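/- Work over $\mathbb{C}$; $\otimes$ denotes $\otimes_{\mathbb C}$. Let $A$ be a cosemisimple Hopf algebra (i.e. the category of finite-dimensional right $A$-comodules is semisimple) with counit $\epsilon$. Let $(E,d)$ be a bicovariant first order differential calculus over $A$: an $A$-bimodule $E$ with a linear map $d:A\to E$ such that $d(ab)=d(a)b+a\,d(b)$, every element of $E$ is a finite sum $\sum_k a_k\,db_k$, and $\sum_k a_k\,db_k=0$ implies $\sum_k\Delta(a_k)(\mathrm{id}\otimes d)\Delta(b_k)=0$ and $\sum_k\Delta(a_k)(d\otimes\mathrm{id})\Delta(b_k)=0$. Then $\Delta_E(a\,db)=\Delta(a)(\mathrm{id}\otimes d)\Delta(b)$ and ${}_E\Delta(a\,db)=\Delta(a)(d\otimes\mathrm{id})\Delta(b)$ make $E$ a bicovariant bimodule, and $E\otimes_AE$ carries the induced coactions $\Delta_{E\otimes_A E}$ and ${}_{E\otimes_A E}\Delta$. Let ${}_0E$ be the space of left-invariant elements of $E$, assumed finite-dimensional; ${}_0E\otimes{}_0E$ is identified with the left-invariant elements of $E\otimes_AE$. Let $\sigma:E\otimes_AE\to E\otimes_AE$ be the canonical braiding,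 the unique $A$-bimodule map with $\sigma(\omega\otimes_A\eta)=\eta\otimes_A\omega$ for $\omega$ left-invariant and $\eta$ right-invariant, and ${}_0\sigma$ its restriction to ${}_0E\otimes{}_0E$. Let $\Omega^2=(E\otimes_AE)/\ker(\sigma-1)$, let $\wedge:E\otimes_AE\to\Omega^2$ be the quotient map, and $d:E\to\Omega^2$, $d(a\,db)=da\wedge db$. Assume that ${}_0\sigma$ is diagonalisable. Let ${}_0E\otimes^{\rm sym}{}_0E=\ker\wedge\cap({}_0E\otimes{}_0E)$ and let ${}_0P_{\rm sym}$ be the idempotent of ${}_0E\otimes{}_0E$ with this range and with kernel the sum of the eigenspaces of ${}_0\sigma$ for eigenvalues $\neq1$. Let $g$ be a bi-invariant pseudo-Riemannian metric, that is, a right $A$-linear map $g:E\otimes_AE\to A$ such that $g\circ\sigma=g$; if $g(\rho\otimes_A\nu)=0$ for all $\nu\in E$ then $\rho=0$; and $(\mathrm{id}\otimes\epsilon g)\Delta_{E\otimes_AE}=g=(\epsilon g\otimes\mathrm{id})\,{}_{E\otimes_AE}\Delta$. Then $g$ takes values in $\mathbb{C}1$ on ${}_0E\otimes{}_0E$. A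 connection is a linear map $\nabla:E\to E\otimes_AE$ with $\nabla(\rho a)=\nabla(\rho)a+\rho\otimes_A da$. It is torsionless if $\wedge\circ\nabla+d=0$, left- (right-)covariant if it intertwines the left (right) coactions, and bicovariant if it is both. A left-covariant connection maps ${}_0E$ into ${}_0E\otimes{}_0E$; put $$\Pi^0_g(\nabla)=2(\mathrm{id}\otimes g)(\sigma\otimes\mathrm{id})(\nabla\otimes\mathrm{id})\,{}_0P_{\rm sym}:{}_0E\otimes{}_0E\to{}_0E,$$ and let $\Pi_g(\nabla):E\otimes_AE\to E$ be given by $\Pi_g(\nabla)(xa)=\Pi^0_g(\nabla)(x)a+g(x)\,da$ for $x\in{}_0E\otimes{}_0E$, $a\in A$. The connection $\nabla$ is compatible with $g$ if $\Pi_g(\nabla)=d\circ g$. A Levi-Civita connection for $(E,d,g)$ is a left-covariant torsionless connection compatible with $g$. Theorem. If the linear map $$\widetilde{\Phi_g}:\operatorname{Hom}_{\mathbb C}({}_0E,{}_0E\otimes^{\rm sym}{}_0E)\to\operatorname{Hom}_{\mathbb C}({}_0E\otimes^{\rm sym}{}_0E,{}_0E),\qquad \widetilde{\Phi_g}(L)=2(\mathrm{id}\otimes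 g)(\sigma\otimes\mathrm{id})(L\otimes\mathrm{id})\,{}_0P_{\rm sym},$$ is an isomorphism, then there is a unique Levi-Civita connection for $(E,d,g)$, and it is bicovariant. -/

import Mathlib

set_option linter.unusedSectionVars false

noncomputable section

open scoped TensorProduct
open TensorProduct Coalgebra HopfAlgebra MulOpposite

namespace Bicov

universe u v

section Tensor

variable (A : Type u) [Ring A] [HopfAlgebra ℂ A]
  (E : Type v) [AddCommGroup E] [Module ℂ E] [Module A E] [Module Aᵐᵒᵖ E]
  [SMulCommClass A Aᵐᵒᵖ E] [IsScalarTower ℂ A E] [IsScalarTower ℂ Aᵐᵒᵖ E]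

/-- Left multiplication `a ↦ (e ↦ a e)`. -/
def lm : A →ₗ[ℂ] E →ₗ[ℂ] E := (Algebra.lsmul ℂ ℂ E : A →ₐ[ℂ] Module.End ℂ E).toLinearMap

/-- Right multiplication `a ↦ (e ↦ e a)`. -/
def rm : A →ₗ[ℂ] E →ₗ[ℂ] E :=
  (Algebra.lsmul ℂ ℂ E : Aᵐᵒᵖ →ₐ[ℂ] Module.End ℂ E).toLinearMap ∘ₗ
    (opLinearEquiv ℂ : A ≃ₗ[ℂ] Aᵐᵒᵖ).toLinearMap

variable {A E}

@[simp] lemma lm_apply (a : A) (e : E) : lm A E a e = a • e := rfl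
@[simp] lemma rm_apply (a : A) (e : E) : rm A E a e = op a • e := rfl

variable (A E)

/-- The relations `e a ⊗ f = e ⊗ a f`. -/
def balRel : Submodule ℂ (E ⊗[ℂ] E) :=
  Submodule.span ℂ {x | ∃ (e : E) (a : A) (f : E), x = (op a • e) ⊗ₜ[ℂ] f - e ⊗ₜ[ℂ] (a • f)}

/-- The tensor product `E ⊗_A E` over the (noncommutative) algebra `A`. -/
abbrev TensorA : Type v := (E ⊗[ℂ] E) ⧸ balRel A E

/-- The canonical projection `E ⊗_ℂ E → E ⊗_A E`. -/
def mkA : E ⊗[ℂ] E →ₗ[ℂ] TensorA A E := (balRel A E).mkQ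

variable {E}

/-- The elementary tensor `e ⊗_A f`. -/
def tmulA (e f : E) : TensorA A E := mkA A E (e ⊗ₜ f)

variable {A}

lemma mkA_tmul (e f : E) : mkA A E (e ⊗ₜ f) = tmulA A e f := rfl

lemma tmulA_bal (e : E) (a : A) (f : E) : tmulA A (op a • e) f = tmulA A e (a • f) := by
  refine (Submodule.Quotient.eq _).2 (Submodule.subset_span ⟨e, a, f, rfl⟩)

variable {N : Type*} [AddCommGroup N] [Module ℂ N]

/-- Linear maps out of `E ⊗_A E`. -/
def liftA (φ : E ⊗[ℂ] E →ₗ[ℂ] N)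
    (h : ∀ (e : E) (a : A) (f : E), φ ((op a • e) ⊗ₜ f) = φ (e ⊗ₜ (a • f))) :
    TensorA A E →ₗ[ℂ] N :=
  (balRel A E).liftQ φ (by
    refine Submodule.span_le.2 ?_
    rintro x ⟨e, a, f, rfl⟩
    simp [h])

@[simp] lemma liftA_mkA (φ : E ⊗[ℂ] E →ₗ[ℂ] N) (h) (x : E ⊗[ℂ] E) :
    liftA (A := A) φ h (mkA A E x) = φ x := rfl

@[simp] lemma liftA_tmulA (φ : E ⊗[ℂ] E →ₗ[ℂ] N) (h) (e f : E) :
    liftA (A := A) φ h (tmulA A e f) = φ (e ⊗ₜ f) := rfl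

lemma tensorA_ext {φ ψ : TensorA A E →ₗ[ℂ] N}
    (h : ∀ e f, φ (tmulA A e f) = ψ (tmulA A e f)) : φ = ψ := by
  refine Submodule.linearMap_qext _ ?_
  exact TensorProduct.ext' h

variable (E)

/-- The left action of `a` on `E ⊗_A E`. -/
def lA (a : A) : TensorA A E →ₗ[ℂ] TensorA A E :=
  liftA (mkA A E ∘ₗ (lm A E a).rTensor E) (by
    intro e b f
    simp only [LinearMap.comp_apply, LinearMap.rTensor_tmul, lm_apply, mkA_tmul]
    rw [smul_comm, tmulA_bal])

/-- The right action of `a` on `E ⊗_A E`. -/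
def rA (a : A) : TensorA A E →ₗ[ℂ] TensorA A E :=
  liftA (mkA A E ∘ₗ (rm A E a).lTensor E) (by
    intro e b f
    simp only [LinearMap.comp_apply, LinearMap.lTensor_tmul, rm_apply, mkA_tmul]
    rw [tmulA_bal, smul_comm])

variable {E}

@[simp] lemma lA_tmulA (a : A) (e f : E) : lA E a (tmulA A e f) = tmulA A (a • e) f := rfl
@[simp] lemma rA_tmulA (a : A) (e f : E) : rA E a (tmulA A e f) = tmulA A e (op a • f) := rfl

variable (A E)

/-- A bicovariant bimodule structure on the `A`-bimodule `E`: commuting left and right coactions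
that are compatible with the bimodule structure.  In the last four laws
`Δ(a) · (b ⊗ e) = a₁ b ⊗ a₂ e`, `(b ⊗ e) · Δ(a) = b a₁ ⊗ e a₂`, and similarly on `E ⊗ A`. -/
structure BicovariantBimodule where
  coL : E →ₗ[ℂ] A ⊗[ℂ] E
  coR : E →ₗ[ℂ] E ⊗[ℂ] A
  coL_coassoc : ∀ e, TensorProduct.assoc ℂ A A E ((comul (R := ℂ) (A := A)).rTensor E (coL e)) =
    coL.lTensor A (coL e)
  coL_counit : ∀ e, (counit (R := ℂ) (A := A)).rTensor E (coL e) = 1 ⊗ₜ e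
  coR_coassoc : ∀ e, TensorProduct.assoc ℂ E A A (coR.rTensor A (coR e)) =
    (comul (R := ℂ) (A := A)).lTensor E (coR e)
  coR_counit : ∀ e, (counit (R := ℂ) (A := A)).lTensor E (coR e) = e ⊗ₜ 1
  coL_coR : ∀ e, TensorProduct.assoc ℂ A E A (coL.rTensor A (coR e)) = coR.lTensor A (coL e)
  coL_lsmul : ∀ (a : A) (e : E),
    coL (a • e) = map₂ (LinearMap.mul ℂ A) (lm A E) (comul a) (coL e)
  coL_rsmul : ∀ (a : A) (e : E),
    coL (op a • e) = map₂ (LinearMap.mul ℂ A).flip (rm A E) (comul a) (coL e)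
  coR_lsmul : ∀ (a : A) (e : E),
    coR (a • e) = map₂ (lm A E) (LinearMap.mul ℂ A) (comul a) (coR e)
  coR_rsmul : ∀ (a : A) (e : E),
    coR (op a • e) = map₂ (rm A E) (LinearMap.mul ℂ A).flip (comul a) (coR e)

/-- A bicovariant first order differential calculus `(E, d)` over `A`. -/
structure BicovariantCalculus where
  d : A →ₗ[ℂ] E
  leibniz : ∀ a b : A, d (a * b) = op b • d a + a • d b
  generates : ∀ ρ : E, ∃ (n : ℕ) (a b : Fin n → A), ρ = ∑ k, a k • d (b k)
  left_covariant : ∀ (n : ℕ) (a b : Fin n → A), ∑ k, a k • d (b k) = 0 →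
    ∑ k, map₂ (LinearMap.mul ℂ A) (lm A E) (comul (a k)) (d.lTensor A (comul (b k))) = 0
  right_covariant : ∀ (n : ℕ) (a b : Fin n → A), ∑ k, a k • d (b k) = 0 →
    ∑ k, map₂ (lm A E) (LinearMap.mul ℂ A) (comul (a k)) (d.rTensor A (comul (b k))) = 0

end Tensor

namespace BicovariantCalculus

variable {A : Type u} [Ring A] [HopfAlgebra ℂ A]
  {E : Type v} [AddCommGroup E] [Module ℂ E] [Module A E] [Module Aᵐᵒᵖ E]
  [SMulCommClass A Aᵐᵒᵖ E] [IsScalarTower ℂ A E] [IsScalarTower ℂ Aᵐᵒᵖ E]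
  (C : BicovariantCalculus A E)

/-- The map `A ⊗ A → E`, `a ⊗ b ↦ a db`. -/
def adb : A ⊗[ℂ] A →ₗ[ℂ] E := lift ((lm A E).compl₂ C.d)

@[simp] lemma adb_tmul (a b : A) : C.adb (a ⊗ₜ b) = a • C.d b := rfl

lemma adb_surjective : Function.Surjective C.adb := by
  intro ρ
  obtain ⟨n, a, b, rfl⟩ := C.generates ρ
  exact ⟨∑ k, a k ⊗ₜ b k, by simp⟩

lemma exists_fin_sum {M N : Type*} [AddCommGroup M] [Module ℂ M] [AddCommGroup N] [Module ℂ N]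
    (x : M ⊗[ℂ] N) : ∃ (n : ℕ) (a : Fin n → M) (b : Fin n → N), x = ∑ k, a k ⊗ₜ b k := by
  obtain ⟨S, hS⟩ := TensorProduct.exists_finset x
  refine ⟨S.card, fun k => (S.equivFin.symm k).1.1, fun k => (S.equivFin.symm k).1.2, ?_⟩
  rw [hS, ← Finset.sum_coe_sort S]
  exact (Equiv.sum_comp S.equivFin.symm (fun i : S => (i.1.1 ⊗ₜ[ℂ] i.1.2 : M ⊗[ℂ] N))).symm

variable {N : Type*} [AddCommGroup N] [Module ℂ N]

/-- The linear map `E → N` sending `a db` to `φ (a ⊗ b)`. -/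
def descend (φ : A ⊗[ℂ] A →ₗ[ℂ] N) (h : ∀ x, C.adb x = 0 → φ x = 0) : E →ₗ[ℂ] N :=
  (LinearMap.ker C.adb).liftQ φ h ∘ₗ (C.adb.quotKerEquivOfSurjective C.adb_surjective).symm

@[simp] lemma descend_adb (φ : A ⊗[ℂ] A →ₗ[ℂ] N) (h) (x : A ⊗[ℂ] A) :
    C.descend φ h (C.adb x) = φ x := by
  have : (C.adb.quotKerEquivOfSurjective C.adb_surjective).symm (C.adb x) =
      (LinearMap.ker C.adb).mkQ x := by
    rw [LinearEquiv.symm_apply_eq]; rfl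
  simp only [descend, LinearMap.comp_apply, LinearEquiv.coe_coe, this]
  rfl

@[simp] lemma descend_smul_d (φ : A ⊗[ℂ] A →ₗ[ℂ] N) (h) (a b : A) :
    C.descend φ h (a • C.d b) = φ (a ⊗ₜ b) := C.descend_adb φ h (a ⊗ₜ b)

lemma ext_adb {φ ψ : E →ₗ[ℂ] N} (h : ∀ a b : A, φ (a • C.d b) = ψ (a • C.d b)) : φ = ψ := by
  have : φ ∘ₗ C.adb = ψ ∘ₗ C.adb := TensorProduct.ext' h
  ext e
  obtain ⟨x, rfl⟩ := C.adb_surjective e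
  exact LinearMap.congr_fun this x

/-- The left coaction of `E`: `a db ↦ Δ(a) (id ⊗ d) Δ(b)`. -/
def coL : E →ₗ[ℂ] A ⊗[ℂ] E :=
  C.descend (lift ((map₂ (LinearMap.mul ℂ A) (lm A E)).compl₁₂ comul (C.d.lTensor A ∘ₗ comul)))
    (by
      intro x hx
      obtain ⟨n, a, b, rfl⟩ := exists_fin_sum x
      simpa using C.left_covariant n a b (by simpa using hx))

/-- The right coaction of `E`: `a db ↦ Δ(a) (d ⊗ id) Δ(b)`. -/
def coR : E →ₗ[ℂ] E ⊗[ℂ] A :=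
  C.descend (lift ((map₂ (lm A E) (LinearMap.mul ℂ A)).compl₁₂ comul (C.d.rTensor A ∘ₗ comul)))
    (by
      intro x hx
      obtain ⟨n, a, b, rfl⟩ := exists_fin_sum x
      simpa using C.right_covariant n a b (by simpa using hx))

lemma coL_adb (a b : A) : C.coL (a • C.d b) =
    map₂ (LinearMap.mul ℂ A) (lm A E) (comul a) (C.d.lTensor A (comul b)) := by
  simp [coL]

lemma coR_adb (a b : A) : C.coR (a • C.d b) =
    map₂ (lm A E) (LinearMap.mul ℂ A) (comul a) (C.d.rTensor A (comul b)) := by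
  simp [coR]

section Laws

lemma actLL_mul (x y : A ⊗[ℂ] A) (z : A ⊗[ℂ] E) :
    map₂ (LinearMap.mul ℂ A) (lm A E) (x * y) z =
      map₂ (LinearMap.mul ℂ A) (lm A E) x (map₂ (LinearMap.mul ℂ A) (lm A E) y z) := by
  induction x with
  | zero => simp
  | add x₁ x₂ h₁ h₂ => simp [add_mul, h₁, h₂]
  | tmul a a' =>
    induction y with
    | zero => simp
    | add x₁ x₂ h₁ h₂ => simp [mul_add, h₁, h₂]
    | tmul b b' =>
      induction z with
      | zero => simp
      | add x₁ x₂ h₁ h₂ => simp only [map_add, h₁, h₂]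
      | tmul c e => simp [mul_assoc, mul_smul]

lemma actRL_mul (x y : A ⊗[ℂ] A) (z : E ⊗[ℂ] A) :
    map₂ (lm A E) (LinearMap.mul ℂ A) (x * y) z =
      map₂ (lm A E) (LinearMap.mul ℂ A) x (map₂ (lm A E) (LinearMap.mul ℂ A) y z) := by
  induction x with
  | zero => simp
  | add x₁ x₂ h₁ h₂ => simp [add_mul, h₁, h₂]
  | tmul a a' =>
    induction y with
    | zero => simp
    | add x₁ x₂ h₁ h₂ => simp [mul_add, h₁, h₂]
    | tmul b b' =>
      induction z with
      | zero => simp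
      | add x₁ x₂ h₁ h₂ => simp only [map_add, h₁, h₂]
      | tmul c e => simp [mul_assoc, mul_smul]

lemma actL_comm (x y : A ⊗[ℂ] A) (z : A ⊗[ℂ] E) :
    map₂ (LinearMap.mul ℂ A) (lm A E) x (map₂ (LinearMap.mul ℂ A).flip (rm A E) y z) =
      map₂ (LinearMap.mul ℂ A).flip (rm A E) y (map₂ (LinearMap.mul ℂ A) (lm A E) x z) := by
  induction x with
  | zero => simp
  | add x₁ x₂ h₁ h₂ => simp only [map_add, LinearMap.add_apply, h₁, h₂]
  | tmul a a' =>
    induction y with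
    | zero => simp
    | add x₁ x₂ h₁ h₂ => simp only [map_add, LinearMap.add_apply, h₁, h₂]
    | tmul b b' =>
      induction z with
      | zero => simp
      | add x₁ x₂ h₁ h₂ => simp only [map_add, h₁, h₂]
      | tmul c e => simp [mul_assoc, smul_comm]

lemma actR_comm (x y : A ⊗[ℂ] A) (z : E ⊗[ℂ] A) :
    map₂ (lm A E) (LinearMap.mul ℂ A) x (map₂ (rm A E) (LinearMap.mul ℂ A).flip y z) =
      map₂ (rm A E) (LinearMap.mul ℂ A).flip y (map₂ (lm A E) (LinearMap.mul ℂ A) x z) := by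
  induction x with
  | zero => simp
  | add x₁ x₂ h₁ h₂ => simp only [map_add, LinearMap.add_apply, h₁, h₂]
  | tmul a a' =>
    induction y with
    | zero => simp
    | add x₁ x₂ h₁ h₂ => simp only [map_add, LinearMap.add_apply, h₁, h₂]
    | tmul b b' =>
      induction z with
      | zero => simp
      | add x₁ x₂ h₁ h₂ => simp only [map_add, h₁, h₂]
      | tmul c e => simp [mul_assoc, smul_comm]

lemma lTensor_d_mul (x y : A ⊗[ℂ] A) : C.d.lTensor A (x * y) =
    map₂ (LinearMap.mul ℂ A).flip (rm A E) y (C.d.lTensor A x) +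
      map₂ (LinearMap.mul ℂ A) (lm A E) x (C.d.lTensor A y) := by
  induction x with
  | zero => simp
  | add x₁ x₂ h₁ h₂ => simp only [add_mul, map_add, h₁, h₂, LinearMap.add_apply]; abel
  | tmul a a' =>
    induction y with
    | zero => simp
    | add x₁ x₂ h₁ h₂ => simp only [mul_add, map_add, h₁, h₂, LinearMap.add_apply]; abel
    | tmul b b' => simp [C.leibniz, tmul_add]

lemma rTensor_d_mul (x y : A ⊗[ℂ] A) : C.d.rTensor A (x * y) =
    map₂ (rm A E) (LinearMap.mul ℂ A).flip y (C.d.rTensor A x) +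
      map₂ (lm A E) (LinearMap.mul ℂ A) x (C.d.rTensor A y) := by
  induction x with
  | zero => simp
  | add x₁ x₂ h₁ h₂ => simp only [add_mul, map_add, h₁, h₂, LinearMap.add_apply]; abel
  | tmul a a' =>
    induction y with
    | zero => simp
    | add x₁ x₂ h₁ h₂ => simp only [mul_add, map_add, h₁, h₂, LinearMap.add_apply]; abel
    | tmul b b' => simp [C.leibniz, add_tmul]

lemma rsmul_adb (a b c : A) :
    op a • (b • C.d c) = b • C.d (c * a) - (b * c) • C.d a := by
  rw [C.leibniz, smul_add, mul_smul, add_sub_cancel_right]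
  exact (smul_comm _ _ _).symm

lemma coL_lsmul (a : A) (e : E) : C.coL (a • e) =
    map₂ (LinearMap.mul ℂ A) (lm A E) (comul a) (C.coL e) := by
  have : C.coL ∘ₗ lm A E a = map₂ (LinearMap.mul ℂ A) (lm A E) (comul a) ∘ₗ C.coL := by
    refine C.ext_adb fun b c => ?_
    simp only [LinearMap.comp_apply, lm_apply, ← mul_smul, coL_adb, Bialgebra.comul_mul, actLL_mul]
  exact LinearMap.congr_fun this e

lemma coL_rsmul (a : A) (e : E) : C.coL (op a • e) =
    map₂ (LinearMap.mul ℂ A).flip (rm A E) (comul a) (C.coL e) := by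
  have : C.coL ∘ₗ rm A E a = map₂ (LinearMap.mul ℂ A).flip (rm A E) (comul a) ∘ₗ C.coL := by
    refine C.ext_adb fun b c => ?_
    simp only [LinearMap.comp_apply, rm_apply, rsmul_adb, map_sub, coL_adb, Bialgebra.comul_mul,
      actLL_mul, lTensor_d_mul, map_add, actL_comm, add_sub_cancel_right]
  exact LinearMap.congr_fun this e

lemma coR_lsmul (a : A) (e : E) : C.coR (a • e) =
    map₂ (lm A E) (LinearMap.mul ℂ A) (comul a) (C.coR e) := by
  have : C.coR ∘ₗ lm A E a = map₂ (lm A E) (LinearMap.mul ℂ A) (comul a) ∘ₗ C.coR := by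
    refine C.ext_adb fun b c => ?_
    simp only [LinearMap.comp_apply, lm_apply, ← mul_smul, coR_adb, Bialgebra.comul_mul, actRL_mul]
  exact LinearMap.congr_fun this e

lemma coR_rsmul (a : A) (e : E) : C.coR (op a • e) =
    map₂ (rm A E) (LinearMap.mul ℂ A).flip (comul a) (C.coR e) := by
  have : C.coR ∘ₗ rm A E a = map₂ (rm A E) (LinearMap.mul ℂ A).flip (comul a) ∘ₗ C.coR := by
    refine C.ext_adb fun b c => ?_
    simp only [LinearMap.comp_apply, rm_apply, rsmul_adb, map_sub, coR_adb, Bialgebra.comul_mul,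
      actRL_mul, rTensor_d_mul, map_add, actR_comm, add_sub_cancel_right]
  exact LinearMap.congr_fun this e

lemma coL_counit (e : E) : (counit (R := ℂ) (A := A)).rTensor E (C.coL e) = 1 ⊗ₜ e := by
  have key : ∀ x y : A ⊗[ℂ] A, (counit (R := ℂ) (A := A)).rTensor E
      (map₂ (LinearMap.mul ℂ A) (lm A E) x (C.d.lTensor A y)) =
      map₂ (LinearMap.mul ℂ ℂ) (lm A E) ((counit (R := ℂ) (A := A)).rTensor A x)
        (C.d.lTensor ℂ ((counit (R := ℂ) (A := A)).rTensor A y)) := by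
    intro x y
    induction x with
    | zero => simp
    | add x₁ x₂ h₁ h₂ => simp only [map_add, LinearMap.add_apply, h₁, h₂]
    | tmul a a' =>
      induction y with
      | zero => simp
      | add x₁ x₂ h₁ h₂ => simp only [map_add, h₁, h₂]
      | tmul b b' => simp
  have : (counit (R := ℂ) (A := A)).rTensor E ∘ₗ C.coL = TensorProduct.mk ℂ ℂ E 1 := by
    refine C.ext_adb fun a b => ?_
    simp only [LinearMap.comp_apply, coL_adb, key, rTensor_counit_comul]
    simp
  exact LinearMap.congr_fun this e

lemma coR_counit (e : E) : (counit (R := ℂ) (A := A)).lTensor E (C.coR e) = e ⊗ₜ 1 := by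
  have key : ∀ x y : A ⊗[ℂ] A, (counit (R := ℂ) (A := A)).lTensor E
      (map₂ (lm A E) (LinearMap.mul ℂ A) x (C.d.rTensor A y)) =
      map₂ (lm A E) (LinearMap.mul ℂ ℂ) ((counit (R := ℂ) (A := A)).lTensor A x)
        (C.d.rTensor ℂ ((counit (R := ℂ) (A := A)).lTensor A y)) := by
    intro x y
    induction x with
    | zero => simp
    | add x₁ x₂ h₁ h₂ => simp only [map_add, LinearMap.add_apply, h₁, h₂]
    | tmul a a' =>
      induction y with
      | zero => simp
      | add x₁ x₂ h₁ h₂ => simp only [map_add, h₁, h₂]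
      | tmul b b' => simp
  have : (counit (R := ℂ) (A := A)).lTensor E ∘ₗ C.coR = (TensorProduct.mk ℂ E ℂ).flip 1 := by
    refine C.ext_adb fun a b => ?_
    simp only [LinearMap.comp_apply, coR_adb, key, lTensor_counit_comul]
    simp
  exact LinearMap.congr_fun this e

lemma coL_coassoc (e : E) :
    TensorProduct.assoc ℂ A A E ((comul (R := ℂ) (A := A)).rTensor E (C.coL e)) =
      C.coL.lTensor A (C.coL e) := by
  have key₀ : ∀ (x y : A ⊗[ℂ] A) (a b : A), TensorProduct.assoc ℂ A A E
      ((x * y) ⊗ₜ[ℂ] (a • C.d b)) =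
      map₂ (LinearMap.mul ℂ A) (map₂ (LinearMap.mul ℂ A) (lm A E))
        (TensorProduct.assoc ℂ A A A (x ⊗ₜ a))
        ((C.d.lTensor A).lTensor A (TensorProduct.assoc ℂ A A A (y ⊗ₜ b))) := by
    intro x y a b
    induction x with
    | zero => simp
    | add x₁ x₂ h₁ h₂ => simp [add_mul, add_tmul, h₁, h₂]
    | tmul c c' =>
      induction y with
      | zero => simp
      | add x₁ x₂ h₁ h₂ => simp [mul_add, add_tmul, h₁, h₂]
      | tmul f f' => simp
  have key₁ : ∀ x y : A ⊗[ℂ] A, TensorProduct.assoc ℂ A A E ((comul (R := ℂ) (A := A)).rTensor E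
      (map₂ (LinearMap.mul ℂ A) (lm A E) x (C.d.lTensor A y))) =
      map₂ (LinearMap.mul ℂ A) (map₂ (LinearMap.mul ℂ A) (lm A E))
        (TensorProduct.assoc ℂ A A A ((comul (R := ℂ) (A := A)).rTensor A x))
        ((C.d.lTensor A).lTensor A
          (TensorProduct.assoc ℂ A A A ((comul (R := ℂ) (A := A)).rTensor A y))) := by
    intro x y
    induction x with
    | zero => simp
    | add x₁ x₂ h₁ h₂ => simp only [map_add, LinearMap.add_apply, h₁, h₂]
    | tmul a a' =>
      induction y with
      | zero => simp
      | add x₁ x₂ h₁ h₂ => simp only [map_add, h₁, h₂]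
      | tmul b b' =>
        simp only [LinearMap.lTensor_tmul, map₂_apply_tmul, map_tmul, LinearMap.rTensor_tmul,
          LinearMap.mul_apply', Bialgebra.comul_mul, lm_apply, key₀]
  have key₂ : ∀ x y : A ⊗[ℂ] A, C.coL.lTensor A
      (map₂ (LinearMap.mul ℂ A) (lm A E) x (C.d.lTensor A y)) =
      map₂ (LinearMap.mul ℂ A) (map₂ (LinearMap.mul ℂ A) (lm A E))
        ((comul (R := ℂ) (A := A)).lTensor A x)
        ((C.d.lTensor A).lTensor A ((comul (R := ℂ) (A := A)).lTensor A y)) := by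
    intro x y
    induction x with
    | zero => simp
    | add x₁ x₂ h₁ h₂ => simp only [map_add, LinearMap.add_apply, h₁, h₂]
    | tmul a a' =>
      induction y with
      | zero => simp
      | add x₁ x₂ h₁ h₂ => simp only [map_add, h₁, h₂]
      | tmul b b' => simp [coL_adb]
  have : (TensorProduct.assoc ℂ A A E).toLinearMap ∘ₗ
      (comul (R := ℂ) (A := A)).rTensor E ∘ₗ C.coL = C.coL.lTensor A ∘ₗ C.coL := by
    refine C.ext_adb fun a b => ?_
    simp only [LinearMap.comp_apply, coL_adb, LinearEquiv.coe_coe, key₁, key₂, coassoc_apply]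
  exact LinearMap.congr_fun this e

lemma coR_coassoc (e : E) :
    TensorProduct.assoc ℂ E A A (C.coR.rTensor A (C.coR e)) =
      (comul (R := ℂ) (A := A)).lTensor E (C.coR e) := by
  have key₀ : ∀ (x : A ⊗[ℂ] A) (y : A ⊗[ℂ] A) (a b : A), TensorProduct.assoc ℂ E A A
      ((map₂ (lm A E) (LinearMap.mul ℂ A) x (C.d.rTensor A y)) ⊗ₜ[ℂ] (a * b)) =
      map₂ (lm A E) (map₂ (LinearMap.mul ℂ A) (LinearMap.mul ℂ A))
        (TensorProduct.assoc ℂ A A A (x ⊗ₜ a))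
        (C.d.rTensor (A ⊗[ℂ] A) (TensorProduct.assoc ℂ A A A (y ⊗ₜ b))) := by
    intro x y a b
    induction x with
    | zero => simp
    | add x₁ x₂ h₁ h₂ => simp [add_tmul, h₁, h₂]
    | tmul c c' =>
      induction y with
      | zero => simp
      | add x₁ x₂ h₁ h₂ => simp only [map_add, add_tmul, h₁, h₂]
      | tmul f f' => simp
  have key₁ : ∀ x y : A ⊗[ℂ] A, TensorProduct.assoc ℂ E A A (C.coR.rTensor A
      (map₂ (lm A E) (LinearMap.mul ℂ A) x (C.d.rTensor A y))) =
      map₂ (lm A E) (map₂ (LinearMap.mul ℂ A) (LinearMap.mul ℂ A))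
        (TensorProduct.assoc ℂ A A A ((comul (R := ℂ) (A := A)).rTensor A x))
        (C.d.rTensor (A ⊗[ℂ] A)
          (TensorProduct.assoc ℂ A A A ((comul (R := ℂ) (A := A)).rTensor A y))) := by
    intro x y
    induction x with
    | zero => simp
    | add x₁ x₂ h₁ h₂ => simp only [map_add, LinearMap.add_apply, h₁, h₂]
    | tmul a a' =>
      induction y with
      | zero => simp
      | add x₁ x₂ h₁ h₂ => simp only [map_add, h₁, h₂]
      | tmul b b' =>
        simp only [map₂_apply_tmul, map_tmul, LinearMap.rTensor_tmul,
          LinearMap.mul_apply', lm_apply, coR_adb, key₀]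
  have key₃ : ∀ (x y : A ⊗[ℂ] A) (a : A) (e : E), (a • e) ⊗ₜ[ℂ] (x * y) =
      map₂ (lm A E) (map₂ (LinearMap.mul ℂ A) (LinearMap.mul ℂ A)) (a ⊗ₜ x) (e ⊗ₜ y) := by
    intro x y a e
    induction x with
    | zero => simp
    | add x₁ x₂ h₁ h₂ => simp only [add_mul, tmul_add, map_add, h₁, h₂, LinearMap.add_apply]
    | tmul c c' =>
      induction y with
      | zero => simp
      | add x₁ x₂ h₁ h₂ => simp only [mul_add, tmul_add, map_add, h₁, h₂]
      | tmul f f' => simp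
  have key₂ : ∀ x y : A ⊗[ℂ] A, (comul (R := ℂ) (A := A)).lTensor E
      (map₂ (lm A E) (LinearMap.mul ℂ A) x (C.d.rTensor A y)) =
      map₂ (lm A E) (map₂ (LinearMap.mul ℂ A) (LinearMap.mul ℂ A))
        ((comul (R := ℂ) (A := A)).lTensor A x)
        (C.d.rTensor (A ⊗[ℂ] A) ((comul (R := ℂ) (A := A)).lTensor A y)) := by
    intro x y
    induction x with
    | zero => simp
    | add x₁ x₂ h₁ h₂ => simp only [map_add, LinearMap.add_apply, h₁, h₂]
    | tmul a a' =>
      induction y with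
      | zero => simp
      | add x₁ x₂ h₁ h₂ => simp only [map_add, h₁, h₂]
      | tmul b b' =>
        simp only [map₂_apply_tmul, map_tmul, LinearMap.rTensor_tmul, LinearMap.lTensor_tmul,
          LinearMap.mul_apply', lm_apply, Bialgebra.comul_mul, key₃]
  have : (TensorProduct.assoc ℂ E A A).toLinearMap ∘ₗ C.coR.rTensor A ∘ₗ C.coR =
      (comul (R := ℂ) (A := A)).lTensor E ∘ₗ C.coR := by
    refine C.ext_adb fun a b => ?_
    simp only [LinearMap.comp_apply, coR_adb, LinearEquiv.coe_coe, key₁, key₂, coassoc_apply]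
  exact LinearMap.congr_fun this e

lemma coL_coR (e : E) :
    TensorProduct.assoc ℂ A E A (C.coL.rTensor A (C.coR e)) = C.coR.lTensor A (C.coL e) := by
  have key₀ : ∀ (x : A ⊗[ℂ] A) (y : A ⊗[ℂ] A) (a b : A), TensorProduct.assoc ℂ A E A
      ((map₂ (LinearMap.mul ℂ A) (lm A E) x (C.d.lTensor A y)) ⊗ₜ[ℂ] (a * b)) =
      map₂ (LinearMap.mul ℂ A) (map₂ (lm A E) (LinearMap.mul ℂ A))
        (TensorProduct.assoc ℂ A A A (x ⊗ₜ a))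
        ((C.d.rTensor A).lTensor A (TensorProduct.assoc ℂ A A A (y ⊗ₜ b))) := by
    intro x y a b
    induction x with
    | zero => simp
    | add x₁ x₂ h₁ h₂ => simp [add_tmul, h₁, h₂]
    | tmul c c' =>
      induction y with
      | zero => simp
      | add x₁ x₂ h₁ h₂ => simp only [map_add, add_tmul, h₁, h₂]
      | tmul f f' => simp
  have key₁ : ∀ x y : A ⊗[ℂ] A, TensorProduct.assoc ℂ A E A (C.coL.rTensor A
      (map₂ (lm A E) (LinearMap.mul ℂ A) x (C.d.rTensor A y))) =
      map₂ (LinearMap.mul ℂ A) (map₂ (lm A E) (LinearMap.mul ℂ A))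
        (TensorProduct.assoc ℂ A A A ((comul (R := ℂ) (A := A)).rTensor A x))
        ((C.d.rTensor A).lTensor A
          (TensorProduct.assoc ℂ A A A ((comul (R := ℂ) (A := A)).rTensor A y))) := by
    intro x y
    induction x with
    | zero => simp
    | add x₁ x₂ h₁ h₂ => simp only [map_add, LinearMap.add_apply, h₁, h₂]
    | tmul a a' =>
      induction y with
      | zero => simp
      | add x₁ x₂ h₁ h₂ => simp only [map_add, h₁, h₂]
      | tmul b b' =>
        simp only [map₂_apply_tmul, map_tmul, LinearMap.rTensor_tmul,
          LinearMap.mul_apply', lm_apply, coL_adb, key₀]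
  have key₂ : ∀ x y : A ⊗[ℂ] A, C.coR.lTensor A
      (map₂ (LinearMap.mul ℂ A) (lm A E) x (C.d.lTensor A y)) =
      map₂ (LinearMap.mul ℂ A) (map₂ (lm A E) (LinearMap.mul ℂ A))
        ((comul (R := ℂ) (A := A)).lTensor A x)
        ((C.d.rTensor A).lTensor A ((comul (R := ℂ) (A := A)).lTensor A y)) := by
    intro x y
    induction x with
    | zero => simp
    | add x₁ x₂ h₁ h₂ => simp only [map_add, LinearMap.add_apply, h₁, h₂]
    | tmul a a' =>
      induction y with
      | zero => simp
      | add x₁ x₂ h₁ h₂ => simp only [map_add, h₁, h₂]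
      | tmul b b' => simp [coR_adb]
  have : (TensorProduct.assoc ℂ A E A).toLinearMap ∘ₗ C.coL.rTensor A ∘ₗ C.coR =
      C.coR.lTensor A ∘ₗ C.coL := by
    refine C.ext_adb fun a b => ?_
    simp only [LinearMap.comp_apply, coL_adb, coR_adb, LinearEquiv.coe_coe, key₁, key₂,
      coassoc_apply]
  exact LinearMap.congr_fun this e

end Laws

/-- The bicovariant bimodule underlying a bicovariant calculus. -/
def toBimodule : BicovariantBimodule A E where
  coL := C.coL
  coR := C.coR
  coL_coassoc := C.coL_coassoc
  coL_counit := C.coL_counit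
  coR_coassoc := C.coR_coassoc
  coR_counit := C.coR_counit
  coL_coR := C.coL_coR
  coL_lsmul := C.coL_lsmul
  coL_rsmul := C.coL_rsmul
  coR_lsmul := C.coR_lsmul
  coR_rsmul := C.coR_rsmul

end BicovariantCalculus

namespace BicovariantBimodule

variable {A : Type u} [Ring A] [HopfAlgebra ℂ A]
  {E : Type v} [AddCommGroup E] [Module ℂ E] [Module A E] [Module Aᵐᵒᵖ E]
  [SMulCommClass A Aᵐᵒᵖ E] [IsScalarTower ℂ A E] [IsScalarTower ℂ Aᵐᵒᵖ E]
  (B : BicovariantBimodule A E)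

/-- The left-invariant elements `₀E = {e | Δ_E(e) = 1 ⊗ e}`. -/
def invL : Submodule ℂ E := LinearMap.eqLocus B.coL (TensorProduct.mk ℂ A E 1)

/-- The right-invariant elements `E₀ = {e | _EΔ(e) = e ⊗ 1}`. -/
def invR : Submodule ℂ E := LinearMap.eqLocus B.coR ((TensorProduct.mk ℂ E A).flip 1)

lemma mem_invL {e : E} : e ∈ B.invL ↔ B.coL e = 1 ⊗ₜ e := Iff.rfl
lemma mem_invR {e : E} : e ∈ B.invR ↔ B.coR e = e ⊗ₜ 1 := Iff.rfl

/-- The left coaction `m ⊗ n ↦ m₍₋₁₎ n₍₋₁₎ ⊗ (m₍₀₎ ⊗_A n₍₀₎)` on `E ⊗_A E`. -/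
def coLT : TensorA A E →ₗ[ℂ] A ⊗[ℂ] TensorA A E :=
  liftA (map (LinearMap.mul' ℂ A) (mkA A E) ∘ₗ
      (tensorTensorTensorComm ℂ A E A E).toLinearMap ∘ₗ map B.coL B.coL) (by
    intro e b f
    simp only [LinearMap.comp_apply, map_tmul, B.coL_rsmul, B.coL_lsmul]
    generalize B.coL e = x
    generalize B.coL f = y
    generalize (comul b : A ⊗[ℂ] A) = z
    induction x with
    | zero => simp
    | add x₁ x₂ h₁ h₂ => simp only [map_add, add_tmul, h₁, h₂]
    | tmul a m =>
      induction y with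
      | zero => simp
      | add x₁ x₂ h₁ h₂ => simp only [map_add, tmul_add, h₁, h₂]
      | tmul c n =>
        induction z with
        | zero => simp
        | add x₁ x₂ h₁ h₂ => simp only [map_add, LinearMap.add_apply, tmul_add, add_tmul, h₁, h₂]
        | tmul f f' => simp [mkA_tmul, tmulA_bal, mul_assoc])

/-- The right coaction `m ⊗ n ↦ (m₍₀₎ ⊗_A n₍₀₎) ⊗ m₍₁₎ n₍₁₎` on `E ⊗_A E`. -/
def coRT : TensorA A E →ₗ[ℂ] TensorA A E ⊗[ℂ] A :=
  liftA (map (mkA A E) (LinearMap.mul' ℂ A) ∘ₗ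
      (tensorTensorTensorComm ℂ E A E A).toLinearMap ∘ₗ map B.coR B.coR) (by
    intro e b f
    simp only [LinearMap.comp_apply, map_tmul, B.coR_rsmul, B.coR_lsmul]
    generalize B.coR e = x
    generalize B.coR f = y
    generalize (comul b : A ⊗[ℂ] A) = z
    induction x with
    | zero => simp
    | add x₁ x₂ h₁ h₂ => simp only [map_add, add_tmul, h₁, h₂]
    | tmul m a =>
      induction y with
      | zero => simp
      | add x₁ x₂ h₁ h₂ => simp only [map_add, tmul_add, h₁, h₂]
      | tmul n c =>
        induction z with
        | zero => simp
        | add x₁ x₂ h₁ h₂ => simp only [map_add, LinearMap.add_apply, tmul_add, add_tmul, h₁, h₂]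
        | tmul f f' => simp [mkA_tmul, tmulA_bal, mul_assoc])

/-- The left-invariant elements of `E ⊗_A E`. -/
def invLT : Submodule ℂ (TensorA A E) :=
  LinearMap.eqLocus B.coLT (TensorProduct.mk ℂ A (TensorA A E) 1)

lemma mem_invLT {x : TensorA A E} : x ∈ B.invLT ↔ B.coLT x = 1 ⊗ₜ x := Iff.rfl

/-- The linear map `E → E`, `e ↦ S(e₍₋₁₎) e₍₀₎`. -/
def projL₀ : E →ₗ[ℂ] E := lift (lm A E ∘ₗ antipode ℂ) ∘ₗ B.coL

/-- The linear map `E → E`, `e ↦ e₍₀₎ S(e₍₁₎)`. -/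
def projR : E →ₗ[ℂ] E := lift (rm A E ∘ₗ antipode ℂ).flip ∘ₗ B.coR

lemma projL₀_of_mem {e : E} (he : e ∈ B.invL) : B.projL₀ e = e := by
  simp [projL₀, B.mem_invL.1 he]

lemma projR_of_mem {e : E} (he : e ∈ B.invR) : B.projR e = e := by
  simp [projR, B.mem_invR.1 he]

lemma projL₀_lsmul (a : A) (e : E) : B.projL₀ (a • e) = counit (R := ℂ) a • B.projL₀ e := by
  simp only [projL₀, LinearMap.comp_apply, B.coL_lsmul]
  have key : ∀ (x : A ⊗[ℂ] A) (y : A ⊗[ℂ] E), lift (lm A E ∘ₗ antipode ℂ)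
      (map₂ (LinearMap.mul ℂ A) (lm A E) x y) =
      lift ((lm A E ∘ₗ antipode ℂ).compl₂ (lm A E
        (LinearMap.mul' ℂ A ((antipode ℂ).rTensor A x)))) y := by
    intro x y
    induction y with
    | zero => simp
    | add x₁ x₂ h₁ h₂ => simp only [map_add, h₁, h₂]
    | tmul c e =>
      induction x with
      | zero => simp
      | add x₁ x₂ h₁ h₂ =>
        simp only [map_add, LinearMap.add_apply, h₁, h₂, lift.tmul, LinearMap.compl₂_apply]
      | tmul f f' => simp [antipode_mul_antidistrib, mul_smul]
  rw [key, mul_antipode_rTensor_comul_apply]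
  generalize B.coL e = y
  induction y with
  | zero => simp
  | add x₁ x₂ h₁ h₂ => simp only [map_add, h₁, h₂, smul_add]
  | tmul c e => simp

lemma projR_rsmul (a : A) (e : E) : B.projR (op a • e) = counit (R := ℂ) a • B.projR e := by
  simp only [projR, LinearMap.comp_apply, B.coR_rsmul]
  have key : ∀ (x : A ⊗[ℂ] A) (y : E ⊗[ℂ] A), lift (rm A E ∘ₗ antipode ℂ).flip
      (map₂ (rm A E) (LinearMap.mul ℂ A).flip x y) =
      lift ((rm A E ∘ₗ antipode ℂ).compl₂ (rm A E
        (LinearMap.mul' ℂ A ((antipode ℂ).lTensor A x)))).flip y := by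
    intro x y
    induction y with
    | zero => simp
    | add x₁ x₂ h₁ h₂ => simp only [map_add, h₁, h₂]
    | tmul e c =>
      induction x with
      | zero => simp
      | add x₁ x₂ h₁ h₂ =>
        simp only [map_add, LinearMap.add_apply, h₁, h₂, lift.tmul, LinearMap.compl₂_apply,
          LinearMap.flip_apply]
      | tmul f f' => simp [antipode_mul_antidistrib, mul_smul]
  rw [key, mul_antipode_lTensor_comul_apply]
  generalize B.coR e = y
  induction y with
  | zero => simp
  | add x₁ x₂ h₁ h₂ => simp only [map_add, h₁, h₂, smul_add]
  | tmul e c => simp [Algebra.algebraMap_eq_smul_one]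

/-- `e₍₋₁₎ (S(e₍₀₎₍₋₁₎) e₍₀₎₍₀₎) = e`. -/
lemma lm_projL₀ (e : E) : lift (lm A E) (B.projL₀.lTensor A (B.coL e)) = e := by
  have key : ∀ z : A ⊗[ℂ] E, lift (lm A E)
      ((lift (lm A E ∘ₗ antipode ℂ)).lTensor A
        (TensorProduct.assoc ℂ A A E ((comul (R := ℂ) (A := A)).rTensor E z))) =
      TensorProduct.lid ℂ E ((counit (R := ℂ) (A := A)).rTensor E z) := by
    intro z
    induction z with
    | zero => simp
    | add x₁ x₂ h₁ h₂ => simp only [map_add, h₁, h₂]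
    | tmul c e =>
      have : ∀ y : A ⊗[ℂ] A, lift (lm A E)
          ((lift (lm A E ∘ₗ antipode ℂ)).lTensor A (TensorProduct.assoc ℂ A A E (y ⊗ₜ e))) =
          LinearMap.mul' ℂ A ((antipode ℂ).lTensor A y) • e := by
        intro y
        induction y with
        | zero => simp
        | add x₁ x₂ h₁ h₂ => simp only [map_add, add_tmul, h₁, h₂, add_smul]
        | tmul f f' => simp [mul_smul]
      simp [this]
  rw [projL₀, LinearMap.lTensor_comp, LinearMap.comp_apply, ← B.coL_coassoc, key, B.coL_counit]
  simp

/-- `(e₍₀₎₍₀₎ S(e₍₀₎₍₁₎)) e₍₁₎ = e`. -/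
lemma rm_projR (e : E) : lift (rm A E).flip (B.projR.rTensor A (B.coR e)) = e := by
  have key : ∀ z : E ⊗[ℂ] A, lift (rm A E).flip
      ((lift (rm A E ∘ₗ antipode ℂ).flip).rTensor A
        ((TensorProduct.assoc ℂ E A A).symm ((comul (R := ℂ) (A := A)).lTensor E z))) =
      TensorProduct.rid ℂ E ((counit (R := ℂ) (A := A)).lTensor E z) := by
    intro z
    induction z with
    | zero => simp
    | add x₁ x₂ h₁ h₂ => simp only [map_add, h₁, h₂]
    | tmul e c =>
      have : ∀ y : A ⊗[ℂ] A, lift (rm A E).flip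
          ((lift (rm A E ∘ₗ antipode ℂ).flip).rTensor A
            ((TensorProduct.assoc ℂ E A A).symm (e ⊗ₜ y))) =
          op (LinearMap.mul' ℂ A ((antipode ℂ).rTensor A y)) • e := by
        intro y
        induction y with
        | zero => simp
        | add x₁ x₂ h₁ h₂ => simp only [map_add, tmul_add, h₁, h₂, add_smul, op_add]
        | tmul f f' => simp [mul_smul]
      simp [this, Algebra.algebraMap_eq_smul_one]
  rw [projR, LinearMap.rTensor_comp, LinearMap.comp_apply]
  rw [← (TensorProduct.assoc ℂ E A A).symm_apply_apply (B.coR.rTensor A (B.coR e)),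
    B.coR_coassoc, key, B.coR_counit]
  simp

/-- `projL₀ (e b) = S(b₁) (projL₀ e) b₂`. -/
lemma projL₀_rsmul (b : A) (e : E) : B.projL₀ (op b • e) =
    lift ((lm A E ∘ₗ antipode ℂ).compl₂ ((rm A E).flip (B.projL₀ e))) (comul b) := by
  simp only [projL₀, LinearMap.comp_apply, B.coL_rsmul]
  generalize B.coL e = y
  generalize (comul b : A ⊗[ℂ] A) = x
  induction x with
  | zero => simp
  | add x₁ x₂ h₁ h₂ => simp only [map_add, LinearMap.add_apply, h₁, h₂]
  | tmul f f' =>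
    induction y with
    | zero => simp
    | add x₁ x₂ h₁ h₂ =>
      simp only [lift.tmul, LinearMap.compl₂_apply, LinearMap.flip_apply] at h₁ h₂
      simp only [map_add, h₁, h₂, lift.tmul, LinearMap.compl₂_apply, LinearMap.flip_apply,
        LinearMap.add_apply]
    | tmul c e => simp [antipode_mul_antidistrib, mul_smul, smul_comm (antipode ℂ c)]

/-- `projR (b e) = b₁ (projR e) S(b₂)`. -/
lemma projR_lsmul (b : A) (e : E) : B.projR (b • e) =
    lift ((lm A E).compl₂ ((rm A E).flip (B.projR e) ∘ₗ antipode ℂ)) (comul b) := by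
  simp only [projR, LinearMap.comp_apply, B.coR_lsmul]
  generalize B.coR e = y
  generalize (comul b : A ⊗[ℂ] A) = x
  induction x with
  | zero => simp
  | add x₁ x₂ h₁ h₂ => simp only [map_add, LinearMap.add_apply, h₁, h₂]
  | tmul f f' =>
    induction y with
    | zero => simp
    | add x₁ x₂ h₁ h₂ =>
      simp only [lift.tmul, LinearMap.compl₂_apply, LinearMap.flip_apply, LinearMap.comp_apply]
        at h₁ h₂
      simp only [map_add, h₁, h₂, lift.tmul, LinearMap.compl₂_apply, LinearMap.flip_apply,
        LinearMap.comp_apply, LinearMap.add_apply]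
    | tmul e c => simp [antipode_mul_antidistrib, mul_smul, smul_comm f]

lemma projL₀_mem (e : E) : B.projL₀ e ∈ B.invL := by
  -- `f` vanishes since `Δ(e₍₋₁₎) f(e₍₀₎) = 0` for all `e`
  let f : E →ₗ[ℂ] A ⊗[ℂ] E := B.coL ∘ₗ B.projL₀ - TensorProduct.mk ℂ A E 1 ∘ₗ B.projL₀
  let act : A →ₗ[ℂ] A ⊗[ℂ] E →ₗ[ℂ] A ⊗[ℂ] E := map₂ (LinearMap.mul ℂ A) (lm A E) ∘ₗ comul
  have act_mul : ∀ a b z, act (a * b) z = act a (act b z) := by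
    intro a b z
    simp only [act, LinearMap.comp_apply, Bialgebra.comul_mul]
    exact BicovariantCalculus.actLL_mul _ _ _
  have h0 : ∀ e, lift act (f.lTensor A (B.coL e)) = 0 := by
    intro e
    have h1 : ∀ z : A ⊗[ℂ] E, lift act ((B.coL ∘ₗ B.projL₀).lTensor A z) =
        B.coL (lift (lm A E) (B.projL₀.lTensor A z)) := by
      intro z
      induction z with
      | zero => simp
      | add x₁ x₂ h₁ h₂ => simp only [map_add, h₁, h₂]
      | tmul c e => simp [act, B.coL_lsmul]
    have h2 : ∀ z : A ⊗[ℂ] E,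
        lift act ((TensorProduct.mk ℂ A E 1 ∘ₗ B.projL₀).lTensor A z) =
        (lift (lm A E) ∘ₗ B.projL₀.lTensor A).lTensor A
          (TensorProduct.assoc ℂ A A E ((comul (R := ℂ) (A := A)).rTensor E z)) := by
      intro z
      induction z with
      | zero => simp
      | add x₁ x₂ h₁ h₂ => simp only [map_add, h₁, h₂]
      | tmul c e =>
        simp only [LinearMap.lTensor_tmul, LinearMap.rTensor_tmul, lift.tmul, act,
          LinearMap.comp_apply, TensorProduct.mk_apply]
        generalize (comul c : A ⊗[ℂ] A) = x
        induction x with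
        | zero => simp
        | add x₁ x₂ h₁ h₂ => simp only [map_add, LinearMap.add_apply, add_tmul, h₁, h₂]
        | tmul f f' => simp
    have h3 : (lift (lm A E) ∘ₗ B.projL₀.lTensor A) ∘ₗ B.coL = LinearMap.id :=
      LinearMap.ext B.lm_projL₀
    simp only [f, LinearMap.lTensor_sub, LinearMap.sub_apply, map_sub, h1, h2, B.lm_projL₀,
      B.coL_coassoc]
    rw [← LinearMap.comp_apply (LinearMap.lTensor A _), ← LinearMap.lTensor_comp, h3]
    simp
  have h4 : ∀ z : A ⊗[ℂ] E, lift (act ∘ₗ antipode ℂ) ((lift act ∘ₗ f.lTensor A).lTensor A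
      (TensorProduct.assoc ℂ A A E ((comul (R := ℂ) (A := A)).rTensor E z))) =
      f (TensorProduct.lid ℂ E ((counit (R := ℂ) (A := A)).rTensor E z)) := by
    intro z
    induction z with
    | zero => simp
    | add x₁ x₂ h₁ h₂ => simp only [map_add, h₁, h₂]
    | tmul c e =>
      have : ∀ y : A ⊗[ℂ] A, lift (act ∘ₗ antipode ℂ) ((lift act ∘ₗ f.lTensor A).lTensor A
          (TensorProduct.assoc ℂ A A E (y ⊗ₜ e))) =
          act (LinearMap.mul' ℂ A ((antipode ℂ).rTensor A y)) (f e) := by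
        intro y
        induction y with
        | zero => simp
        | add x₁ x₂ h₁ h₂ => simp only [map_add, add_tmul, LinearMap.add_apply, h₁, h₂]
        | tmul c c' => simp [act_mul]
      have act_one : act 1 (f e) = f e := by
        simp only [act, LinearMap.comp_apply, Bialgebra.comul_one, Algebra.TensorProduct.one_def,
          map₂_apply_tmul]
        have e1 : LinearMap.mul ℂ A 1 = LinearMap.id := by ext; simp
        have e2 : lm A E 1 = LinearMap.id := by ext; simp
        rw [e1, e2]; simp
      simp only [LinearMap.rTensor_tmul, this, mul_antipode_rTensor_comul_apply,
        Algebra.algebraMap_eq_smul_one, map_smul, LinearMap.smul_apply, act_one,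
        TensorProduct.lid_tmul]
  have h5 := h4 (B.coL e)
  have h6 : (lift act ∘ₗ f.lTensor A) ∘ₗ B.coL = 0 := LinearMap.ext h0
  rw [B.coL_coassoc, ← LinearMap.comp_apply (LinearMap.lTensor A _), ← LinearMap.lTensor_comp, h6,
    B.coL_counit] at h5
  simp only [LinearMap.lTensor_zero, LinearMap.zero_apply, map_zero, TensorProduct.lid_tmul,
    one_smul, f, LinearMap.sub_apply, LinearMap.comp_apply, TensorProduct.mk_apply] at h5
  exact (sub_eq_zero.1 h5.symm)

/-- The projection `E → ₀E`, `e ↦ S(e₍₋₁₎) e₍₀₎`. -/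
def projL : E →ₗ[ℂ] B.invL := B.projL₀.codRestrict B.invL B.projL₀_mem

@[simp] lemma coe_projL (e : E) : (B.projL e : E) = B.projL₀ e := rfl

lemma projL_of_mem (v : B.invL) : B.projL v = v := Subtype.ext (B.projL₀_of_mem v.2)

/-- The map `E → A ⊗ ₀E` inverse to multiplication. -/
def splitL : E →ₗ[ℂ] A ⊗[ℂ] B.invL := B.projL.lTensor A ∘ₗ B.coL

/-- The map `E → E ⊗ A`, `e ↦ projR(e₍₀₎) ⊗ e₍₁₎`. -/
def splitR : E →ₗ[ℂ] E ⊗[ℂ] A := B.projR.rTensor A ∘ₗ B.coR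

lemma splitL_of_mem (v : B.invL) : B.splitL v = 1 ⊗ₜ v := by
  rw [splitL, LinearMap.comp_apply, B.mem_invL.1 v.2, LinearMap.lTensor_tmul, projL_of_mem]

lemma splitR_of_mem {e : E} (he : e ∈ B.invR) : B.splitR e = e ⊗ₜ 1 := by
  rw [splitR, LinearMap.comp_apply, B.mem_invR.1 he, LinearMap.rTensor_tmul, B.projR_of_mem he]

lemma splitL_lsmul (a : A) (e : E) :
    B.splitL (a • e) = (LinearMap.mulLeft ℂ a).rTensor B.invL (B.splitL e) := by
  simp only [splitL, LinearMap.comp_apply, B.coL_lsmul]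
  have key : ∀ (x : A ⊗[ℂ] A) (y : A ⊗[ℂ] E),
      B.projL.lTensor A (map₂ (LinearMap.mul ℂ A) (lm A E) x y) =
      (LinearMap.mulLeft ℂ (TensorProduct.rid ℂ A ((counit (R := ℂ) (A := A)).lTensor A x))).rTensor
        B.invL (B.projL.lTensor A y) := by
    intro x y
    induction y with
    | zero => simp
    | add x₁ x₂ h₁ h₂ => simp only [map_add, h₁, h₂]
    | tmul c e =>
      induction x with
      | zero => simp
      | add x₁ x₂ h₁ h₂ =>
        simp only [map_add, LinearMap.add_apply, h₁, h₂, LinearMap.lTensor_tmul,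
          LinearMap.rTensor_tmul, LinearMap.mulLeft_apply, add_mul, add_tmul]
      | tmul f f' =>
        have : B.projL (f' • e) = counit (R := ℂ) f' • B.projL e :=
          Subtype.ext (by simpa using B.projL₀_lsmul f' e)
        simp [this, smul_tmul']
  simp [key]

lemma splitR_rsmul (a : A) (e : E) :
    B.splitR (op a • e) = (LinearMap.mulRight ℂ a).lTensor E (B.splitR e) := by
  simp only [splitR, LinearMap.comp_apply, B.coR_rsmul]
  have key : ∀ (x : A ⊗[ℂ] A) (y : E ⊗[ℂ] A),
      B.projR.rTensor A (map₂ (rm A E) (LinearMap.mul ℂ A).flip x y) =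
      (LinearMap.mulRight ℂ (TensorProduct.lid ℂ A
        ((counit (R := ℂ) (A := A)).rTensor A x))).lTensor E (B.projR.rTensor A y) := by
    intro x y
    induction y with
    | zero => simp
    | add x₁ x₂ h₁ h₂ => simp only [map_add, h₁, h₂]
    | tmul e c =>
      induction x with
      | zero => simp
      | add x₁ x₂ h₁ h₂ =>
        simp only [map_add, LinearMap.add_apply, h₁, h₂, LinearMap.lTensor_tmul,
          LinearMap.rTensor_tmul, LinearMap.mulRight_apply, mul_add, tmul_add]
      | tmul f f' => simp [projR_rsmul, smul_tmul']
  simp [key]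

/-- `(a ⊗ v) ⊗ (w ⊗ b) ↦ a w ⊗_A v b`. -/
def braidKernel : (A ⊗[ℂ] B.invL) ⊗[ℂ] (E ⊗[ℂ] A) →ₗ[ℂ] TensorA A E :=
  mkA A E ∘ₗ map (lift (lm A E)) (lift (rm A E).flip ∘ₗ B.invL.subtype.rTensor A) ∘ₗ
    (tensorTensorTensorComm ℂ A B.invL E A).toLinearMap

@[simp] lemma braidKernel_tmul (a b : A) (v : B.invL) (w : E) :
    B.braidKernel ((a ⊗ₜ v) ⊗ₜ (w ⊗ₜ b)) = tmulA A (a • w) (op b • (v : E)) := rfl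

lemma braid_balanced (m : E) (b : A) (n : E) :
    B.braidKernel (B.splitL (op b • m) ⊗ₜ B.splitR n) =
      B.braidKernel (B.splitL m ⊗ₜ B.splitR (b • n)) := by
  simp only [splitL, splitR, LinearMap.comp_apply, B.coL_rsmul, B.coR_lsmul]
  generalize B.coL m = x
  generalize B.coR n = z
  induction x with
  | zero => simp
  | add x₁ x₂ h₁ h₂ => simp only [map_add, add_tmul, h₁, h₂]
  | tmul c e =>
    induction z with
    | zero => simp
    | add x₁ x₂ h₁ h₂ => simp only [map_add, tmul_add, h₁, h₂]
    | tmul w c' =>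
      let G : A ⊗[ℂ] (A ⊗[ℂ] A) →ₗ[ℂ] TensorA A E := mkA A E ∘ₗ
        map ((lm A E).flip (B.projR w) ∘ₗ LinearMap.mulLeft ℂ c)
          (lift ((lm A E ∘ₗ antipode ℂ).compl₂
            ((rm A E).flip (B.projL₀ e) ∘ₗ LinearMap.mulRight ℂ c')))
      have hL : ∀ y : A ⊗[ℂ] A, B.braidKernel (B.projL.lTensor A
          (map₂ (LinearMap.mul ℂ A).flip (rm A E) y (c ⊗ₜ e)) ⊗ₜ B.projR.rTensor A (w ⊗ₜ c')) =
          G ((comul (R := ℂ) (A := A)).lTensor A y) := by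
        intro y
        induction y with
        | zero => simp
        | add x₁ x₂ h₁ h₂ => simp only [map_add, LinearMap.add_apply, add_tmul, h₁, h₂]
        | tmul f f' =>
          simp only [map₂_apply_tmul, map_tmul, LinearMap.lTensor_tmul, LinearMap.rTensor_tmul,
            braidKernel_tmul, LinearMap.flip_apply, LinearMap.mul_apply', rm_apply, coe_projL,
            projL₀_rsmul, G, LinearMap.comp_apply, lm_apply, LinearMap.mulLeft_apply, mkA_tmul]
          congr 1
          generalize (comul f' : A ⊗[ℂ] A) = t
          induction t with
          | zero => simp
          | add x₁ x₂ h₁ h₂ => simp only [map_add, smul_add, h₁, h₂]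
          | tmul g g' => simp [mul_smul, smul_comm (antipode ℂ g)]
      have hR : ∀ y : A ⊗[ℂ] A, B.braidKernel (B.projL.lTensor A (c ⊗ₜ e) ⊗ₜ
          B.projR.rTensor A (map₂ (lm A E) (LinearMap.mul ℂ A) y (w ⊗ₜ c'))) =
          G (TensorProduct.assoc ℂ A A A ((comul (R := ℂ) (A := A)).rTensor A y)) := by
        intro y
        induction y with
        | zero => simp
        | add x₁ x₂ h₁ h₂ => simp only [map_add, LinearMap.add_apply, tmul_add, h₁, h₂]
        | tmul f f' =>
          simp only [map₂_apply_tmul, map_tmul, LinearMap.lTensor_tmul, LinearMap.rTensor_tmul,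
            braidKernel_tmul, LinearMap.mul_apply', lm_apply, coe_projL, projR_lsmul]
          generalize (comul f : A ⊗[ℂ] A) = t
          induction t with
          | zero => simp [tmulA]
          | add x₁ x₂ h₁ h₂ =>
            simp only [tmulA] at h₁ h₂
            simp only [tmulA, map_add, smul_add, add_tmul, h₁, h₂]
          | tmul g g' =>
            simp only [lift.tmul, LinearMap.compl₂_apply, LinearMap.comp_apply,
              LinearMap.flip_apply, lm_apply, rm_apply, G, assoc_tmul, map_tmul, mkA_tmul,
              LinearMap.mulLeft_apply, LinearMap.mulRight_apply]
            rw [smul_comm g, smul_comm c, tmulA_bal, mul_smul]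
      rw [hL, hR, coassoc_apply]

/-- The canonical braiding of `E ⊗_A E`: `σ(m ⊗ n) = m₍₋₁₎ projR(n₍₀₎) ⊗_A projL(m₍₀₎) n₍₁₎`,
the bimodule map with `σ(ω ⊗ η) = η ⊗ ω` for `ω` left-invariant and `η` right-invariant
(`braiding_flip`, `braiding_lA`, `braiding_rA`). -/
def braiding : TensorA A E →ₗ[ℂ] TensorA A E :=
  liftA (B.braidKernel ∘ₗ map B.splitL B.splitR) fun m b n => B.braid_balanced m b n

lemma braiding_tmulA (m n : E) :
    B.braiding (tmulA A m n) = B.braidKernel (B.splitL m ⊗ₜ B.splitR n) := rfl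

lemma braiding_flip {v w : E} (hv : v ∈ B.invL) (hw : w ∈ B.invR) :
    B.braiding (tmulA A v w) = tmulA A w v := by
  rw [braiding_tmulA, B.splitR_of_mem hw, B.splitL_of_mem ⟨v, hv⟩]
  simp

lemma braiding_lA (a : A) (x : TensorA A E) : B.braiding (lA E a x) = lA E a (B.braiding x) := by
  have : B.braiding ∘ₗ lA E a = lA E a ∘ₗ B.braiding := by
    refine tensorA_ext fun m n => ?_
    simp only [LinearMap.comp_apply, lA_tmulA, braiding_tmulA, splitL_lsmul]
    generalize B.splitL m = x
    generalize B.splitR n = y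
    induction x with
    | zero => simp
    | add x₁ x₂ h₁ h₂ => simp only [map_add, add_tmul, h₁, h₂]
    | tmul c v =>
      induction y with
      | zero => simp
      | add x₁ x₂ h₁ h₂ => simp only [map_add, tmul_add, h₁, h₂]
      | tmul w c' => simp [mul_smul]
  exact LinearMap.congr_fun this x

lemma braiding_rA (a : A) (x : TensorA A E) : B.braiding (rA E a x) = rA E a (B.braiding x) := by
  have : B.braiding ∘ₗ rA E a = rA E a ∘ₗ B.braiding := by
    refine tensorA_ext fun m n => ?_
    simp only [LinearMap.comp_apply, rA_tmulA, braiding_tmulA, splitR_rsmul]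
    generalize B.splitL m = x
    generalize B.splitR n = y
    induction x with
    | zero => simp
    | add x₁ x₂ h₁ h₂ => simp only [map_add, add_tmul, h₁, h₂]
    | tmul c v =>
      induction y with
      | zero => simp
      | add x₁ x₂ h₁ h₂ => simp only [map_add, tmul_add, h₁, h₂]
      | tmul w c' => simp [mul_smul]
  exact LinearMap.congr_fun this x

/-- The canonical map `₀E ⊗ ₀E → E ⊗_A E`. -/
def incl : B.invL ⊗[ℂ] B.invL →ₗ[ℂ] TensorA A E :=
  mkA A E ∘ₗ map B.invL.subtype B.invL.subtype

@[simp] lemma incl_tmul (v w : B.invL) : B.incl (v ⊗ₜ w) = tmulA A (v : E) (w : E) := rfl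

/-- The map `E ⊗_A E → ₀E ⊗ ₀E`, `e ⊗ f ↦ projL(e f₍₋₁₎) ⊗ projL(f₍₀₎)`, which inverts `incl` on
the left-invariant elements of `E ⊗_A E` (`retr_incl`, `incl_retr`). -/
def retr : TensorA A E →ₗ[ℂ] B.invL ⊗[ℂ] B.invL :=
  liftA ((B.projL ∘ₗ lift (rm A E).flip).rTensor B.invL ∘ₗ
    (TensorProduct.assoc ℂ E A B.invL).symm.toLinearMap ∘ₗ B.splitL.lTensor E) (by
    intro e b f
    simp only [LinearMap.comp_apply, LinearMap.lTensor_tmul, splitL_lsmul, LinearEquiv.coe_coe]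
    generalize B.splitL f = x
    induction x with
    | zero => simp
    | add x₁ x₂ h₁ h₂ => simp only [map_add, tmul_add, h₁, h₂]
    | tmul c v => simp [mul_smul])

lemma retr_incl (y : B.invL ⊗[ℂ] B.invL) : B.retr (B.incl y) = y := by
  have : B.retr ∘ₗ B.incl = LinearMap.id := by
    refine TensorProduct.ext' fun v w => ?_
    simp [retr, splitL_of_mem, projL_of_mem]
  exact LinearMap.congr_fun this y

lemma incl_mem (y : B.invL ⊗[ℂ] B.invL) : B.incl y ∈ B.invLT := by
  have : B.coLT ∘ₗ B.incl = TensorProduct.mk ℂ A (TensorA A E) 1 ∘ₗ B.incl := by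
    refine TensorProduct.ext' fun v w => ?_
    simp [coLT, B.mem_invL.1 v.2, B.mem_invL.1 w.2, mkA_tmul]
  exact LinearMap.congr_fun this y

lemma incl_retr {x : TensorA A E} (hx : x ∈ B.invLT) : B.incl (B.retr x) = x := by
  have hlAS : ∀ a b : A, lA E (a + b) = lA E a + lA E b := fun a b =>
    tensorA_ext fun e f => by
      simp only [lA_tmulA, LinearMap.add_apply, add_smul]
      simp [tmulA, add_tmul]
  have hlAc : ∀ (c : ℂ) (a : A), lA E (c • a) = c • lA E a := fun c a =>
    tensorA_ext fun e f => by
      simp only [lA_tmulA, LinearMap.smul_apply, smul_assoc]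
      simp [tmulA, ← smul_tmul']
  let Λ : A →ₗ[ℂ] TensorA A E →ₗ[ℂ] TensorA A E :=
    { toFun := lA E, map_add' := hlAS, map_smul' := hlAc }
  -- `incl (retr x) = S(x₍₋₁₎) x₍₀₎` for every `x`
  have key : B.incl ∘ₗ B.retr = lift (Λ ∘ₗ antipode ℂ) ∘ₗ B.coLT := by
    have h1 : ∀ (e : E) (v : B.invL), lift (Λ ∘ₗ antipode ℂ) (B.coLT (tmulA A e (v : E))) =
        tmulA A (B.projL₀ e) (v : E) := by
      intro e v
      simp only [coLT, liftA_tmulA, LinearMap.comp_apply, map_tmul, B.mem_invL.1 v.2, projL₀]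
      generalize B.coL e = x
      induction x with
      | zero => simp [tmulA]
      | add x₁ x₂ h₁ h₂ =>
        simp only [tmulA] at h₁ h₂
        simp only [tmulA, map_add, add_tmul, h₁, h₂]
      | tmul c e => simp [Λ, mkA_tmul]
    refine tensorA_ext fun e f => ?_
    have h2 : tmulA A e f = mkA A E (map (lift (rm A E).flip) B.invL.subtype
        ((TensorProduct.assoc ℂ E A B.invL).symm (e ⊗ₜ B.splitL f))) := by
      conv_lhs => rw [← B.lm_projL₀ f]
      simp only [splitL, LinearMap.comp_apply]
      generalize B.coL f = x
      induction x with
      | zero => simp [tmulA]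
      | add x₁ x₂ h₁ h₂ =>
        simp only [tmulA] at h₁ h₂
        simp only [tmulA, map_add, tmul_add, h₁, h₂]
      | tmul c e' => simp [mkA_tmul, tmulA_bal]
    have h3 : ∀ z : A ⊗[ℂ] B.invL, B.incl ((B.projL ∘ₗ lift (rm A E).flip).rTensor B.invL
        ((TensorProduct.assoc ℂ E A B.invL).symm (e ⊗ₜ z))) =
        lift (Λ ∘ₗ antipode ℂ) (B.coLT (mkA A E (map (lift (rm A E).flip) B.invL.subtype
        ((TensorProduct.assoc ℂ E A B.invL).symm (e ⊗ₜ z))))) := by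
      intro z
      induction z with
      | zero => simp
      | add x₁ x₂ h₁ h₂ => simp only [map_add, tmul_add, h₁, h₂]
      | tmul c v => simp [mkA_tmul, h1]
    simp only [LinearMap.comp_apply]
    rw [h2, ← h3 (B.splitL f), ← h2]
    rfl
  have h := LinearMap.congr_fun key x
  simp only [LinearMap.comp_apply, B.mem_invLT.1 hx] at h
  rw [h]
  have h1 : lA E (1 : A) = LinearMap.id := tensorA_ext fun e f => by simp
  simp [Λ, h1]

lemma coR_of_mem (w : B.invL) :
    B.coR (w : E) = B.invL.subtype.rTensor A (B.projL.rTensor A (B.coR (w : E))) := by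
  have h := B.coL_coR (w : E)
  rw [B.mem_invL.1 w.2, LinearMap.lTensor_tmul] at h
  have key : ∀ z : E ⊗[ℂ] A, B.invL.subtype.rTensor A (B.projL.rTensor A z) =
      (lift (lm A E ∘ₗ antipode ℂ)).rTensor A
        ((TensorProduct.assoc ℂ A E A).symm (TensorProduct.assoc ℂ A E A (B.coL.rTensor A z))) := by
    intro z
    induction z with
    | zero => simp
    | add x₁ x₂ h₁ h₂ => simp only [map_add, h₁, h₂]
    | tmul e c => simp [projL₀]
  rw [key, h]
  generalize B.coR (w : E) = z
  induction z with
  | zero => simp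
  | add x₁ x₂ h₁ h₂ => simp only [tmul_add, map_add, ← h₁, ← h₂]
  | tmul e c => simp

/-- The braiding preserves the left-invariant elements `₀E ⊗ ₀E` of `E ⊗_A E`. -/
lemma incl_retr_braiding (y : B.invL ⊗[ℂ] B.invL) :
    B.incl (B.retr (B.braiding (B.incl y))) = B.braiding (B.incl y) := by
  apply B.incl_retr
  induction y with
  | zero => simp
  | add x₁ x₂ h₁ h₂ => simp only [map_add]; exact Submodule.add_mem _ h₁ h₂
  | tmul v w =>
    have key : ∀ z : B.invL ⊗[ℂ] A, B.braidKernel ((1 ⊗ₜ v) ⊗ₜ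
        (lift (rm A E ∘ₗ antipode ℂ).flip).rTensor A ((TensorProduct.assoc ℂ E A A).symm
          ((comul (R := ℂ) (A := A)).lTensor E (B.invL.subtype.rTensor A z)))) ∈ B.invLT := by
      intro z
      induction z with
      | zero => simp
      | add x₁ x₂ h₁ h₂ => simp only [map_add, tmul_add]; exact Submodule.add_mem _ h₁ h₂
      | tmul u c =>
        have h := B.projL₀_rsmul c (v : E)
        have : B.braidKernel ((1 ⊗ₜ v) ⊗ₜ
            (lift (rm A E ∘ₗ antipode ℂ).flip).rTensor A ((TensorProduct.assoc ℂ E A A).symm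
            ((comul (R := ℂ) (A := A)).lTensor E (B.invL.subtype.rTensor A (u ⊗ₜ c))))) =
            B.incl (u ⊗ₜ B.projL (op c • (v : E))) := by
          rw [incl_tmul, coe_projL, h, B.projL₀_of_mem v.2]
          simp only [LinearMap.rTensor_tmul, LinearMap.lTensor_tmul, Submodule.subtype_apply]
          generalize (comul c : A ⊗[ℂ] A) = x
          induction x with
          | zero => simp [tmulA]
          | add x₁ x₂ h₁ h₂ =>
            simp only [tmulA] at h₁ h₂
            simp only [tmulA, map_add, tmul_add, h₁, h₂]
          | tmul f f' => simp [tmulA_bal]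
        rw [this]
        exact B.incl_mem _
    have h := key (B.projL.rTensor A (B.coR (w : E)))
    rw [← B.coR_of_mem, ← B.coR_coassoc, LinearEquiv.symm_apply_apply,
      ← LinearMap.comp_apply (LinearMap.rTensor A _), ← LinearMap.rTensor_comp] at h
    rw [incl_tmul, braiding_tmulA, splitL_of_mem]
    exact h

end BicovariantBimodule

namespace BicovariantCalculus

variable {A : Type u} [Ring A] [HopfAlgebra ℂ A]
  {E : Type v} [AddCommGroup E] [Module ℂ E] [Module A E] [Module Aᵐᵒᵖ E]
  [SMulCommClass A Aᵐᵒᵖ E] [IsScalarTower ℂ A E] [IsScalarTower ℂ Aᵐᵒᵖ E]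
  (C : BicovariantCalculus A E)

/-- The canonical braiding `σ` of the calculus. -/
def sigma : TensorA A E →ₗ[ℂ] TensorA A E := C.toBimodule.braiding

/-- The two-forms `Ω²(A) = (E ⊗_A E) / Ker(σ - 1)`. -/
abbrev TwoForms : Type v := TensorA A E ⧸ LinearMap.ker (C.sigma - LinearMap.id)

/-- The quotient map `∧ : E ⊗_A E → Ω²(A)`. -/
def wedge : TensorA A E →ₗ[ℂ] C.TwoForms := (LinearMap.ker (C.sigma - LinearMap.id)).mkQ

lemma wedge_eq_zero_iff {x : TensorA A E} : C.wedge x = 0 ↔ C.sigma x = x := by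
  rw [wedge, Submodule.mkQ_apply, Submodule.Quotient.mk_eq_zero, LinearMap.mem_ker,
    LinearMap.sub_apply, LinearMap.id_apply, sub_eq_zero]

lemma coL_d (a : A) : C.toBimodule.coL (C.d a) = C.d.lTensor A (comul a) := by
  have h := C.coL_adb 1 a
  rw [one_smul, Bialgebra.comul_one, Algebra.TensorProduct.one_def, map₂_apply_tmul] at h
  have e1 : LinearMap.mul ℂ A 1 = LinearMap.id := by ext; simp
  have e2 : lm A E 1 = LinearMap.id := by ext; simp
  rw [e1, e2, map_id, LinearMap.id_apply] at h
  exact h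

lemma coR_d (a : A) : C.toBimodule.coR (C.d a) = C.d.rTensor A (comul a) := by
  have h := C.coR_adb 1 a
  rw [one_smul, Bialgebra.comul_one, Algebra.TensorProduct.one_def, map₂_apply_tmul] at h
  have e1 : LinearMap.mul ℂ A 1 = LinearMap.id := by ext; simp
  have e2 : lm A E 1 = LinearMap.id := by ext; simp
  rw [e1, e2, map_id, LinearMap.id_apply] at h
  exact h

/-- The difference `σ(da ⊗ db) - da ⊗ db` depends on `a db` only. -/
lemma sigma_d_d (a b : A) : C.sigma (tmulA A (C.d a) (C.d b)) - tmulA A (C.d a) (C.d b) =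
    mkA A E (map C.toBimodule.projR C.d (C.toBimodule.coR (a • C.d b))) -
      mkA A E (map C.d C.toBimodule.projL₀ (C.toBimodule.coL (a • C.d b))) := by
  set B := C.toBimodule with hB
  -- the common term `a db₁ S(b₂) ⊗ db₃`
  let T : TensorA A E := mkA A E (map (lm A E a ∘ₗ C.d) (B.projL₀ ∘ₗ C.d) (comul b))
  have hT : T = mkA A E (map (lm A E a ∘ₗ B.projR ∘ₗ C.d) C.d (comul b)) := by
    let G : A ⊗[ℂ] (A ⊗[ℂ] A) →ₗ[ℂ] TensorA A E := mkA A E ∘ₗ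
      map (lm A E a ∘ₗ C.d) (lift ((lm A E ∘ₗ antipode ℂ).compl₂ C.d))
    have h1 : ∀ y : A ⊗[ℂ] A, mkA A E (map (lm A E a ∘ₗ C.d) (B.projL₀ ∘ₗ C.d) y) =
        G ((comul (R := ℂ) (A := A)).lTensor A y) := by
      intro y
      induction y with
      | zero => simp
      | add x₁ x₂ h₁ h₂ => simp only [map_add, h₁, h₂]
      | tmul f f' =>
        simp only [map_tmul, LinearMap.comp_apply, LinearMap.lTensor_tmul, G,
          BicovariantBimodule.projL₀, hB, coL_d, mkA_tmul]
        congr 1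
        generalize (comul f' : A ⊗[ℂ] A) = t
        induction t with
        | zero => simp
        | add x₁ x₂ h₁ h₂ => simp only [map_add, h₁, h₂]
        | tmul g g' => simp
    have h2 : ∀ y : A ⊗[ℂ] A, mkA A E (map (lm A E a ∘ₗ B.projR ∘ₗ C.d) C.d y) =
        G (TensorProduct.assoc ℂ A A A ((comul (R := ℂ) (A := A)).rTensor A y)) := by
      intro y
      induction y with
      | zero => simp
      | add x₁ x₂ h₁ h₂ => simp only [map_add, h₁, h₂]
      | tmul f f' =>
        simp only [map_tmul, LinearMap.comp_apply, LinearMap.rTensor_tmul, G,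
          BicovariantBimodule.projR, hB, coR_d, mkA_tmul]
        generalize (comul f : A ⊗[ℂ] A) = t
        induction t with
        | zero => simp [tmulA]
        | add x₁ x₂ h₁ h₂ =>
          simp only [tmulA] at h₁ h₂
          simp only [tmulA, map_add, add_tmul, h₁, h₂]
        | tmul g g' =>
          simp only [LinearMap.rTensor_tmul, lift.tmul, LinearMap.flip_apply, LinearMap.comp_apply,
            rm_apply, lm_apply, assoc_tmul, map_tmul, LinearMap.compl₂_apply, mkA_tmul]
          rw [smul_comm, tmulA_bal]
    simp only [T, h1, h2, coassoc_apply]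
  have hY : mkA A E (map C.d B.projL₀ (B.coL (a • C.d b))) =
      tmulA A (C.d a) (C.d b) + T := by
    have h1 : ∀ x y : A ⊗[ℂ] A, mkA A E (map C.d B.projL₀
        (map₂ (LinearMap.mul ℂ A) (lm A E) x (C.d.lTensor A y))) =
        mkA A E (map (C.d ∘ₗ LinearMap.mulLeft ℂ (TensorProduct.rid ℂ A
          ((counit (R := ℂ) (A := A)).lTensor A x))) (B.projL₀ ∘ₗ C.d) y) := by
      intro x y
      induction y with
      | zero => simp
      | add x₁ x₂ h₁ h₂ => simp only [map_add, h₁, h₂]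
      | tmul f f' =>
        induction x with
        | zero => simp
        | add x₁ x₂ h₁ h₂ =>
          simp only [map_tmul] at h₁ h₂
          simp only [map_add, LinearMap.add_apply, h₁, h₂, map_tmul, LinearMap.comp_apply,
            LinearMap.mulLeft_apply, add_mul, add_tmul]
        | tmul g g' => simp [B.projL₀_lsmul, ← smul_tmul']
    have h2 : ∀ y : A ⊗[ℂ] A, mkA A E (map (C.d ∘ₗ LinearMap.mulLeft ℂ a) (B.projL₀ ∘ₗ C.d) y) =
        tmulA A (C.d a) (lift (lm A E) (B.projL₀.lTensor A (C.d.lTensor A y))) +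
        mkA A E (map (lm A E a ∘ₗ C.d) (B.projL₀ ∘ₗ C.d) y) := by
      intro y
      induction y with
      | zero => simp [tmulA]
      | add x₁ x₂ h₁ h₂ =>
        simp only [tmulA] at h₁ h₂
        simp only [tmulA, map_add, tmul_add, h₁, h₂]
        abel
      | tmul f f' =>
        simp only [map_tmul, LinearMap.comp_apply, LinearMap.mulLeft_apply, C.leibniz, add_tmul,
          map_add, mkA_tmul, LinearMap.lTensor_tmul, lift.tmul, lm_apply, tmulA_bal]
    have h3 := B.lm_projL₀ (C.d b)
    rw [hB, coL_d, ← hB] at h3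
    have h4 : B.coL (a • C.d b) = _ := C.coL_adb a b
    rw [h4, h1, lTensor_counit_comul]
    simp only [TensorProduct.rid_tmul, one_smul]
    rw [h2, h3]
  have hX : mkA A E (map B.projR C.d (B.coR (a • C.d b))) =
      C.sigma (tmulA A (C.d a) (C.d b)) + T := by
    rw [hT]
    have h4 : B.coR (a • C.d b) = _ := C.coR_adb a b
    have h5 : C.sigma (tmulA A (C.d a) (C.d b)) = B.braidKernel
        ((B.projL ∘ₗ C.d).lTensor A (comul a) ⊗ₜ (B.projR ∘ₗ C.d).rTensor A (comul b)) := by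
      rw [sigma, ← hB, B.braiding_tmulA, BicovariantBimodule.splitL, BicovariantBimodule.splitR,
        LinearMap.comp_apply, LinearMap.comp_apply, hB, coL_d, coR_d, LinearMap.lTensor_comp,
        LinearMap.rTensor_comp, LinearMap.comp_apply, LinearMap.comp_apply]
    rw [h4, h5]
    generalize (comul b : A ⊗[ℂ] A) = y
    induction y with
    | zero => simp
    | add x₁ x₂ h₁ h₂ =>
      simp only [map_add, tmul_add, h₁, h₂]
      abel
    | tmul f f' =>
      let G : A ⊗[ℂ] (A ⊗[ℂ] A) →ₗ[ℂ] TensorA A E := mkA A E ∘ₗ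
        map ((lm A E).flip (B.projR (C.d f)))
          (lift ((lm A E ∘ₗ antipode ℂ).compl₂ (C.d ∘ₗ LinearMap.mulRight ℂ f')))
      have h1 : ∀ x : A ⊗[ℂ] A, mkA A E (map B.projR C.d
          (map₂ (lm A E) (LinearMap.mul ℂ A) x (C.d.rTensor A (f ⊗ₜ f')))) =
          G (TensorProduct.assoc ℂ A A A ((comul (R := ℂ) (A := A)).rTensor A x)) := by
        intro x
        induction x with
        | zero => simp
        | add x₁ x₂ h₁ h₂ => simp only [map_add, LinearMap.add_apply, h₁, h₂]
        | tmul g g' =>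
          simp only [map₂_apply_tmul, map_tmul, LinearMap.rTensor_tmul, lm_apply, B.projR_lsmul,
            LinearMap.mul_apply', mkA_tmul]
          generalize (comul g : A ⊗[ℂ] A) = t
          induction t with
          | zero => simp [tmulA]
          | add x₁ x₂ h₁ h₂ =>
            simp only [tmulA] at h₁ h₂
            simp only [tmulA, map_add, add_tmul, h₁, h₂]
          | tmul k k' =>
            simp only [lift.tmul, LinearMap.compl₂_apply, LinearMap.comp_apply,
              LinearMap.flip_apply, lm_apply, rm_apply, G, assoc_tmul, map_tmul, mkA_tmul,
              LinearMap.mulRight_apply]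
            rw [smul_comm, tmulA_bal]
      have h2 : ∀ x : A ⊗[ℂ] A, G ((comul (R := ℂ) (A := A)).lTensor A x) =
          B.braidKernel ((B.projL ∘ₗ C.d).lTensor A x ⊗ₜ (B.projR ∘ₗ C.d).rTensor A (f ⊗ₜ f')) +
          tmulA A (TensorProduct.rid ℂ A ((counit (R := ℂ) (A := A)).lTensor A x) •
            B.projR (C.d f)) (C.d f') := by
        intro x
        induction x with
        | zero => simp [tmulA]
        | add x₁ x₂ h₁ h₂ =>
          simp only [tmulA] at h₁ h₂
          simp only [tmulA, map_add, add_smul, add_tmul, h₁, h₂]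
          abel
        | tmul g g' =>
          have hk : lift ((lm A E ∘ₗ antipode ℂ).compl₂ (C.d ∘ₗ LinearMap.mulRight ℂ f')) (comul g') =
              op f' • B.projL₀ (C.d g') + counit (R := ℂ) g' • C.d f' := by
            rw [BicovariantBimodule.projL₀, LinearMap.comp_apply, hB, coL_d]
            have : counit (R := ℂ) g' • C.d f' =
                LinearMap.mul' ℂ A ((antipode ℂ).rTensor A (comul g')) • C.d f' := by simp
            rw [this]
            generalize (comul g' : A ⊗[ℂ] A) = t
            induction t with
            | zero => simp
            | add x₁ x₂ h₁ h₂ =>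
              simp only [map_add, h₁, h₂, add_smul, smul_add]
              abel
            | tmul k k' =>
              simp [C.leibniz, mul_smul, smul_comm (antipode ℂ k) (op f')]
          simp only [LinearMap.lTensor_tmul, G, LinearMap.comp_apply, map_tmul, hk, tmul_add,
            map_add, mkA_tmul, LinearMap.flip_apply, lm_apply, LinearMap.rTensor_tmul,
            BicovariantBimodule.braidKernel_tmul, BicovariantBimodule.coe_projL,
            TensorProduct.rid_tmul]
          simp [tmulA, ← smul_tmul']
      rw [h1, coassoc_apply, h2, lTensor_counit_comul]
      simp [tmulA]
  rw [hX, hY]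
  abel

/-- The exterior derivative `d : E → Ω²(A)`, `a db ↦ da ∧ db`. -/
def extD : E →ₗ[ℂ] C.TwoForms :=
  C.descend (C.wedge ∘ₗ mkA A E ∘ₗ map C.d C.d) (by
    intro x hx
    have key : ∀ x, C.sigma (mkA A E (map C.d C.d x)) - mkA A E (map C.d C.d x) =
        mkA A E (map C.toBimodule.projR C.d (C.toBimodule.coR (C.adb x))) -
          mkA A E (map C.d C.toBimodule.projL₀ (C.toBimodule.coL (C.adb x))) := by
      intro x
      induction x with
      | zero => simp
      | tmul a b => exact C.sigma_d_d a b
      | add x₁ x₂ h₁ h₂ =>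
        simp only [map_add]
        rw [add_sub_add_comm, h₁, h₂]
        abel
    have key := key x
    rw [hx] at key
    simp only [map_zero, sub_zero] at key
    exact C.wedge_eq_zero_iff.2 (sub_eq_zero.1 key))

lemma extD_smul_d (a b : A) :
    C.extD (a • C.d b) = C.wedge (tmulA A (C.d a) (C.d b)) := by
  simp [extD, mkA_tmul]

end BicovariantCalculus

namespace BicovariantCalculus

variable {A : Type u} [Ring A] [HopfAlgebra ℂ A]
  {E : Type v} [AddCommGroup E] [Module ℂ E] [Module A E] [Module Aᵐᵒᵖ E]
  [SMulCommClass A Aᵐᵒᵖ E] [IsScalarTower ℂ A E] [IsScalarTower ℂ Aᵐᵒᵖ E]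
  (C : BicovariantCalculus A E)

/-- The space `₀E` of left-invariant one-forms. -/
abbrev V : Submodule ℂ E := C.toBimodule.invL

/-- The canonical embedding `₀E ⊗ ₀E → E ⊗_A E`, onto the left-invariant elements. -/
abbrev incl : C.V ⊗[ℂ] C.V →ₗ[ℂ] TensorA A E := C.toBimodule.incl

/-- The restriction `₀σ` of the braiding to `₀E ⊗ ₀E` (see `incl_sigma0`). -/
def sigma0 : Module.End ℂ (C.V ⊗[ℂ] C.V) := C.toBimodule.retr ∘ₗ C.sigma ∘ₗ C.incl

lemma incl_sigma0 (y : C.V ⊗[ℂ] C.V) : C.incl (C.sigma0 y) = C.sigma (C.incl y) :=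
  C.toBimodule.incl_retr_braiding y

lemma incl_injective : Function.Injective C.incl :=
  Function.LeftInverse.injective C.toBimodule.retr_incl

/-- `₀σ` is diagonalisable: `₀E ⊗ ₀E` is the sum of the eigenspaces of `₀σ`. -/
def IsDiagonalisable : Prop := ⨆ μ : ℂ, C.sigma0.eigenspace μ = ⊤

/-- The symmetric tensors in `₀E ⊗ ₀E`: the left-invariant elements of `Ker ∧`. -/
def sym : Submodule ℂ (C.V ⊗[ℂ] C.V) := LinearMap.ker (C.wedge ∘ₗ C.incl)

/-- The sum `₀F` of the eigenspaces of `₀σ` for the eigenvalues other than `1`. -/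
def antisym : Submodule ℂ (C.V ⊗[ℂ] C.V) := ⨆ μ : ℂ, ⨆ _ : μ ≠ 1, C.sigma0.eigenspace μ

lemma sym_eq : C.sym = C.sigma0.eigenspace 1 := by
  ext y
  rw [sym, LinearMap.mem_ker, LinearMap.comp_apply, wedge_eq_zero_iff, ← incl_sigma0,
    C.incl_injective.eq_iff, Module.End.mem_eigenspace_iff, one_smul]

variable {C}

lemma IsDiagonalisable.isCompl (hσ : C.IsDiagonalisable) : IsCompl C.sym C.antisym := by
  rw [sym_eq]
  refine ⟨C.sigma0.eigenspaces_iSupIndep 1, codisjoint_iff.2 (top_le_iff.1 ?_)⟩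
  rw [← hσ]
  refine iSup_le fun μ => ?_
  by_cases h : μ = 1
  · subst h
    exact le_sup_left
  · exact le_sup_of_le_right (le_iSup₂_of_le (f := fun μ (_ : μ ≠ 1) => C.sigma0.eigenspace μ)
      μ h le_rfl)

/-- The idempotent `₀P_sym` of `₀E ⊗ ₀E` with range the symmetric tensors and kernel `₀F`. -/
def psym (hσ : C.IsDiagonalisable) : C.V ⊗[ℂ] C.V →ₗ[ℂ] C.V ⊗[ℂ] C.V :=
  C.sym.projection C.antisym hσ.isCompl

variable (C)

/-- A pseudo-Riemannian metric on `E`: it is only required to be right `A`-linear. -/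
structure Metric where
  toFun : TensorA A E →ₗ[ℂ] A
  map_rA : ∀ (a : A) (x : TensorA A E), toFun (rA E a x) = toFun x * a
  map_sigma : ∀ x : TensorA A E, toFun (C.sigma x) = toFun x
  nondegenerate : ∀ ρ : E, (∀ ν : E, toFun (tmulA A ρ ν) = 0) → ρ = 0

namespace Metric

variable {C} (g : C.Metric)

/-- `(id ⊗ ε g) ∘ Δ_{E ⊗_A E} = g`. -/
def IsLeftInvariant : Prop := ∀ x : TensorA A E, TensorProduct.rid ℂ A
  ((counit (R := ℂ) (A := A) ∘ₗ g.toFun).lTensor A (C.toBimodule.coLT x)) = g.toFun x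

/-- `(ε g ⊗ id) ∘ _{E ⊗_A E}Δ = g`. -/
def IsRightInvariant : Prop := ∀ x : TensorA A E, TensorProduct.lid ℂ A
  ((counit (R := ℂ) (A := A) ∘ₗ g.toFun).rTensor A (C.toBimodule.coRT x)) = g.toFun x

/-- The metric on `₀E ⊗ ₀E` with its values read in `ℂ`: for a left-invariant `g` the values of
`g` on `₀E ⊗ ₀E` lie in `ℂ 1` (see `IsLeftInvariant.apply_incl`). -/
def g0 : C.V ⊗[ℂ] C.V →ₗ[ℂ] ℂ := counit (R := ℂ) (A := A) ∘ₗ g.toFun ∘ₗ C.incl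

lemma IsLeftInvariant.apply_incl (hg : g.IsLeftInvariant) (y : C.V ⊗[ℂ] C.V) :
    g.toFun (C.incl y) = algebraMap ℂ A (g.g0 y) := by
  have h := hg (C.incl y)
  rw [C.toBimodule.mem_invLT.1 (C.toBimodule.incl_mem y), LinearMap.lTensor_tmul,
    TensorProduct.rid_tmul] at h
  rw [← h, Algebra.algebraMap_eq_smul_one]
  rfl

/-- `id ⊗ g : (₀E ⊗ ₀E) ⊗ ₀E → ₀E`. -/
def contract : (C.V ⊗[ℂ] C.V) ⊗[ℂ] C.V →ₗ[ℂ] C.V :=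
  (TensorProduct.rid ℂ C.V).toLinearMap ∘ₗ g.g0.lTensor C.V ∘ₗ
    (TensorProduct.assoc ℂ C.V C.V C.V).toLinearMap

@[simp] lemma contract_tmul (v w z : C.V) :
    g.contract ((v ⊗ₜ w) ⊗ₜ z) = g.g0 (w ⊗ₜ z) • v := rfl

variable (hσ : C.IsDiagonalisable)

/-- `T ↦ 2 (id ⊗ g) σ₁₂ (T ⊗ id) ₀P_sym` for linear maps `T : ₀E → ₀E ⊗ ₀E`. -/
def contr : (C.V →ₗ[ℂ] C.V ⊗[ℂ] C.V) →ₗ[ℂ] (C.V ⊗[ℂ] C.V →ₗ[ℂ] C.V) where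
  toFun T := (2 : ℂ) • (g.contract ∘ₗ C.sigma0.rTensor C.V ∘ₗ T.rTensor C.V ∘ₗ psym hσ)
  map_add' S T := by
    ext x
    simp [LinearMap.rTensor_add]
  map_smul' c T := by
    ext x
    simp [LinearMap.rTensor_smul]
    exact smul_comm _ _ _

/-- The map `Φ_g : Hom(₀E, ₀E ⊗^sym ₀E) → Hom(₀E ⊗^sym ₀E, ₀E)`,
`Φ_g(L) = 2 (id ⊗ g) σ₁₂ (L ⊗ id) ₀P_sym`. -/
def Phi : (C.V →ₗ[ℂ] C.sym) →ₗ[ℂ] (C.sym →ₗ[ℂ] C.V) where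
  toFun L := g.contr hσ (C.sym.subtype ∘ₗ L) ∘ₗ C.sym.subtype
  map_add' S T := by
    rw [LinearMap.comp_add, map_add, LinearMap.add_comp]
  map_smul' c T := by
    rw [LinearMap.comp_smul, map_smul, LinearMap.smul_comp, RingHom.id_apply]

end Metric

/-- A (right) connection on `E`: `∇(ρ a) = ∇(ρ) a + ρ ⊗_A da`. -/
def IsConnection (D : E →ₗ[ℂ] TensorA A E) : Prop :=
  ∀ (ρ : E) (a : A), D (op a • ρ) = rA E a (D ρ) + tmulA A ρ (C.d a)

/-- The torsion `∧ ∘ ∇ + d : E → Ω²(A)`. -/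
def torsion (D : E →ₗ[ℂ] TensorA A E) : E →ₗ[ℂ] C.TwoForms := C.wedge ∘ₗ D + C.extD

/-- Left-covariance of a linear map `E → E ⊗_A E`. -/
def IsLeftCovariant (D : E →ₗ[ℂ] TensorA A E) : Prop :=
  ∀ e, C.toBimodule.coLT (D e) = D.lTensor A (C.toBimodule.coL e)

/-- Right-covariance of a linear map `E → E ⊗_A E`. -/
def IsRightCovariant (D : E →ₗ[ℂ] TensorA A E) : Prop :=
  ∀ e, C.toBimodule.coRT (D e) = D.rTensor A (C.toBimodule.coR e)

variable {C}

/-- The map `₀E → ₀E ⊗ ₀E` induced by a left-covariant connection (see `incl_restrict`). -/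
def restrict (C : BicovariantCalculus A E) (D : E →ₗ[ℂ] TensorA A E) :
    C.V →ₗ[ℂ] C.V ⊗[ℂ] C.V := C.toBimodule.retr ∘ₗ D ∘ₗ C.V.subtype

lemma incl_restrict {D : E →ₗ[ℂ] TensorA A E} (hD : C.IsLeftCovariant D) (v : C.V) :
    C.incl (C.restrict D v) = D v := by
  refine C.toBimodule.incl_retr (C.toBimodule.mem_invLT.2 ?_)
  have h := hD v
  rw [C.toBimodule.mem_invL.1 v.2, LinearMap.lTensor_tmul] at h
  exact h

namespace Metric

variable (g : C.Metric) (hσ : C.IsDiagonalisable)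

/-- `Π⁰_g(∇) = 2 (id ⊗ g) (σ ⊗ id) (∇ ⊗ id) ₀P_sym : ₀E ⊗ ₀E → ₀E`. -/
def Pi0 (D : E →ₗ[ℂ] TensorA A E) : C.V ⊗[ℂ] C.V →ₗ[ℂ] C.V := g.contr hσ (C.restrict D)

/-- Metric compatibility `Π_g(∇) = d g` on `E ⊗_A E`.  The map `Π_g(∇)` is determined by
`Π_g(∇)(x a) = Π⁰_g(∇)(x) a + g(x) da` for `x ∈ ₀E ⊗ ₀E` and `a ∈ A`, as
`x ⊗ a ↦ x a` is an isomorphism from `₀E ⊗ ₀E ⊗ A` onto `E ⊗_A E`. -/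
def IsCompatible (D : E →ₗ[ℂ] TensorA A E) : Prop :=
  ∀ (x : C.V ⊗[ℂ] C.V) (a : A),
    op a • (g.Pi0 hσ D x : E) + g.toFun (C.incl x) • C.d a = C.d (g.toFun (rA E a (C.incl x)))

/-- A Levi-Civita connection: a left-covariant connection on `E` that is torsionless and
compatible with `g`. -/
structure IsLeviCivita (D : E →ₗ[ℂ] TensorA A E) : Prop where
  isConnection : C.IsConnection D
  isLeftCovariant : C.IsLeftCovariant D
  torsion_eq_zero : C.torsion D = 0
  isCompatible : g.IsCompatible hσ D

end Metric

end BicovariantCalculus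

section Cosemisimple

variable (A : Type u) [Ring A] [HopfAlgebra ℂ A]

/-- A right `A`-comodule structure on `W`. -/
structure IsRightComodule {W : Type*} [AddCommGroup W] [Module ℂ W]
    (δ : W →ₗ[ℂ] W ⊗[ℂ] A) : Prop where
  coassoc : ∀ w, TensorProduct.assoc ℂ W A A (δ.rTensor A (δ w)) =
    (comul (R := ℂ) (A := A)).lTensor W (δ w)
  counit_apply : ∀ w, (counit (R := ℂ) (A := A)).lTensor W (δ w) = w ⊗ₜ 1

/-- `U` is a subcomodule: `δ(U) ⊆ U ⊗ A`. -/
def IsSubcomodule {W : Type*} [AddCommGroup W] [Module ℂ W] (δ : W →ₗ[ℂ] W ⊗[ℂ] A)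
    (U : Submodule ℂ W) : Prop :=
  ∀ u ∈ U, δ u ∈ LinearMap.range (U.subtype.rTensor A)

/-- `A` is cosemisimple: the category of finite-dimensional right `A`-comodules is semisimple,
that is, every subcomodule of such a comodule has a complementary subcomodule. -/
def IsCosemisimple : Prop :=
  ∀ (W : Type) [AddCommGroup W] [Module ℂ W] [FiniteDimensional ℂ W] (δ : W →ₗ[ℂ] W ⊗[ℂ] A),
    IsRightComodule A δ → ∀ U : Submodule ℂ W, IsSubcomodule A δ U →
      ∃ U' : Submodule ℂ W, IsSubcomodule A δ U' ∧ IsCompl U U'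

end Cosemisimple

end Bicov

end

set_option linter.unusedSectionVars false

noncomputable section

open scoped TensorProduct
open TensorProduct Coalgebra HopfAlgebra MulOpposite

namespace Bicov

universe u v

/-! ### Finite-dimensional comodules and their matrix coefficients -/

section Comodules

variable {A : Type u} [Ring A] [HopfAlgebra ℂ A]

/-! The problem is affine linear on `₀E`. A left-covariant connection induces a linear map `T : ₀E →
₀E ⊗ ₀E`, and it is recovered from `T` by the Leibniz rule `∇(v a) = T(v) a + v ⊗_A da`, because `E
= ₀E · A`. Conversely every linear `T` extends in this way, because `₀E ⊗ A → E` is also injective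
(`mulR_bijective`). The extension is always left-covariant, and it is right-covariant as soon as `T`
is equivariant.

The torsion of a connection is right `A`-linear, so it can be tested on `₀E`, where its vanishing
reads `₀σ T - T = -z` with the fixed map `z(v) = v₍₀₎ ⊗ projL(d v₍₁₎)`
(`wedge_incl_add_extD_eq_zero_iff`). Since `g` is scalar on `₀E ⊗ ₀E`, compatibility reads `(id ⊗ g)
σ₁₂ (T ⊗ id) = 0` on the symmetric tensors (`isCompatible_iff`). The torsion equation has a
particular solution (`exists_torsionless`), and two solutions differ by a map into `ker(₀σ - 1)`,
the symmetric tensors. On such differences the compatibility equation is governed by `Φ_g`: its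
surjectivity supplies the correction that makes a solution compatible, and its injectivity makes the
result unique.

Right covariance follows from uniqueness. The adjoint coaction sends `T` to `m ↦ T(m₍₀₎)₍₀₎ ⊗
T(m₍₀₎)₍₁₎ S(m₍₁₎)`. Both equations have equivariant coefficients, so for every functional `φ` on
`A` the slice of this map by `φ` solves the same equations with the inhomogeneous term multiplied by
`φ(1)`. By uniqueness it equals `φ(1) T`. Hence `T` is coinvariant for the adjoint coaction, which
means that it is equivariant (`intertwines_of_unique`).

Freeness of `E` over `₀E` on the right needs the inverse of the antipode, which exists by Larson's
argument. For a matrix corepresentation `u` the identity element of `W ⊗ W*` is coinvariant, and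
cosemisimplicity splits it off by an invariant functional. This functional is a matrix `Q` of trace
`1` with `S²(u) Q = Q u`. If `u` is irreducible, `Q` is invertible by Schur's lemma, so the
coefficients of `u` lie in the image under `S²` of their own span. Complete reducibility extends
this to all finite-dimensional comodules, a dimension count makes `S²` bijective on each coefficient
space, and these spaces exhaust `A`. -/

/-- The matrix coefficient `(φ ⊗ id) δ(w)` of a linear map `δ : W → W ⊗ A`. -/
def matrixCoeff {W : Type*} [AddCommGroup W] [Module ℂ W] (δ : W →ₗ[ℂ] W ⊗[ℂ] A)
    (φ : W →ₗ[ℂ] ℂ) : W →ₗ[ℂ] A :=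
  (TensorProduct.lid ℂ A).toLinearMap ∘ₗ φ.rTensor A ∘ₗ δ

/-- The space spanned by the matrix coefficients of `δ`. -/
def coeffSpace {W : Type*} [AddCommGroup W] [Module ℂ W] (δ : W →ₗ[ℂ] W ⊗[ℂ] A) :
    Submodule ℂ A :=
  Submodule.span ℂ {a | ∃ φ w, a = matrixCoeff δ φ w}

section Induced

variable {M W : Type*} [AddCommGroup M] [Module ℂ M] [AddCommGroup W] [Module ℂ W]
  {δ : M →ₗ[ℂ] M ⊗[ℂ] A} {j : W →ₗ[ℂ] M} {π : M →ₗ[ℂ] W}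

/-- The composite `j π` is the identity on the range of `j`, and the coaction stays in `range j ⊗
A`. The choice of `π` off that range is therefore immaterial. -/
lemma rTensor_induced (hπ : π ∘ₗ j = LinearMap.id)
    (hj : ∀ w, δ (j w) ∈ LinearMap.range (j.rTensor A)) (w : W) :
    j.rTensor A (π.rTensor A (δ (j w))) = δ (j w) := by
  obtain ⟨y, hy⟩ := hj w
  rw [← hy, ← LinearMap.comp_apply (π.rTensor A), ← LinearMap.rTensor_comp, hπ]
  simp

/-- A comodule structure restricts along a split injection whose range is a subcomodule. -/
lemma IsRightComodule.induced (hδ : IsRightComodule A δ) (hπ : π ∘ₗ j = LinearMap.id)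
    (hj : ∀ w, δ (j w) ∈ LinearMap.range (j.rTensor A)) :
    IsRightComodule A (π.rTensor A ∘ₗ δ ∘ₗ j) := by
  have hcomp : j.rTensor A ∘ₗ (π.rTensor A ∘ₗ δ ∘ₗ j) = δ ∘ₗ j :=
    LinearMap.ext (rTensor_induced hπ hj)
  constructor
  · intro w
    have h1 : ∀ z : W ⊗[ℂ] A, TensorProduct.assoc ℂ W A A
        ((π.rTensor A ∘ₗ δ ∘ₗ j).rTensor A z) =
        π.rTensor (A ⊗[ℂ] A) (TensorProduct.assoc ℂ M A A (δ.rTensor A (j.rTensor A z))) := by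
      intro z
      induction z with
      | zero => simp
      | add x y hx hy => simp only [map_add, hx, hy]
      | tmul w a =>
        simp only [LinearMap.rTensor_tmul, LinearMap.comp_apply]
        generalize δ (j w) = t
        induction t with
        | zero => simp
        | add x y hx hy => simp only [map_add, add_tmul, hx, hy]
        | tmul m b => simp
    have h2 : ∀ z : M ⊗[ℂ] A, (comul (R := ℂ) (A := A)).lTensor W (π.rTensor A z) =
        π.rTensor (A ⊗[ℂ] A) ((comul (R := ℂ) (A := A)).lTensor M z) := by
      intro z
      induction z with
      | zero => simp
      | add x y hx hy => simp only [map_add, hx, hy]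
      | tmul w a => simp
    rw [h1]
    simp only [LinearMap.comp_apply, h2]
    rw [rTensor_induced hπ hj, hδ.coassoc]
  · intro w
    have h2 : ∀ z : M ⊗[ℂ] A, (counit (R := ℂ) (A := A)).lTensor W (π.rTensor A z) =
        π.rTensor ℂ ((counit (R := ℂ) (A := A)).lTensor M z) := by
      intro z
      induction z with
      | zero => simp
      | add x y hx hy => simp only [map_add, hx, hy]
      | tmul w a => simp
    simp only [LinearMap.comp_apply, h2, hδ.counit_apply, LinearMap.rTensor_tmul]
    rw [← LinearMap.comp_apply, hπ, LinearMap.id_apply]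

lemma matrixCoeff_induced (hπ : π ∘ₗ j = LinearMap.id)
    (hj : ∀ w, δ (j w) ∈ LinearMap.range (j.rTensor A)) (φ : M →ₗ[ℂ] ℂ) (w : W) :
    matrixCoeff (π.rTensor A ∘ₗ δ ∘ₗ j) (φ ∘ₗ j) w = matrixCoeff δ φ (j w) := by
  simp only [matrixCoeff, LinearMap.comp_apply, LinearEquiv.coe_coe, LinearMap.rTensor_comp]
  rw [rTensor_induced hπ hj]

lemma coeffSpace_induced_le :
    coeffSpace (π.rTensor A ∘ₗ δ ∘ₗ j) ≤ coeffSpace δ := by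
  refine Submodule.span_le.2 ?_
  rintro _ ⟨φ, w, rfl⟩
  refine Submodule.subset_span ⟨φ ∘ₗ π, j w, ?_⟩
  simp [matrixCoeff, LinearMap.rTensor_comp]

end Induced

/-- Every element of `A` is a matrix coefficient of a finite-dimensional comodule. -/
lemma exists_mem_coeffSpace (a : A) : ∃ (n : ℕ) (δ : (Fin n → ℂ) →ₗ[ℂ] (Fin n → ℂ) ⊗[ℂ] A),
    IsRightComodule A δ ∧ a ∈ coeffSpace δ := by
  classical
  let b := Module.Basis.ofVectorSpace ℂ A
  -- With `Δ(a) = ∑ fᵢ ⊗ bᵢ` for a basis `b` of `A`, the finitely many left legs `fᵢ` span the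
  -- required subcomodule of `A`.
  obtain ⟨f, hf⟩ := TensorProduct.eq_repr_basis_right b (comul (R := ℂ) a)
  let W₀ : Submodule ℂ A := Submodule.span ℂ (f.support.image f : Finset A)
  have hfW : ∀ i, f i ∈ W₀ := by
    intro i
    by_cases hi : i ∈ f.support
    · exact Submodule.subset_span (Finset.mem_coe.2 (Finset.mem_image_of_mem f hi))
    · simp only [Finsupp.mem_support_iff, not_not] at hi
      rw [hi]
      exact zero_mem _
  have hΔ : ∀ w ∈ W₀, comul (R := ℂ) w ∈ LinearMap.range (W₀.subtype.rTensor A) := by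
    -- Since `fᵢ = (id ⊗ bᵢ*) Δ(a)`, coassociativity gives `Δ(fᵢ) = ∑ₖ fₖ ⊗ (id ⊗ bᵢ*) Δ(bₖ)`, whose
    -- left legs are again in `W₀`.
    have hgen : ∀ i, comul (R := ℂ) (f i) ∈ LinearMap.range (W₀.subtype.rTensor A) := by
      intro i
      have h1 : f i = TensorProduct.rid ℂ A ((b.coord i).lTensor A (comul a)) := by
        rw [← TensorProduct.equivFinsuppOfBasisRight_apply, ← hf,
          ← TensorProduct.equivFinsuppOfBasisRight_symm_apply, LinearEquiv.apply_symm_apply]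
      have h2 : ∀ z : A ⊗[ℂ] A, comul (R := ℂ) (TensorProduct.rid ℂ A ((b.coord i).lTensor A z)) =
          ((TensorProduct.rid ℂ A).toLinearMap ∘ₗ (b.coord i).lTensor A).lTensor A
            (TensorProduct.assoc ℂ A A A ((comul (R := ℂ) (A := A)).rTensor A z)) := by
        intro z
        induction z with
        | zero => simp
        | add x y hx hy => simp only [map_add, hx, hy]
        | tmul x y =>
          simp only [LinearMap.lTensor_tmul, TensorProduct.rid_tmul, map_smul,
            LinearMap.rTensor_tmul]
          generalize (comul x : A ⊗[ℂ] A) = t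
          induction t with
          | zero => simp
          | add x y hx hy => simp only [map_add, add_tmul, smul_add, hx, hy]
          | tmul x y => simp
      rw [h1, h2, coassoc_apply, ← hf, Finsupp.sum, map_sum, map_sum]
      refine Submodule.sum_mem _ fun k _ => ?_
      exact ⟨⟨f k, hfW k⟩ ⊗ₜ _, rfl⟩
    intro w hw
    induction hw using Submodule.span_induction with
    | mem x hx =>
      obtain ⟨i, -, rfl⟩ := Finset.mem_image.1 (Finset.mem_coe.1 hx)
      exact hgen i
    | zero => simp
    | add x y _ _ hx hy => rw [map_add]; exact add_mem hx hy
    | smul c x _ hx => rw [map_smul]; exact Submodule.smul_mem _ c hx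
  -- The counit law gives `a = ∑ ε(bᵢ) fᵢ`.
  have haW : a ∈ W₀ := by
    have h := lTensor_counit_comul (R := ℂ) a
    rw [← hf, Finsupp.sum, map_sum] at h
    have h' := congrArg (TensorProduct.rid ℂ A) h
    simp only [map_sum, LinearMap.lTensor_tmul, TensorProduct.rid_tmul, one_smul] at h'
    rw [← h']
    exact Submodule.sum_mem _ fun i _ => Submodule.smul_mem _ _ (hfW i)
  have : FiniteDimensional ℂ W₀ := FiniteDimensional.span_finset ℂ _
  -- The comodule is transported to `Fin n → ℂ` because `IsCosemisimple` speaks only of comodules in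
  -- `Type`, while `A` may lie in a higher universe.
  let e := (Module.finBasis ℂ W₀).equivFun
  obtain ⟨p, hp⟩ := W₀.subtype.exists_leftInverse_of_injective
    (LinearMap.ker_eq_bot.2 W₀.injective_subtype)
  let j : (Fin (Module.finrank ℂ W₀) → ℂ) →ₗ[ℂ] A := W₀.subtype ∘ₗ e.symm.toLinearMap
  let π : A →ₗ[ℂ] (Fin (Module.finrank ℂ W₀) → ℂ) := e.toLinearMap ∘ₗ p
  have hπ : π ∘ₗ j = LinearMap.id := by
    ext1 w
    have := LinearMap.congr_fun hp (e.symm (Pi.single w 1))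
    simp only [LinearMap.comp_apply, LinearMap.id_apply, Submodule.subtype_apply] at this
    ext1
    simp [π, j, this]
  have hj : ∀ w, comul (R := ℂ) (j w) ∈ LinearMap.range (j.rTensor A) := by
    intro w
    obtain ⟨y, hy⟩ := hΔ (j w) (e.symm w).2
    refine ⟨e.toLinearMap.rTensor A y, ?_⟩
    rw [← hy, ← LinearMap.comp_apply, ← LinearMap.rTensor_comp, LinearMap.comp_assoc]
    simp
  have hA : IsRightComodule A (comul (R := ℂ) (A := A)) :=
    ⟨fun w => coassoc_apply w, fun w => lTensor_counit_comul w⟩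
  -- The coefficient of `a` against the counit is `(ε ⊗ id) Δ(a) = a`.
  refine ⟨_, _, hA.induced hπ hj, Submodule.subset_span ⟨counit ∘ₗ j, e ⟨a, haW⟩, ?_⟩⟩
  rw [matrixCoeff_induced hπ hj]
  simp [matrixCoeff, j]

/-- A coinvariant vector of a finite-dimensional comodule is split off by an invariant
functional. -/
lemma IsCosemisimple.exists_invariant_functional (hA : IsCosemisimple A) {W : Type}
    [AddCommGroup W] [Module ℂ W] [FiniteDimensional ℂ W] {δ : W →ₗ[ℂ] W ⊗[ℂ] A}
    (hδ : IsRightComodule A δ) {x : W} (hx : δ x = x ⊗ₜ 1) (hx0 : x ≠ 0) :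
    ∃ p : W →ₗ[ℂ] ℂ, p x = 1 ∧ ∀ w, matrixCoeff δ p w = algebraMap ℂ A (p w) := by
  obtain ⟨U', hU', hc⟩ := hA W δ hδ (Submodule.span ℂ {x}) (by
    intro u hu
    obtain ⟨c, rfl⟩ := Submodule.mem_span_singleton.1 hu
    rw [map_smul, hx]
    exact ⟨(⟨c • x, hu⟩ : Submodule.span ℂ {x}) ⊗ₜ 1, rfl⟩)
  -- `p` is the `x`-coordinate of the projection along a complementary subcomodule `U'`.
  let p : W →ₗ[ℂ] ℂ := (LinearEquiv.coord ℂ W x hx0 : _ →ₗ[ℂ] ℂ) ∘ₗ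
    Submodule.projectionOnto _ _ hc
  have hpx : p x = 1 := by
    have : Submodule.projectionOnto _ _ hc x =
        ⟨x, Submodule.mem_span_singleton_self x⟩ :=
      Submodule.projectionOnto_apply_left hc ⟨x, Submodule.mem_span_singleton_self x⟩
    simp only [p, LinearMap.comp_apply, this]
    exact LinearEquiv.coord_self ℂ W x hx0
  have hpU : p ∘ₗ U'.subtype = 0 := by
    ext u
    simp [p, Submodule.projectionOnto_apply_right hc u]
  -- Invariance is checked on the two summands: `x` is coinvariant, and on `U'` both sides vanish
  -- because `δ(U') ⊆ U' ⊗ A` and `p` kills `U'`.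
  refine ⟨p, hpx, fun w => ?_⟩
  have hw : w ∈ Submodule.span ℂ {x} ⊔ U' := by rw [hc.sup_eq_top]; trivial
  obtain ⟨y, hy, z, hz, rfl⟩ := Submodule.mem_sup.1 hw
  obtain ⟨c, rfl⟩ := Submodule.mem_span_singleton.1 hy
  obtain ⟨t, ht⟩ := hU' z hz
  have hpz : p z = 0 := LinearMap.congr_fun hpU ⟨z, hz⟩
  have h0 : matrixCoeff δ p z = 0 := by
    rw [matrixCoeff, LinearMap.comp_apply, LinearMap.comp_apply, ← ht,
      ← LinearMap.comp_apply (p.rTensor A), ← LinearMap.rTensor_comp, hpU]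
    simp
  rw [map_add, h0, map_smul, map_add, hpz, map_smul, hpx]
  simp [matrixCoeff, hx, hpx, Algebra.algebraMap_eq_smul_one]

end Comodules

/-! ### Matrix corepresentations and the intertwiner between `u` and `S²(u)` -/

section Corepresentations

variable {A : Type u} [Ring A] [HopfAlgebra ℂ A] {ι : Type} [Fintype ι] [DecidableEq ι]

/-- A matrix corepresentation: `Δ(u i j) = ∑ k, u i k ⊗ u k j` and `ε(u i j) = δ i j`. -/
structure IsCorep (u : Matrix ι ι A) : Prop where
  comul_apply : ∀ i j, comul (R := ℂ) (u i j) = ∑ k, u i k ⊗ₜ[ℂ] u k j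
  counit_apply : ∀ i j, counit (R := ℂ) (u i j) = (1 : Matrix ι ι ℂ) i j

/-- The coaction `e j ↦ ∑ i, e i ⊗ u i j` on `ι → ℂ`. -/
def corepCoaction (u : Matrix ι ι A) : (ι → ℂ) →ₗ[ℂ] (ι → ℂ) ⊗[ℂ] A :=
  (Pi.basisFun ℂ ι).constr ℂ fun j => ∑ i, Pi.single i 1 ⊗ₜ u i j

lemma corepCoaction_single (u : Matrix ι ι A) (j : ι) :
    corepCoaction u (Pi.single j 1) = ∑ i, Pi.single i 1 ⊗ₜ u i j := by
  rw [← Pi.basisFun_apply, corepCoaction, Module.Basis.constr_basis]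

namespace IsCorep

variable {u : Matrix ι ι A}

lemma isRightComodule (hu : IsCorep u) : IsRightComodule A (corepCoaction u) := by
  constructor
  · have : (TensorProduct.assoc ℂ (ι → ℂ) A A).toLinearMap ∘ₗ
        (corepCoaction u).rTensor A ∘ₗ corepCoaction u =
        (comul (R := ℂ) (A := A)).lTensor (ι → ℂ) ∘ₗ corepCoaction u := by
      refine (Pi.basisFun ℂ ι).ext fun j => ?_
      simp only [Pi.basisFun_apply, LinearMap.comp_apply, corepCoaction_single, map_sum,
        LinearMap.rTensor_tmul, LinearMap.lTensor_tmul, hu.comul_apply, sum_tmul, tmul_sum,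
        LinearEquiv.coe_coe, assoc_tmul]
      exact Finset.sum_comm
    exact LinearMap.congr_fun this
  · have : (counit (R := ℂ) (A := A)).lTensor (ι → ℂ) ∘ₗ corepCoaction u =
        (TensorProduct.mk ℂ (ι → ℂ) ℂ).flip 1 := by
      refine (Pi.basisFun ℂ ι).ext fun j => ?_
      simp only [Pi.basisFun_apply, LinearMap.comp_apply, corepCoaction_single, map_sum,
        LinearMap.lTensor_tmul, hu.counit_apply, Matrix.one_apply, LinearMap.flip_apply,
        TensorProduct.mk_apply]
      rw [Finset.sum_eq_single j (fun i _ hi => by simp [hi]) (by simp)]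
      simp
    exact LinearMap.congr_fun this

lemma mul_antipode (hu : IsCorep u) : u * u.map (antipode ℂ) = 1 := by
  ext i j
  have h := mul_antipode_lTensor_comul_apply (R := ℂ) (u i j)
  rw [hu.comul_apply, hu.counit_apply] at h
  simp only [map_sum, LinearMap.lTensor_tmul, LinearMap.mul'_apply] at h
  rw [Matrix.mul_apply]
  simp only [Matrix.map_apply, h, Matrix.one_apply]
  split_ifs <;> simp

lemma antipode_mul (hu : IsCorep u) : u.map (antipode ℂ) * u = 1 := by
  ext i j
  have h := mul_antipode_rTensor_comul_apply (R := ℂ) (u i j)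
  rw [hu.comul_apply, hu.counit_apply] at h
  simp only [map_sum, LinearMap.rTensor_tmul, LinearMap.mul'_apply] at h
  rw [Matrix.mul_apply]
  simp only [Matrix.map_apply, h, Matrix.one_apply]
  split_ifs <;> simp

/-- Both sides are the entries of an inverse of the matrix `Δ(u)` over `A ⊗ A`. Applying the ring
map `Δ` to `u S(u) = 1` shows that `Δ(S(u))` is a right inverse, and the matrix `Z` of the
right-hand sides is a left inverse by a direct computation. -/
lemma comul_antipode (hu : IsCorep u) (i j : ι) :
    comul (R := ℂ) (antipode ℂ (u i j)) = ∑ k, antipode ℂ (u k j) ⊗ₜ[ℂ] antipode ℂ (u i k) := by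
  let c : A →+* A ⊗[ℂ] A := (Bialgebra.comulAlgHom ℂ A).toRingHom
  have hc : ∀ a, c a = comul a := fun a => rfl
  let Z : Matrix ι ι (A ⊗[ℂ] A) :=
    Matrix.of fun i j => ∑ k, antipode ℂ (u k j) ⊗ₜ[ℂ] antipode ℂ (u i k)
  have h1 : u.map c * (u.map (antipode ℂ)).map c = 1 := by
    rw [← Matrix.map_mul, hu.mul_antipode]
    exact Matrix.map_one c (map_zero c) (map_one c)
  have h2 : Z * u.map c = 1 := by
    ext l j
    have h : ∀ m p, ∑ k, antipode ℂ (u m k) * u k p = (1 : Matrix ι ι A) m p := fun m p => by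
      rw [← hu.antipode_mul, Matrix.mul_apply]; rfl
    calc (Z * u.map c) l j
        = ∑ k, ∑ m, ∑ p, (antipode ℂ (u m k) * u k p) ⊗ₜ[ℂ] (antipode ℂ (u l m) * u p j) := by
          simp only [Matrix.mul_apply, Z, Matrix.of_apply, Matrix.map_apply, hc, hu.comul_apply,
            Finset.sum_mul_sum, Algebra.TensorProduct.tmul_mul_tmul]
      _ = ∑ m, ∑ p, (∑ k, antipode ℂ (u m k) * u k p) ⊗ₜ[ℂ] (antipode ℂ (u l m) * u p j) := by
          simp only [sum_tmul]
          rw [Finset.sum_comm]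
          exact Finset.sum_congr rfl fun m _ => Finset.sum_comm
      _ = ∑ m, 1 ⊗ₜ[ℂ] (antipode ℂ (u l m) * u m j) := by
          refine Finset.sum_congr rfl fun m _ => ?_
          simp only [h, Matrix.one_apply]
          rw [Finset.sum_eq_single m (fun p _ hp => by simp [hp.symm]) (by simp)]
          simp
      _ = _ := by
          rw [← tmul_sum, h, Matrix.one_apply, Matrix.one_apply]
          split_ifs <;> simp [Algebra.TensorProduct.one_def]
  have h3 := left_inv_eq_right_inv h2 h1
  exact (congrFun (congrFun h3 i) j).symm

/-- The matrix corepresentation on `W ⊗ W*`. -/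
lemma tensorDual (hu : IsCorep u) : IsCorep (Matrix.of fun p q : ι × ι =>
    u p.1 q.1 * antipode ℂ (u q.2 p.2)) := by
  constructor
  · rintro ⟨i, k⟩ ⟨j, l⟩
    simp only [Matrix.of_apply, Bialgebra.comul_mul, hu.comul_apply, hu.comul_antipode,
      Finset.sum_mul_sum, Algebra.TensorProduct.tmul_mul_tmul, Fintype.sum_prod_type]
  · rintro ⟨i, k⟩ ⟨j, l⟩
    simp only [Matrix.of_apply, Bialgebra.counit_mul, hu.counit_apply, counit_antipode,
      Matrix.one_apply, Prod.mk.injEq]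
    by_cases h1 : i = j <;> by_cases h2 : k = l <;> simp [h1, h2, Ne.symm]

/-- Over a cosemisimple Hopf algebra the square of the antipode intertwines. -/
lemma exists_antipode_sq_mul (hu : IsCorep u) [Nonempty ι] (hA : IsCosemisimple A) :
    ∃ Q : Matrix ι ι ℂ, Q ≠ 0 ∧
      (u.map (antipode ℂ)).map (antipode ℂ) * Q.map (algebraMap ℂ A) =
        Q.map (algebraMap ℂ A) * u := by
  let w : Matrix (ι × ι) (ι × ι) A := Matrix.of fun p q => u p.1 q.1 * antipode ℂ (u q.2 p.2)
  -- `x` is the identity of `W` seen in `W ⊗ W*`. It is coinvariant because `u S(u) = 1`.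
  let x : ι × ι → ℂ := ∑ j, Pi.single (j, j) 1
  have hx : corepCoaction w x = x ⊗ₜ 1 := by
    have h : ∀ i k, ∑ j, u i j * antipode ℂ (u j k) = (1 : Matrix ι ι A) i k := fun i k => by
      rw [← hu.mul_antipode, Matrix.mul_apply]; rfl
    simp only [x, map_sum, corepCoaction_single]
    rw [Finset.sum_comm, sum_tmul, Fintype.sum_prod_type]
    refine Finset.sum_congr rfl fun i _ => ?_
    simp only [w, Matrix.of_apply, ← tmul_sum, h, Matrix.one_apply]
    rw [Finset.sum_eq_single i (fun p _ hp => by simp [hp.symm]) (by simp)]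
    simp
  have hxi : ∀ i, x (i, i) = 1 := by
    intro i
    simp only [x, Finset.sum_apply]
    rw [Finset.sum_eq_single i (fun p _ hp => by simp [hp.symm]) (by simp)]
    simp
  have hx0 : x ≠ 0 := fun h => by
    have := hxi (Classical.arbitrary ι)
    rw [h] at this
    simp at this
  obtain ⟨p, hpx, hp⟩ := hA.exists_invariant_functional hu.tensorDual.isRightComodule hx hx0
  let Q : Matrix ι ι ℂ := Matrix.of fun k i => p (Pi.single (i, k) 1)
  -- Invariance of `p` at the basis vector `(j, l)` reads `∑ Q k i • u i j S(u l k) = Q l j • 1`.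
  -- The antipode reverses each product and turns this into `S²(u) Q S(u) = Q`.
  have hQ : (u.map (antipode ℂ)).map (antipode ℂ) * Q.map (algebraMap ℂ A) *
      u.map (antipode ℂ) = Q.map (algebraMap ℂ A) := by
    ext l j
    have h := congrArg (antipode ℂ) (hp (Pi.single (j, l) 1))
    simp only [matrixCoeff, LinearMap.comp_apply, corepCoaction_single, map_sum,
      LinearMap.rTensor_tmul, LinearEquiv.coe_coe, lid_tmul, Matrix.of_apply, map_smul,
      antipode_mul_antidistrib, Algebra.algebraMap_eq_smul_one, antipode_one] at h
    simp only [Matrix.map_apply, Q, Matrix.of_apply, Algebra.algebraMap_eq_smul_one, ← h,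
      Matrix.mul_apply, Fintype.sum_prod_type, Finset.sum_mul]
    simp
  refine ⟨Q, fun h0 => ?_, ?_⟩
  -- The trace of `Q` is `p x = 1`, so `Q` is not zero.
  · have : p x = ∑ j, Q j j := by simp [x, Q]
    rw [hpx, h0] at this
    simp at this
  · conv_rhs => rw [← hQ]
    rw [Matrix.mul_assoc _ _ u, hu.antipode_mul, Matrix.mul_one]

end IsCorep

end Corepresentations

/-! ### Bijectivity of the antipode of a cosemisimple Hopf algebra -/

section Antipode

variable {A : Type u} [Ring A] [HopfAlgebra ℂ A]

section Basis

variable {W : Type*} [AddCommGroup W] [Module ℂ W] {δ : W →ₗ[ℂ] W ⊗[ℂ] A}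
  {ι : Type} [Fintype ι] [DecidableEq ι] (b : Module.Basis ι ℂ W)

variable (δ) in
/-- The matrix of a coaction with respect to a basis. -/
def coactionMatrix : Matrix ι ι A := Matrix.of fun i j => matrixCoeff δ (b.coord i) (b j)

lemma coaction_basis (j : ι) : δ (b j) = ∑ i, b i ⊗ₜ coactionMatrix δ b i j := by
  have key : ∀ z : W ⊗[ℂ] A,
      z = ∑ i, b i ⊗ₜ[ℂ] TensorProduct.lid ℂ A ((b.coord i).rTensor A z) := by
    intro z
    induction z with
    | zero => simp
    | add x y hx hy =>
      simp only [map_add, tmul_add, Finset.sum_add_distrib]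
      rw [← hx, ← hy]
    | tmul w a =>
      conv_lhs => rw [← b.sum_repr w]
      simp only [sum_tmul, LinearMap.rTensor_tmul, lid_tmul, Module.Basis.coord_apply, tmul_smul,
        smul_tmul']
  exact key _

lemma IsRightComodule.isCorep (hδ : IsRightComodule A δ) : IsCorep (coactionMatrix δ b) := by
  constructor
  · intro i j
    have h := hδ.coassoc (b j)
    have h' := congrArg (fun z => TensorProduct.lid ℂ (A ⊗[ℂ] A)
      ((b.coord i).rTensor (A ⊗[ℂ] A) z)) h
    simp only [coaction_basis b, map_sum, LinearMap.rTensor_tmul, LinearMap.lTensor_tmul, sum_tmul,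
      assoc_tmul, lid_tmul, Module.Basis.coord_apply, Module.Basis.repr_self,
      Finsupp.single_apply, ite_smul, one_smul, zero_smul, Finset.sum_ite_eq',
      Finset.mem_univ, if_true] at h'
    exact h'.symm
  · intro i j
    have h := hδ.counit_apply (b j)
    have h' := congrArg (fun z => TensorProduct.lid ℂ ℂ ((b.coord i).rTensor ℂ z)) h
    simp only [coaction_basis b, map_sum, LinearMap.rTensor_tmul, LinearMap.lTensor_tmul,
      lid_tmul, Module.Basis.coord_apply, Module.Basis.repr_self,
      Finsupp.single_apply, ite_smul, one_smul, zero_smul, Finset.sum_ite_eq',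
      Finset.mem_univ, if_true] at h'
    rw [h', Matrix.one_apply]
    simp [eq_comm]

lemma coeffSpace_eq_span : coeffSpace δ =
    Submodule.span ℂ (Set.range fun p : ι × ι => coactionMatrix δ b p.1 p.2) := by
  apply le_antisymm
  · refine Submodule.span_le.2 ?_
    rintro _ ⟨φ, w, rfl⟩
    rw [← b.sum_repr w, map_sum]
    refine Submodule.sum_mem _ fun j _ => ?_
    rw [map_smul]
    refine Submodule.smul_mem _ _ ?_
    rw [matrixCoeff, LinearMap.comp_apply, LinearMap.comp_apply, coaction_basis b, map_sum,
      map_sum]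
    refine Submodule.sum_mem _ fun i _ => ?_
    simp only [LinearMap.rTensor_tmul, LinearEquiv.coe_coe, lid_tmul]
    exact Submodule.smul_mem _ _ (Submodule.subset_span ⟨(i, j), rfl⟩)
  · refine Submodule.span_mono ?_
    rintro _ ⟨⟨i, j⟩, rfl⟩
    exact ⟨_, _, rfl⟩

end Basis

lemma finiteDimensional_coeffSpace {W : Type*} [AddCommGroup W] [Module ℂ W]
    [FiniteDimensional ℂ W] (δ : W →ₗ[ℂ] W ⊗[ℂ] A) : FiniteDimensional ℂ (coeffSpace δ) := by
  rw [coeffSpace_eq_span (Module.finBasis ℂ W)]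
  exact FiniteDimensional.span_of_finite ℂ (Set.finite_range _)

/-- The square of the antipode. -/
def antipodeSq (A : Type u) [Ring A] [HopfAlgebra ℂ A] : A →ₗ[ℂ] A := antipode ℂ ∘ₗ antipode ℂ

/-- This is Schur's lemma for the matrix `Q` with `S²(u) Q = Q u`: it intertwines `δ` with the twist
of `δ` by `S²`, so its kernel is a subcomodule. Irreducibility and `Q ≠ 0` then make `Q` invertible,
and `u = Q⁻¹ S²(u) Q` expresses the coefficients through their images under `S²`. -/
lemma IsCosemisimple.coeffSpace_le_of_irreducible (hA : IsCosemisimple A) {W : Type}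
    [AddCommGroup W] [Module ℂ W] [FiniteDimensional ℂ W] {δ : W →ₗ[ℂ] W ⊗[ℂ] A}
    (hδ : IsRightComodule A δ) [Nontrivial W]
    (hirr : ∀ U : Submodule ℂ W, IsSubcomodule A δ U → U = ⊥ ∨ U = ⊤) :
    coeffSpace δ ≤ (coeffSpace δ).map (antipodeSq A) := by
  let b := Module.finBasis ℂ W
  set u := coactionMatrix δ b with hu
  have hub : ∀ j, δ (b j) = ∑ i, b i ⊗ₜ u i j := coaction_basis b
  have : Nonempty (Fin (Module.finrank ℂ W)) := b.index_nonempty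
  obtain ⟨Q, hQ0, hQ⟩ := (hδ.isCorep b).exists_antipode_sq_mul hA
  rw [← hu] at hQ
  have hQij : ∀ i j, ∑ k, Q k j • antipodeSq A (u i k) = ∑ k, Q i k • u k j := by
    intro i j
    have := congrFun (congrFun hQ i) j
    simp only [Matrix.mul_apply, Matrix.map_apply] at this
    simp only [Algebra.smul_def]
    rw [← this]
    exact Finset.sum_congr rfl fun k _ => Algebra.commutes _ _
  let q : W →ₗ[ℂ] W := Matrix.toLin b b Q
  have hqb : ∀ j, q (b j) = ∑ i, Q i j • b i := fun j => Matrix.toLin_self b b Q j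
  -- `q` intertwines `δ` and `(id ⊗ S²) δ`
  have hq : q.rTensor A ∘ₗ δ = (antipodeSq A).lTensor W ∘ₗ δ ∘ₗ q := by
    refine b.ext fun j => ?_
    simp only [LinearMap.comp_apply, hub, hqb, map_sum, LinearMap.rTensor_tmul,
      LinearMap.lTensor_tmul, sum_tmul, map_smul, Finset.smul_sum, smul_tmul, ← tmul_smul]
    rw [Finset.sum_comm]
    conv_rhs => rw [Finset.sum_comm]
    simp only [← tmul_sum, hQij]
  -- If `q w = 0`, then `(q ⊗ id) δ(w) = (id ⊗ S²) δ(q w) = 0`. By flatness of `A` over `ℂ` the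
  -- kernel of `q ⊗ id` is `ker q ⊗ A`.
  have hker : IsSubcomodule A δ (LinearMap.ker q) := by
    intro w hw
    have hex : Function.Exact (LinearMap.ker q).subtype q := LinearMap.exact_subtype_ker_map q
    refine (Module.Flat.rTensor_exact A hex (δ w)).1 ?_
    have := LinearMap.congr_fun hq w
    simp only [LinearMap.comp_apply, LinearMap.mem_ker.1 hw, map_zero] at this
    exact this
  have hinj : LinearMap.ker q = ⊥ := by
    refine (hirr _ hker).resolve_right fun h => hQ0 ?_
    have h0 : q = 0 := LinearMap.ker_eq_top.1 h
    exact (Matrix.toLin b b).map_eq_zero_iff.1 h0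
  obtain ⟨r, hr⟩ := q.exists_leftInverse_of_injective hinj
  -- `R` is the inverse of `Q`.
  let R : Matrix _ _ ℂ := LinearMap.toMatrix b b r
  have hRQ : R * Q = 1 := by
    have : LinearMap.toMatrix b b (r ∘ₗ q) = 1 := by rw [hr, LinearMap.toMatrix_id]
    rw [LinearMap.toMatrix_comp b b b, LinearMap.toMatrix_toLin] at this
    exact this
  rw [coeffSpace_eq_span b, Submodule.span_le]
  rintro _ ⟨⟨i, j⟩, rfl⟩
  have hij : u i j = ∑ l, R i l • ∑ k, Q k j • antipodeSq A (u l k) := by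
    simp only [hQij, Finset.smul_sum, smul_smul]
    rw [Finset.sum_comm]
    simp only [← Finset.sum_smul, ← Matrix.mul_apply, hRQ, Matrix.one_apply]
    simp
  rw [← hu]
  change u i j ∈ _
  rw [hij]
  refine Submodule.sum_mem _ fun l _ => Submodule.smul_mem _ _ (Submodule.sum_mem _ fun k _ =>
    Submodule.smul_mem _ _ (Submodule.mem_map_of_mem (Submodule.subset_span ⟨(l, k), rfl⟩)))

/-- In a decomposition into subcomodules the coaction is block diagonal, so every matrix coefficient
is a sum of coefficients of the two blocks. -/
lemma coeffSpace_le_sup {W : Type*} [AddCommGroup W] [Module ℂ W] {δ : W →ₗ[ℂ] W ⊗[ℂ] A}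
    {U U' : Submodule ℂ W} (hU : IsSubcomodule A δ U) (hU' : IsSubcomodule A δ U')
    (hc : IsCompl U U') :
    coeffSpace δ ≤ coeffSpace ((U.projectionOnto U' hc).rTensor A ∘ₗ δ ∘ₗ U.subtype) ⊔
      coeffSpace ((U'.projectionOnto U hc.symm).rTensor A ∘ₗ δ ∘ₗ U'.subtype) := by
  refine Submodule.span_le.2 ?_
  rintro _ ⟨φ, w, rfl⟩
  have hw : w ∈ U ⊔ U' := by rw [hc.sup_eq_top]; trivial
  obtain ⟨y, hy, z, hz, rfl⟩ := Submodule.mem_sup.1 hw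
  rw [map_add]
  refine add_mem (Submodule.mem_sup_left (Submodule.subset_span ⟨φ ∘ₗ U.subtype, ⟨y, hy⟩, ?_⟩))
    (Submodule.mem_sup_right (Submodule.subset_span ⟨φ ∘ₗ U'.subtype, ⟨z, hz⟩, ?_⟩))
  · rw [matrixCoeff_induced]
    · rfl
    · ext1 x; exact Submodule.projectionOnto_apply_left hc x
    · exact fun x => hU x x.2
  · rw [matrixCoeff_induced]
    · rfl
    · ext1 x; exact Submodule.projectionOnto_apply_left hc.symm x
    · exact fun x => hU' x x.2

/-- Complete reducibility, as strong induction on the dimension: a proper nonzero subcomodule has a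
complement that is also proper, and the inclusion for the two summands gives it for the whole
because their coefficients are among those of `W`. -/
lemma IsCosemisimple.coeffSpace_le (hA : IsCosemisimple A) (n : ℕ) :
    ∀ (W : Type) [AddCommGroup W] [Module ℂ W] [FiniteDimensional ℂ W] (δ : W →ₗ[ℂ] W ⊗[ℂ] A),
      Module.finrank ℂ W = n → IsRightComodule A δ →
        coeffSpace δ ≤ (coeffSpace δ).map (antipodeSq A) := by
  induction n using Nat.strong_induction_on with
  | _ n ih =>
    intro W _ _ _ δ hn hδ
    by_cases hirr : ∀ U : Submodule ℂ W, IsSubcomodule A δ U → U = ⊥ ∨ U = ⊤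
    · rcases subsingleton_or_nontrivial W with hW | hW
      · refine Submodule.span_le.2 ?_
        rintro _ ⟨φ, w, rfl⟩
        rw [Subsingleton.elim w 0, map_zero]
        exact zero_mem _
      · exact hA.coeffSpace_le_of_irreducible hδ hirr
    · push Not at hirr
      obtain ⟨U, hU, hbot, htop⟩ := hirr
      obtain ⟨U', hU', hc⟩ := hA W δ hδ U hU
      have hbot' : U' ≠ ⊥ := fun h => htop (by rw [h] at hc; exact eq_top_of_isCompl_bot hc)
      have htop' : U' ≠ ⊤ := fun h => hbot (by rw [h] at hc; exact eq_bot_of_isCompl_top hc)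
      have h1 := ih _ (hn ▸ Submodule.finrank_lt htop) U _ rfl (hδ.induced
        (π := U.projectionOnto U' hc) (j := U.subtype)
        (LinearMap.ext fun x => Submodule.projectionOnto_apply_left hc x) fun x => hU x x.2)
      have h2 := ih _ (hn ▸ Submodule.finrank_lt htop') U' _ rfl (hδ.induced
        (π := U'.projectionOnto U hc.symm) (j := U'.subtype)
        (LinearMap.ext fun x => Submodule.projectionOnto_apply_left hc.symm x) fun x => hU' x x.2)
      refine (coeffSpace_le_sup hU hU' hc).trans (sup_le (h1.trans ?_) (h2.trans ?_))
      · exact Submodule.map_mono coeffSpace_induced_le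
      · exact Submodule.map_mono coeffSpace_induced_le

/-- The square of the antipode of a cosemisimple Hopf algebra is bijective. -/
lemma IsCosemisimple.antipodeSq_bijective (hA : IsCosemisimple A) :
    Function.Bijective (antipodeSq A) := by
  constructor
  · refine (injective_iff_map_eq_zero _).2 fun a ha => ?_
    obtain ⟨n, δ, hδ, haδ⟩ := exists_mem_coeffSpace a
    have := finiteDimensional_coeffSpace δ
    have hle := hA.coeffSpace_le _ _ δ rfl hδ
    -- The image under `S²` contains the finite-dimensional coefficient space and has at most its
    -- dimension, so the two agree. Hence `S²` restricts to a surjective endomorphism of this space,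
    -- which is then injective.
    have heq : coeffSpace δ = (coeffSpace δ).map (antipodeSq A) :=
      Submodule.eq_of_le_of_finrank_le hle (Submodule.finrank_map_le _ _)
    let s : coeffSpace δ →ₗ[ℂ] coeffSpace δ := (antipodeSq A).restrict fun x hx => by
      rw [heq]; exact Submodule.mem_map_of_mem hx
    have hs : Function.Surjective s := by
      rintro ⟨x, hx⟩
      obtain ⟨y, hy, rfl⟩ := hle hx
      exact ⟨⟨y, hy⟩, rfl⟩
    have h0 : s ⟨a, haδ⟩ = s 0 := by
      rw [map_zero]; exact Subtype.ext ha
    exact congrArg Subtype.val (LinearMap.injective_iff_surjective.2 hs h0)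
  · intro a
    obtain ⟨n, δ, hδ, haδ⟩ := exists_mem_coeffSpace a
    obtain ⟨y, -, hy⟩ := hA.coeffSpace_le _ _ δ rfl hδ haδ
    exact ⟨y, hy⟩

/-- The antipode of a cosemisimple Hopf algebra is bijective. -/
lemma IsCosemisimple.antipode_bijective (hA : IsCosemisimple A) :
    Function.Bijective (antipode ℂ (A := A)) :=
  ⟨Function.Injective.of_comp (f := antipode ℂ (A := A)) hA.antipodeSq_bijective.1,
    Function.Surjective.of_comp (g := antipode ℂ (A := A)) hA.antipodeSq_bijective.2⟩

/-- The inverse of the antipode of a cosemisimple Hopf algebra. -/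
lemma IsCosemisimple.exists_antipode_inv (hA : IsCosemisimple A) : ∃ R : A →ₗ[ℂ] A,
    (∀ x : A, LinearMap.mul' ℂ A (R.lTensor A (TensorProduct.comm ℂ A A (comul x))) =
      algebraMap ℂ A (counit x)) ∧
    ∀ x : A, LinearMap.mul' ℂ A (R.rTensor A (TensorProduct.comm ℂ A A (comul x))) =
      algebraMap ℂ A (counit x) := by
  let e := LinearEquiv.ofBijective _ hA.antipode_bijective
  have he : ∀ x, antipode ℂ (e.symm x) = x := e.apply_symm_apply
  have hinj := hA.antipode_bijective.1
  have h1 : ∀ c : ℂ, antipode ℂ (algebraMap ℂ A c) = algebraMap ℂ A c := fun c => by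
    rw [Algebra.algebraMap_eq_smul_one, map_smul, antipode_one]
  -- The claims `x₂ S⁻¹(x₁) = ε(x)` and `S⁻¹(x₂) x₁ = ε(x)` become the two antipode axioms after the
  -- injective antihomomorphism `S` is applied.
  refine ⟨e.symm.toLinearMap, fun x => hinj ?_, fun x => hinj ?_⟩
  · rw [h1, ← mul_antipode_lTensor_comul_apply]
    generalize (comul x : A ⊗[ℂ] A) = t
    induction t with
    | zero => simp
    | add x y hx hy => simp only [map_add, hx, hy]
    | tmul x y => simp [antipode_mul_antidistrib, he]
  · rw [h1, ← mul_antipode_rTensor_comul_apply]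
    generalize (comul x : A ⊗[ℂ] A) = t
    induction t with
    | zero => simp
    | add x y hx hy => simp only [map_add, hx, hy]
    | tmul x y => simp [antipode_mul_antidistrib, he]

end Antipode

/-! ### The adjoint coaction on linear maps, and equivariance of unique solutions -/

section AdjointCoaction

variable {A : Type u} [Ring A] [HopfAlgebra ℂ A]
  {M N N' P : Type*} [AddCommGroup M] [Module ℂ M] [AddCommGroup N] [Module ℂ N]
  [AddCommGroup N'] [Module ℂ N'] [AddCommGroup P] [Module ℂ P]

/-- The diagonal coaction `m ⊗ p ↦ m₍₀₎ ⊗ p₍₀₎ ⊗ m₍₁₎ p₍₁₎`. -/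
def diagCo (δM : M →ₗ[ℂ] M ⊗[ℂ] A) (δP : P →ₗ[ℂ] P ⊗[ℂ] A) :
    M ⊗[ℂ] P →ₗ[ℂ] (M ⊗[ℂ] P) ⊗[ℂ] A :=
  (LinearMap.mul' ℂ A).lTensor _ ∘ₗ
    (tensorTensorTensorComm ℂ M A P A).toLinearMap ∘ₗ map δM δP

/-- A linear map that intertwines two coactions. -/
def Intertwines (δM : M →ₗ[ℂ] M ⊗[ℂ] A) (δN : N →ₗ[ℂ] N ⊗[ℂ] A) (f : M →ₗ[ℂ] N) : Prop :=
  ∀ m, δN (f m) = f.rTensor A (δM m)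

lemma Intertwines.comp {δM : M →ₗ[ℂ] M ⊗[ℂ] A} {δN : N →ₗ[ℂ] N ⊗[ℂ] A}
    {δP : P →ₗ[ℂ] P ⊗[ℂ] A} {f : N →ₗ[ℂ] P} {h : M →ₗ[ℂ] N} (hf : Intertwines δN δP f)
    (hh : Intertwines δM δN h) : Intertwines δM δP (f ∘ₗ h) := by
  intro m
  rw [LinearMap.comp_apply, hf, hh, LinearMap.rTensor_comp, LinearMap.comp_apply]

lemma Intertwines.rTensor {δM : M →ₗ[ℂ] M ⊗[ℂ] A} {δN : N →ₗ[ℂ] N ⊗[ℂ] A} {f : M →ₗ[ℂ] N}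
    (hf : Intertwines δM δN f) (δP : P →ₗ[ℂ] P ⊗[ℂ] A) :
    Intertwines (diagCo δM δP) (diagCo δN δP) (f.rTensor P) := by
  intro t
  induction t with
  | zero => simp
  | add x y hx hy => simp only [map_add, hx, hy]
  | tmul m p =>
    simp only [diagCo, LinearMap.comp_apply, LinearMap.rTensor_tmul, map_tmul, hf m]
    generalize δM m = x
    generalize δP p = y
    induction x with
    | zero => simp
    | add x₁ x₂ h₁ h₂ => simp only [map_add, add_tmul, h₁, h₂]
    | tmul m a =>
      induction y with
      | zero => simp
      | add x₁ x₂ h₁ h₂ => simp only [map_add, tmul_add, h₁, h₂]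
      | tmul p b => simp

variable (N) in
/-- `(n ⊗ a) ⊗ b ↦ n ⊗ a S(b)`. -/
def mulAntipode : (N ⊗[ℂ] A) ⊗[ℂ] A →ₗ[ℂ] N ⊗[ℂ] A :=
  (LinearMap.mul' ℂ A ∘ₗ (antipode ℂ).lTensor A).lTensor N ∘ₗ
    (TensorProduct.assoc ℂ N A A).toLinearMap

@[simp] lemma mulAntipode_tmul (n : N) (a b : A) :
    mulAntipode N ((n ⊗ₜ a) ⊗ₜ b) = n ⊗ₜ (a * antipode ℂ b) := rfl

/-- The adjoint coaction on linear maps: `m ↦ T(m₍₀₎)₍₀₎ ⊗ T(m₍₀₎)₍₁₎ S(m₍₁₎)`. -/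
def adCo (δM : M →ₗ[ℂ] M ⊗[ℂ] A) (δN : N →ₗ[ℂ] N ⊗[ℂ] A) (T : M →ₗ[ℂ] N) :
    M →ₗ[ℂ] N ⊗[ℂ] A :=
  mulAntipode N ∘ₗ (δN ∘ₗ T).rTensor A ∘ₗ δM

/-- The adjoint coaction is natural in its target: an equivariant `f` commutes with the coaction
taken after `T`. Consequently an equivariant linear equation on `T` can be transported through the
adjoint coaction. -/
lemma adCo_comp {δM : M →ₗ[ℂ] M ⊗[ℂ] A} {δN : N →ₗ[ℂ] N ⊗[ℂ] A} {δN' : N' →ₗ[ℂ] N' ⊗[ℂ] A}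
    {f : N →ₗ[ℂ] N'} (hf : Intertwines δN δN' f) (T : M →ₗ[ℂ] N) (m : M) :
    adCo δM δN' (f ∘ₗ T) m = f.rTensor A (adCo δM δN T m) := by
  simp only [adCo, LinearMap.comp_apply]
  generalize δM m = z
  induction z with
  | zero => simp
  | add x y hx hy => simp only [map_add, hx, hy]
  | tmul m a =>
    simp only [LinearMap.rTensor_tmul, LinearMap.comp_apply, hf (T m)]
    generalize δN (T m) = y
    induction y with
    | zero => simp
    | add x y hx hy => simp only [map_add, add_tmul, hx, hy]
    | tmul n b => simp

lemma adCo_sub {δM : M →ₗ[ℂ] M ⊗[ℂ] A} {δN : N →ₗ[ℂ] N ⊗[ℂ] A} (S T : M →ₗ[ℂ] N) :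
    adCo δM δN (S - T) = adCo δM δN S - adCo δM δN T := by
  simp only [adCo, LinearMap.comp_sub, LinearMap.rTensor_sub, LinearMap.sub_comp]

lemma adCo_neg {δM : M →ₗ[ℂ] M ⊗[ℂ] A} {δN : N →ₗ[ℂ] N ⊗[ℂ] A} (T : M →ₗ[ℂ] N) :
    adCo δM δN (-T) = -adCo δM δN T := by
  have := adCo_sub (δM := δM) (δN := δN) 0 T
  have h0 : adCo δM δN (0 : M →ₗ[ℂ] N) = 0 := by simp [adCo]
  rwa [zero_sub, h0, zero_sub] at this

/-- The identity `m₍₀₎ ⊗ m₍₁₎ S(m₍₂₎) = m ⊗ 1`, which says that the identity map is coinvariant for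
the adjoint coaction. -/
lemma IsRightComodule.mulAntipode_coaction {δM : M →ₗ[ℂ] M ⊗[ℂ] A} (hM : IsRightComodule A δM)
    (m : M) : mulAntipode M (δM.rTensor A (δM m)) = m ⊗ₜ 1 := by
  have key : ∀ z : M ⊗[ℂ] A, (LinearMap.mul' ℂ A ∘ₗ (antipode ℂ).lTensor A).lTensor M
      ((comul (R := ℂ) (A := A)).lTensor M z) =
      TensorProduct.rid ℂ M ((counit (R := ℂ) (A := A)).lTensor M z) ⊗ₜ 1 := by
    intro z
    induction z with
    | zero => simp
    | add x y hx hy => simp only [map_add, add_tmul, hx, hy]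
    | tmul m a => simp [Algebra.algebraMap_eq_smul_one, smul_tmul']
  rw [mulAntipode, LinearMap.comp_apply, LinearEquiv.coe_coe, hM.coassoc, key, hM.counit_apply]
  simp

lemma Intertwines.adCo_apply {δM : M →ₗ[ℂ] M ⊗[ℂ] A} {δN : N →ₗ[ℂ] N ⊗[ℂ] A}
    {T : M →ₗ[ℂ] N} (hT : Intertwines δM δN T) (hM : IsRightComodule A δM) (m : M) :
    adCo δM δN T m = T m ⊗ₜ 1 := by
  have h := adCo_comp (δM := δM) hT LinearMap.id m
  rw [LinearMap.comp_id] at h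
  rw [h, adCo, LinearMap.comp_id, LinearMap.comp_apply, LinearMap.comp_apply,
    hM.mulAntipode_coaction, LinearMap.rTensor_tmul]

/-- Multiply the adjoint coaction of `T` at `m₍₀₎` on the right by the remaining leg `m₍₁₎`.
Coassociativity and `S(m₍₁₎) m₍₂₎ = ε` collapse the result to `δN (T m)`, while the hypothesis
evaluates it as `T(m₍₀₎) ⊗ m₍₁₎`. -/
lemma intertwines_of_adCo {δM : M →ₗ[ℂ] M ⊗[ℂ] A} {δN : N →ₗ[ℂ] N ⊗[ℂ] A}
    {T : M →ₗ[ℂ] N} (hM : IsRightComodule A δM) (h : ∀ m, adCo δM δN T m = T m ⊗ₜ 1) :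
    Intertwines δM δN T := by
  -- `(n ⊗ a) ⊗ b ↦ n ⊗ a b`
  let Y : (N ⊗[ℂ] A) ⊗[ℂ] A →ₗ[ℂ] N ⊗[ℂ] A :=
    (LinearMap.mul' ℂ A).lTensor N ∘ₗ (TensorProduct.assoc ℂ N A A).toLinearMap
  intro m
  have h1 : ∀ z : M ⊗[ℂ] A, Y ((adCo δM δN T).rTensor A z) = T.rTensor A z := by
    intro z
    induction z with
    | zero => simp
    | add x y hx hy => simp only [map_add, hx, hy]
    | tmul m a => simp [h, Y]
  have h2 : ∀ z : M ⊗[ℂ] A, Y ((mulAntipode N ∘ₗ (δN ∘ₗ T).rTensor A).rTensor A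
      ((TensorProduct.assoc ℂ M A A).symm ((comul (R := ℂ) (A := A)).lTensor M z))) =
      δN (T (TensorProduct.rid ℂ M ((counit (R := ℂ) (A := A)).lTensor M z))) := by
    intro z
    induction z with
    | zero => simp
    | add x y hx hy => simp only [map_add, hx, hy]
    | tmul m a =>
      have key : ∀ t : A ⊗[ℂ] A, Y ((mulAntipode N ∘ₗ (δN ∘ₗ T).rTensor A).rTensor A
          ((TensorProduct.assoc ℂ M A A).symm (m ⊗ₜ t))) =
          (LinearMap.mulRight ℂ (LinearMap.mul' ℂ A ((antipode ℂ).rTensor A t))).lTensor N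
            (δN (T m)) := by
        intro t
        induction t with
        | zero => simp
        | add x y hx hy =>
          simp only [map_add, tmul_add, hx, hy]
          generalize δN (T m) = y
          induction y with
          | zero => simp
          | add x y hx hy => simp only [map_add, ← hx, ← hy]; abel
          | tmul n b => simp [mul_add, tmul_add]
        | tmul x y =>
          simp only [assoc_symm_tmul, LinearMap.rTensor_tmul, LinearMap.comp_apply]
          generalize δN (T m) = y
          induction y with
          | zero => simp
          | add x y hx hy => simp only [map_add, add_tmul, hx, hy]
          | tmul n b => simp [Y, mul_assoc]
      simp only [LinearMap.lTensor_tmul, key, mul_antipode_rTensor_comul_apply, rid_tmul, map_smul]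
      generalize δN (T m) = y
      induction y with
      | zero => simp
      | add x y hx hy => simp only [map_add, hx, hy, smul_add]
      | tmul n b => simp [Algebra.algebraMap_eq_smul_one]
  have h3 := h2 (δM m)
  rw [← hM.coassoc, LinearEquiv.symm_apply_apply, ← LinearMap.comp_apply (LinearMap.rTensor A _),
    ← LinearMap.rTensor_comp, hM.counit_apply, rid_tmul, one_smul] at h3
  rw [← h3, ← h1]
  rfl

/-- The factor in `A` is `T(m₍₀₎)₍₁₎ p₍₁₎ S(m₍₁₎ p₍₂₎) = T(m₍₀₎)₍₁₎ p₍₁₎ S(p₍₂₎) S(m₍₁₎)`. The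
antipode reverses products, so the two legs of `p` become adjacent and cancel without any
commutativity in `A`. -/
lemma adCo_rTensor_tmul {δM : M →ₗ[ℂ] M ⊗[ℂ] A} {δN : N →ₗ[ℂ] N ⊗[ℂ] A}
    {δP : P →ₗ[ℂ] P ⊗[ℂ] A} (hP : IsRightComodule A δP) (T : M →ₗ[ℂ] N) (m : M) (p : P) :
    adCo (diagCo δM δP) (diagCo δN δP) (T.rTensor P) (m ⊗ₜ p) =
      ((TensorProduct.mk ℂ N P).flip p).rTensor A (adCo δM δN T m) := by
  simp only [adCo, LinearMap.comp_apply]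
  have hd : diagCo δM δP (m ⊗ₜ p) = (LinearMap.mul' ℂ A).lTensor _
      (tensorTensorTensorComm ℂ M A P A (δM m ⊗ₜ δP p)) := rfl
  rw [hd]
  generalize δM m = z
  induction z with
  | zero => simp
  | add x y hx hy => simp only [map_add, add_tmul, hx, hy]
  | tmul m c =>
    have hstep : ∀ t : P ⊗[ℂ] A, mulAntipode (N ⊗[ℂ] P)
        ((diagCo δN δP ∘ₗ T.rTensor P).rTensor A ((LinearMap.mul' ℂ A).lTensor _
          (tensorTensorTensorComm ℂ M A P A ((m ⊗ₜ c) ⊗ₜ t)))) =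
        mulAntipode (N ⊗[ℂ] P) (map ((LinearMap.mul' ℂ A).lTensor _ ∘ₗ
          (tensorTensorTensorComm ℂ N A P A).toLinearMap ∘ₗ
            TensorProduct.mk ℂ (N ⊗[ℂ] A) (P ⊗[ℂ] A) (δN (T m)))
          (LinearMap.mulLeft ℂ c) (δP.rTensor A t)) := by
      intro t
      induction t with
      | zero => simp
      | add x y hx hy => simp only [map_add, tmul_add, hx, hy]
      | tmul p a => simp [diagCo]
    rw [hstep]
    simp only [LinearMap.rTensor_tmul, LinearMap.comp_apply]
    generalize δN (T m) = y
    induction y with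
    | zero => simp
    | add x y hx hy =>
      simp only [map_add, add_tmul, ← hx, ← hy, LinearMap.comp_add, map_add_left,
        LinearMap.add_apply]
    | tmul n b =>
      let K : P ⊗[ℂ] (A ⊗[ℂ] A) →ₗ[ℂ] (N ⊗[ℂ] P) ⊗[ℂ] A :=
        map (TensorProduct.mk ℂ N P n) (LinearMap.mulRight ℂ (antipode ℂ c) ∘ₗ
          LinearMap.mulLeft ℂ b ∘ₗ LinearMap.mul' ℂ A ∘ₗ (antipode ℂ).lTensor A)
      have h1 : ∀ s : (P ⊗[ℂ] A) ⊗[ℂ] A, mulAntipode (N ⊗[ℂ] P)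
          (map ((LinearMap.mul' ℂ A).lTensor _ ∘ₗ
            (tensorTensorTensorComm ℂ N A P A).toLinearMap ∘ₗ
              TensorProduct.mk ℂ (N ⊗[ℂ] A) (P ⊗[ℂ] A) (n ⊗ₜ b)) (LinearMap.mulLeft ℂ c) s) =
          K (TensorProduct.assoc ℂ P A A s) := by
        intro s
        induction s with
        | zero => simp
        | add x y hx hy => simp only [map_add, hx, hy]
        | tmul t y =>
          induction t with
          | zero => simp
          | add x y hx hy => simp only [map_add, add_tmul, hx, hy]
          | tmul p x => simp [K, antipode_mul_antidistrib, mul_assoc]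
      have h2 : ∀ t : P ⊗[ℂ] A, K ((comul (R := ℂ) (A := A)).lTensor P t) =
          (n ⊗ₜ TensorProduct.rid ℂ P ((counit (R := ℂ) (A := A)).lTensor P t)) ⊗ₜ
            (b * antipode ℂ c) := by
        intro t
        induction t with
        | zero => simp
        | add x y hx hy => simp only [map_add, tmul_add, add_tmul, hx, hy]
        | tmul p a =>
          simp [K, Algebra.algebraMap_eq_smul_one, tmul_smul, smul_tmul']
      rw [h1, hP.coassoc, h2, hP.counit_apply]
      simp

/-- The slice map `id ⊗ φ : N ⊗ A → N`. -/
def slice (N : Type*) [AddCommGroup N] [Module ℂ N] (φ : A →ₗ[ℂ] ℂ) : N ⊗[ℂ] A →ₗ[ℂ] N :=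
  (TensorProduct.rid ℂ N).toLinearMap ∘ₗ φ.lTensor N

@[simp] lemma slice_tmul (φ : A →ₗ[ℂ] ℂ) (n : N) (a : A) : slice N φ (n ⊗ₜ a) = φ a • n := by
  simp [slice]

lemma slice_rTensor (φ : A →ₗ[ℂ] ℂ) (f : N →ₗ[ℂ] N') (x : N ⊗[ℂ] A) :
    slice N' φ (f.rTensor A x) = f (slice N φ x) := by
  induction x with
  | zero => simp
  | add x y hx hy => simp only [map_add, hx, hy]
  | tmul n a => simp

/-- The slices by the coordinate functionals of a basis of `A` already determine an element of `N ⊗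
A`. This reduces the coinvariance of `T` to statements about ordinary maps `M → N`. -/
lemma eq_of_slice_eq {x y : N ⊗[ℂ] A} (h : ∀ φ : A →ₗ[ℂ] ℂ, slice N φ x = slice N φ y) :
    x = y := by
  classical
  let b := Module.Basis.ofVectorSpace ℂ A
  apply (TensorProduct.equivFinsuppOfBasisRight (M := N) b).injective
  ext i
  rw [TensorProduct.equivFinsuppOfBasisRight_apply, TensorProduct.equivFinsuppOfBasisRight_apply]
  exact h (b.coord i)

/-- If `T : M → N` is the unique solution of a system of equations with equivariant coefficients,
then `T` is equivariant. -/
lemma intertwines_of_unique {δM : M →ₗ[ℂ] M ⊗[ℂ] A} {δN : N →ₗ[ℂ] N ⊗[ℂ] A}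
    (hM : IsRightComodule A δM) {s : N →ₗ[ℂ] N} (hs : Intertwines δN δN s)
    {z : M →ₗ[ℂ] N} (hz : Intertwines δM δN z)
    {c : N ⊗[ℂ] M →ₗ[ℂ] M} (hc : Intertwines (diagCo δN δM) δM c)
    {Y : Submodule ℂ (M ⊗[ℂ] M)} (hY : IsSubcomodule A (diagCo δM δM) Y)
    (huniq : ∀ L : M →ₗ[ℂ] N, (∀ m, s (L m) = L m) → (∀ y ∈ Y, c (L.rTensor M y) = 0) → L = 0)
    {T : M →ₗ[ℂ] N} (h₁ : ∀ m, s (T m) - T m = -z m) (h₂ : ∀ y ∈ Y, c (T.rTensor M y) = 0) :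
    Intertwines δM δN T := by
  refine intertwines_of_adCo hM fun m => eq_of_slice_eq fun φ => ?_
  -- `T'` is a slice of the adjoint coaction of `T`. It solves the system of `T` with `z` replaced
  -- by `φ 1 • z`.
  let T' : M →ₗ[ℂ] N := slice _ φ ∘ₗ adCo δM δN T
  have hT'₁ : ∀ m, s (T' m) - T' m = -(φ 1 • z m) := by
    intro m
    have e : s ∘ₗ T - T = -z := LinearMap.ext h₁
    have h := LinearMap.congr_fun (congrArg (adCo δM δN) e) m
    rw [adCo_sub, adCo_neg, LinearMap.sub_apply, adCo_comp hs, LinearMap.neg_apply,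
      hz.adCo_apply hM] at h
    have h' := congrArg (slice _ φ) h
    rw [map_sub, map_neg, slice_rTensor, slice_tmul] at h'
    exact h'
  -- The left side is a slice of the adjoint coaction of `c (T ⊗ id)` at `y`. That map vanishes on
  -- `Y`, and since `Y` is a subcomodule its adjoint coaction vanishes there too.
  have hT'₂ : ∀ y ∈ Y, c (T'.rTensor M y) = 0 := by
    have key : ∀ y : M ⊗[ℂ] M, c (T'.rTensor M y) =
        slice _ φ (adCo (diagCo δM δM) δM (c ∘ₗ T.rTensor M) y) := by
      intro y
      rw [adCo_comp hc, slice_rTensor]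
      congr 1
      induction y with
      | zero => simp
      | add x y hx hy => simp only [map_add, hx, hy]
      | tmul v w =>
        rw [adCo_rTensor_tmul hM, slice_rTensor]
        rfl
    intro y hy
    rw [key]
    obtain ⟨t, ht⟩ := hY y hy
    have h0 : (c ∘ₗ T.rTensor M) ∘ₗ Y.subtype = 0 := LinearMap.ext fun y => h₂ y y.2
    rw [adCo, LinearMap.comp_apply, LinearMap.comp_apply, ← ht,
      ← LinearMap.comp_apply (LinearMap.rTensor A _), ← LinearMap.rTensor_comp,
      LinearMap.comp_assoc, h0]
    simp
  -- The difference solves the homogeneous system.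
  have h0 : T' - φ 1 • T = 0 := by
    refine huniq _ (fun m => ?_) fun y hy => ?_
    · have e1 := hT'₁ m
      have e2 := h₁ m
      rw [sub_eq_iff_eq_add] at e1 e2
      simp only [LinearMap.sub_apply, LinearMap.smul_apply, map_sub, map_smul, e1, e2, smul_add,
        smul_neg]
      abel
    · rw [LinearMap.rTensor_sub, LinearMap.rTensor_smul, LinearMap.sub_apply,
        LinearMap.smul_apply, map_sub, map_smul, hT'₂ y hy, h₂ y hy]
      simp
  rw [slice_tmul]
  exact LinearMap.congr_fun (sub_eq_zero.1 h0) m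

end AdjointCoaction

/-! ### Bicovariant bimodules: right freeness, coactions and the braiding -/

variable {A : Type u} [Ring A] [HopfAlgebra ℂ A]
  {E : Type v} [AddCommGroup E] [Module ℂ E] [Module A E] [Module Aᵐᵒᵖ E]
  [SMulCommClass A Aᵐᵒᵖ E] [IsScalarTower ℂ A E] [IsScalarTower ℂ Aᵐᵒᵖ E]

variable (A E) in
/-- The bilinear map `(e, f) ↦ e ⊗_A f`. -/
def tmulHom : E →ₗ[ℂ] E →ₗ[ℂ] TensorA A E := (TensorProduct.mk ℂ E E).compr₂ (mkA A E)

@[simp] lemma tmulHom_apply (e f : E) : tmulHom A E e f = tmulA A e f := rfl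

variable (A E) in
/-- The right action of `A` on `E ⊗_A E` as a linear map in both arguments. -/
def rAHom : A →ₗ[ℂ] TensorA A E →ₗ[ℂ] TensorA A E where
  toFun a := rA E a
  map_add' a b := tensorA_ext fun e f => by
    simp only [rA_tmulA, LinearMap.add_apply, op_add, add_smul]
    simp [tmulA, tmul_add]
  map_smul' c a := tensorA_ext fun e f => by
    simp only [rA_tmulA, LinearMap.smul_apply, op_smul, smul_assoc]
    simp [tmulA]

@[simp] lemma rAHom_apply (a : A) (x : TensorA A E) : rAHom A E a x = rA E a x := rfl

lemma rA_mul (a b : A) (x : TensorA A E) : rA E (a * b) x = rA E b (rA E a x) := by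
  have : rA E (a * b) = rA E b ∘ₗ rA E a := tensorA_ext fun e f => by
    simp [mul_smul]
  rw [this, LinearMap.comp_apply]

namespace BicovariantBimodule

variable (B : BicovariantBimodule A E)

/-- The right adjoint action `v ◁ a = projL (v a)` of `A` on the left-invariant elements. -/
def adj : B.invL →ₗ[ℂ] A →ₗ[ℂ] B.invL := ((rm A E).flip ∘ₗ B.invL.subtype).compr₂ B.projL

lemma adj_apply (v : B.invL) (a : A) : B.adj v a = B.projL (op a • (v : E)) := rfl

@[simp] lemma adj_one (v : B.invL) : B.adj v 1 = v := by
  rw [adj_apply, op_one, one_smul, projL_of_mem]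

/-- By the formula `projL₀ (e a) = S(a₁) (projL₀ e) a₂`, the left side depends on `e` only through
`projL₀ e`. This is what makes `◁` an action in `adj_adj`. -/
lemma projL_rsmul_projL₀ (a : A) (e : E) : B.projL (op a • B.projL₀ e) = B.projL (op a • e) := by
  apply Subtype.ext
  rw [coe_projL, coe_projL, projL₀_rsmul, projL₀_rsmul, B.projL₀_of_mem (B.projL₀_mem e)]

lemma adj_adj (v : B.invL) (a b : A) : B.adj (B.adj v a) b = B.adj v (a * b) := by
  rw [adj_apply, adj_apply, adj_apply, coe_projL, projL_rsmul_projL₀, op_mul, mul_smul]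

/-- Right multiplication `₀E ⊗ A → E`, `v ⊗ a ↦ v a`. -/
def mulR : B.invL ⊗[ℂ] A →ₗ[ℂ] E := lift ((rm A E).flip ∘ₗ B.invL.subtype)

@[simp] lemma mulR_tmul (v : B.invL) (a : A) : B.mulR (v ⊗ₜ a) = op a • (v : E) := rfl

/-- In Sweedler notation this is the commutation rule `v a = a₁ (v ◁ a₂)`, which moves coefficients
from the right to the left of a left-invariant element. -/
lemma splitL_rsmul_of_mem (v : B.invL) (a : A) :
    B.splitL (op a • (v : E)) = (B.adj v).lTensor A (comul a) := by
  rw [splitL, LinearMap.comp_apply, B.coL_rsmul, B.mem_invL.1 v.2]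
  generalize (comul a : A ⊗[ℂ] A) = t
  induction t with
  | zero => simp
  | add x y hx hy => simp only [map_add, LinearMap.add_apply, hx, hy]
  | tmul x y => simp [adj_apply]

lemma lm_splitL (e : E) : lift (lm A E) (B.invL.subtype.lTensor A (B.splitL e)) = e := by
  conv_rhs => rw [← B.lm_projL₀ e]
  rw [splitL, LinearMap.comp_apply, ← LinearMap.comp_apply (B.invL.subtype.lTensor A),
    ← LinearMap.lTensor_comp]
  rfl

/-- For a cosemisimple Hopf algebra, a bicovariant bimodule is free as a right module over its
left-invariant elements. -/
lemma mulR_bijective (hA : IsCosemisimple A) : Function.Bijective B.mulR := by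
  obtain ⟨R, hR₁, hR₂⟩ := hA.exists_antipode_inv
  -- `a ⊗ v ↦ v ◁ S⁻¹(a₂) ⊗ a₁`
  let N : A ⊗[ℂ] B.invL →ₗ[ℂ] B.invL ⊗[ℂ] A :=
    (lift B.adj).rTensor A ∘ₗ (TensorProduct.assoc ℂ B.invL A A).symm.toLinearMap ∘ₗ
      (R.rTensor A ∘ₗ (TensorProduct.comm ℂ A A).toLinearMap ∘ₗ comul).lTensor B.invL ∘ₗ
        (TensorProduct.comm ℂ A B.invL).toLinearMap
  have hN : ∀ a v, N (a ⊗ₜ v) =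
      TensorProduct.comm ℂ A B.invL ((B.adj v ∘ₗ R).lTensor A (comul a)) := by
    intro a v
    simp only [N, LinearMap.comp_apply, LinearEquiv.coe_coe, comm_tmul, LinearMap.lTensor_tmul]
    generalize (comul a : A ⊗[ℂ] A) = t
    induction t with
    | zero => simp
    | add x y hx hy => simp only [map_add, tmul_add, hx, hy]
    | tmul x y => simp
  constructor
  -- The element `v a = a₁ (v ◁ a₂)` is sent to `v ◁ (a₃ S⁻¹(a₂)) ⊗ a₁ = v ⊗ a`.
  · have hleft : (N ∘ₗ B.splitL) ∘ₗ B.mulR = LinearMap.id := by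
      refine TensorProduct.ext' fun v a => ?_
      simp only [LinearMap.comp_apply, mulR_tmul, splitL_rsmul_of_mem, LinearMap.id_apply]
      let G : A ⊗[ℂ] (A ⊗[ℂ] A) →ₗ[ℂ] B.invL ⊗[ℂ] A :=
        (TensorProduct.comm ℂ A B.invL).toLinearMap ∘ₗ (B.adj v ∘ₗ LinearMap.mul' ℂ A ∘ₗ
          R.lTensor A ∘ₗ (TensorProduct.comm ℂ A A).toLinearMap).lTensor A
      have h1 : ∀ t : A ⊗[ℂ] A, N ((B.adj v).lTensor A t) =
          G (TensorProduct.assoc ℂ A A A ((comul (R := ℂ) (A := A)).rTensor A t)) := by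
        intro t
        induction t with
        | zero => simp
        | add x y hx hy => simp only [map_add, hx, hy]
        | tmul x y =>
          simp only [LinearMap.lTensor_tmul, LinearMap.rTensor_tmul, hN]
          generalize (comul x : A ⊗[ℂ] A) = t
          induction t with
          | zero => simp
          | add x y hx hy => simp only [map_add, add_tmul, hx, hy]
          | tmul x y => simp [G, adj_adj]
      have h2 : ∀ t : A ⊗[ℂ] A, G ((comul (R := ℂ) (A := A)).lTensor A t) =
          v ⊗ₜ TensorProduct.rid ℂ A ((counit (R := ℂ) (A := A)).lTensor A t) := by
        intro t
        induction t with
        | zero => simp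
        | add x y hx hy => simp only [map_add, tmul_add, hx, hy]
        | tmul x y =>
          simp [G, hR₁, Algebra.algebraMap_eq_smul_one, tmul_smul, smul_tmul']
      rw [h1, coassoc_apply, h2]
      simp
    exact Function.LeftInverse.injective (g := N ∘ₗ B.splitL) (LinearMap.congr_fun hleft)
  -- By the commutation rule `(v ◁ S⁻¹(a₂)) a₁ = a₁ (v ◁ (S⁻¹(a₃) a₂)) = a v`. As `E` is spanned by
  -- such products, `mulR` is onto.
  · have hright : ∀ (a : A) (v : B.invL), B.mulR (N (a ⊗ₜ v)) = a • (v : E) := by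
      intro a v
      let H : A ⊗[ℂ] (A ⊗[ℂ] A) →ₗ[ℂ] E := lift (lm A E) ∘ₗ
        (B.invL.subtype ∘ₗ B.adj v ∘ₗ LinearMap.mul' ℂ A ∘ₗ
          R.rTensor A ∘ₗ (TensorProduct.comm ℂ A A).toLinearMap).lTensor A
      have h1 : ∀ t : A ⊗[ℂ] A,
          B.mulR (TensorProduct.comm ℂ A B.invL ((B.adj v ∘ₗ R).lTensor A t)) =
          H (TensorProduct.assoc ℂ A A A ((comul (R := ℂ) (A := A)).rTensor A t)) := by
        intro t
        induction t with
        | zero => simp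
        | add x y hx hy => simp only [map_add, hx, hy]
        | tmul x y =>
          simp only [LinearMap.lTensor_tmul, LinearMap.rTensor_tmul, comm_tmul, mulR_tmul,
            LinearMap.comp_apply]
          rw [← B.lm_splitL (op x • _), splitL_rsmul_of_mem]
          generalize (comul x : A ⊗[ℂ] A) = t
          induction t with
          | zero => simp
          | add x y hx hy => simp only [map_add, add_tmul, hx, hy]
          | tmul x y => simp [H, adj_adj]
      have h2 : ∀ t : A ⊗[ℂ] A, H ((comul (R := ℂ) (A := A)).lTensor A t) =
          TensorProduct.rid ℂ A ((counit (R := ℂ) (A := A)).lTensor A t) • (v : E) := by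
        intro t
        induction t with
        | zero => simp
        | add x y hx hy => simp only [map_add, add_smul, hx, hy]
        | tmul x y =>
          simp [H, hR₂, Algebra.algebraMap_eq_smul_one]
      rw [hN, h1, coassoc_apply, h2]
      simp
    intro e
    rw [← LinearMap.mem_range, ← B.lm_splitL e]
    generalize B.splitL e = z
    induction z with
    | zero => simp
    | add x y hx hy => simp only [map_add]; exact add_mem hx hy
    | tmul a v => exact ⟨N (a ⊗ₜ v), hright a v⟩

lemma projR_mem (e : E) : B.projR e ∈ B.invR := by
  -- `f` vanishes since `f(e₍₀₎) Δ(e₍₁₎) = 0` for all `e`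
  let f : E →ₗ[ℂ] E ⊗[ℂ] A := B.coR ∘ₗ B.projR - (TensorProduct.mk ℂ E A).flip 1 ∘ₗ B.projR
  let act : A →ₗ[ℂ] E ⊗[ℂ] A →ₗ[ℂ] E ⊗[ℂ] A := map₂ (rm A E) (LinearMap.mul ℂ A).flip ∘ₗ comul
  have act_mul' : ∀ (x y : A ⊗[ℂ] A) (z : E ⊗[ℂ] A),
      map₂ (rm A E) (LinearMap.mul ℂ A).flip (x * y) z =
      map₂ (rm A E) (LinearMap.mul ℂ A).flip y (map₂ (rm A E) (LinearMap.mul ℂ A).flip x z) := by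
    intro x y z
    induction x with
    | zero => simp
    | add x₁ x₂ h₁ h₂ => simp only [add_mul, map_add, LinearMap.add_apply, h₁, h₂]
    | tmul a a' =>
      induction y with
      | zero => simp
      | add x₁ x₂ h₁ h₂ => simp only [mul_add, map_add, LinearMap.add_apply, h₁, h₂]
      | tmul b b' =>
        induction z with
        | zero => simp
        | add x₁ x₂ h₁ h₂ => simp only [map_add, h₁, h₂]
        | tmul c e => simp [mul_assoc, mul_smul]
  have act_mul : ∀ a b z, act (a * b) z = act b (act a z) := by
    intro a b z
    simp only [act, LinearMap.comp_apply, Bialgebra.comul_mul]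
    exact act_mul' _ _ _
  have h0 : ∀ e, lift act.flip (f.rTensor A (B.coR e)) = 0 := by
    intro e
    have h1 : ∀ z : E ⊗[ℂ] A, lift act.flip ((B.coR ∘ₗ B.projR).rTensor A z) =
        B.coR (lift (rm A E).flip (B.projR.rTensor A z)) := by
      intro z
      induction z with
      | zero => simp
      | add x₁ x₂ h₁ h₂ => simp only [map_add, h₁, h₂]
      | tmul c e => simp [act, B.coR_rsmul]
    have h2 : ∀ z : E ⊗[ℂ] A,
        lift act.flip (((TensorProduct.mk ℂ E A).flip 1 ∘ₗ B.projR).rTensor A z) =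
        (lift (rm A E).flip ∘ₗ B.projR.rTensor A).rTensor A
          ((TensorProduct.assoc ℂ E A A).symm ((comul (R := ℂ) (A := A)).lTensor E z)) := by
      intro z
      induction z with
      | zero => simp
      | add x₁ x₂ h₁ h₂ => simp only [map_add, h₁, h₂]
      | tmul e c =>
        simp only [LinearMap.lTensor_tmul, LinearMap.rTensor_tmul, lift.tmul, act,
          LinearMap.comp_apply, TensorProduct.mk_apply, LinearMap.flip_apply]
        generalize (comul c : A ⊗[ℂ] A) = x
        induction x with
        | zero => simp
        | add x₁ x₂ h₁ h₂ => simp only [map_add, LinearMap.add_apply, tmul_add, h₁, h₂]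
        | tmul f f' => simp
    have h3 : (lift (rm A E).flip ∘ₗ B.projR.rTensor A) ∘ₗ B.coR = LinearMap.id :=
      LinearMap.ext B.rm_projR
    simp only [f, LinearMap.rTensor_sub, LinearMap.sub_apply, map_sub, h1, h2, B.rm_projR,
      ← B.coR_coassoc, LinearEquiv.symm_apply_apply]
    rw [← LinearMap.comp_apply (LinearMap.rTensor A _), ← LinearMap.rTensor_comp, h3]
    simp
  -- Acting on `f(e₍₀₎) Δ(e₍₁₎)` by `Δ(S(e₍₂₎))` recovers `f(e)`, so the vanishing in `h0` forces `f
  -- = 0`.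
  have h4 : ∀ z : E ⊗[ℂ] A, lift (act ∘ₗ antipode ℂ).flip ((lift act.flip ∘ₗ f.rTensor A).rTensor A
      ((TensorProduct.assoc ℂ E A A).symm ((comul (R := ℂ) (A := A)).lTensor E z))) =
      f (TensorProduct.rid ℂ E ((counit (R := ℂ) (A := A)).lTensor E z)) := by
    intro z
    induction z with
    | zero => simp
    | add x₁ x₂ h₁ h₂ => simp only [map_add, h₁, h₂]
    | tmul e c =>
      have : ∀ y : A ⊗[ℂ] A, lift (act ∘ₗ antipode ℂ).flip
          ((lift act.flip ∘ₗ f.rTensor A).rTensor A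
            ((TensorProduct.assoc ℂ E A A).symm (e ⊗ₜ y))) =
          act (LinearMap.mul' ℂ A ((antipode ℂ).lTensor A y)) (f e) := by
        intro y
        induction y with
        | zero => simp
        | add x₁ x₂ h₁ h₂ => simp only [map_add, tmul_add, LinearMap.add_apply, h₁, h₂]
        | tmul c c' => simp [act_mul]
      have act_one : act 1 (f e) = f e := by
        simp only [act, LinearMap.comp_apply, Bialgebra.comul_one, Algebra.TensorProduct.one_def,
          map₂_apply_tmul]
        have e1 : (LinearMap.mul ℂ A).flip 1 = LinearMap.id := by ext; simp
        have e2 : rm A E 1 = LinearMap.id := by ext; simp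
        rw [e1, e2]; simp
      simp only [LinearMap.lTensor_tmul, this, mul_antipode_lTensor_comul_apply,
        Algebra.algebraMap_eq_smul_one, map_smul, LinearMap.smul_apply, act_one,
        TensorProduct.rid_tmul]
  have h5 := h4 (B.coR e)
  have h6 : (lift act.flip ∘ₗ f.rTensor A) ∘ₗ B.coR = 0 := LinearMap.ext h0
  rw [← B.coR_coassoc, LinearEquiv.symm_apply_apply,
    ← LinearMap.comp_apply (LinearMap.rTensor A _), ← LinearMap.rTensor_comp, h6,
    B.coR_counit] at h5
  simp only [LinearMap.rTensor_zero, LinearMap.zero_apply, map_zero, TensorProduct.rid_tmul,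
    one_smul, f, LinearMap.sub_apply, LinearMap.comp_apply, TensorProduct.mk_apply,
    LinearMap.flip_apply] at h5
  exact (sub_eq_zero.1 h5.symm)

/-- The right coaction on the left-invariant elements. -/
def coV : B.invL →ₗ[ℂ] B.invL ⊗[ℂ] A := B.projL.rTensor A ∘ₗ B.coR ∘ₗ B.invL.subtype

lemma coR_coe (v : B.invL) : B.coR (v : E) = B.invL.subtype.rTensor A (B.coV v) := B.coR_of_mem v

lemma isRightComodule_coV : IsRightComodule A B.coV :=
  IsRightComodule.induced ⟨B.coR_coassoc, B.coR_counit⟩ (LinearMap.ext B.projL_of_mem)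
    fun v => ⟨_, (B.coR_of_mem v).symm⟩

/-- The braiding intertwines the right coactions. -/
lemma coRT_braiding (x : TensorA A E) :
    B.coRT (B.braiding x) = B.braiding.rTensor A (B.coRT x) := by
  -- On `a v ⊗ w b` with `w` right-invariant the braiding is the flip `a w ⊗ v b`. As `w` carries no
  -- coaction leg, both sides equal `(a₁ w ⊗ v₍₀₎ b₁) ⊗ a₂ v₍₁₎ b₂`.
  have key : ∀ (a b : A) (v : B.invL) (w : E), w ∈ B.invR →
      B.coRT (B.braiding (tmulA A (a • (v : E)) (op b • w))) =
        B.braiding.rTensor A (B.coRT (tmulA A (a • (v : E)) (op b • w))) := by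
    intro a b v w hw
    have hσ : ∀ (a b : A) (v : B.invL), B.braiding (tmulA A (a • (v : E)) (op b • w)) =
        tmulA A (a • w) (op b • (v : E)) := by
      intro a b v
      rw [← lA_tmulA, ← rA_tmulA, braiding_lA, braiding_rA, B.braiding_flip v.2 hw, rA_tmulA,
        lA_tmulA]
    rw [hσ]
    simp only [coRT, liftA_tmulA, LinearMap.comp_apply, map_tmul, B.coR_lsmul, B.coR_rsmul,
      B.mem_invR.1 hw, coR_coe]
    generalize B.coV v = z
    generalize (comul a : A ⊗[ℂ] A) = x
    generalize (comul b : A ⊗[ℂ] A) = y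
    induction z with
    | zero => simp
    | add x₁ x₂ h₁ h₂ => simp only [map_add, tmul_add, add_tmul, h₁, h₂]
    | tmul v c =>
      induction x with
      | zero => simp
      | add x₁ x₂ h₁ h₂ => simp only [map_add, LinearMap.add_apply, add_tmul, h₁, h₂]
      | tmul x x' =>
        induction y with
        | zero => simp
        | add x₁ x₂ h₁ h₂ => simp only [map_add, LinearMap.add_apply, tmul_add, h₁, h₂]
        | tmul y y' => simp [mkA_tmul, hσ, mul_assoc]
  have : B.coRT ∘ₗ B.braiding = B.braiding.rTensor A ∘ₗ B.coRT := by
    refine tensorA_ext fun e f => ?_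
    -- Such elements span: `e` is a sum of terms `a v` with `v` left-invariant, and `f` is a sum of
    -- terms `w b` with `w` right-invariant.
    rw [← B.lm_projL₀ e, ← B.rm_projR f]
    generalize B.coL e = x
    generalize B.coR f = y
    induction x with
    | zero => simp [tmulA]
    | add x₁ x₂ h₁ h₂ =>
      simp only [← tmulHom_apply] at h₁ h₂ ⊢
      simp only [map_add, LinearMap.add_apply, h₁, h₂]
    | tmul a e =>
      induction y with
      | zero => simp [tmulA]
      | add x₁ x₂ h₁ h₂ =>
        simp only [← tmulHom_apply] at h₁ h₂ ⊢
        simp only [map_add, h₁, h₂]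
      | tmul f b => exact key a b (B.projL e) _ (B.projR_mem f)
  exact LinearMap.congr_fun this x

lemma retr_lA (a : A) (x : TensorA A E) : B.retr (lA E a x) = counit (R := ℂ) a • B.retr x := by
  have : B.retr ∘ₗ lA E a = counit (R := ℂ) a • B.retr := by
    refine tensorA_ext fun e f => ?_
    simp only [LinearMap.comp_apply, lA_tmulA, LinearMap.smul_apply, retr, liftA_tmulA,
      LinearMap.lTensor_tmul, LinearEquiv.coe_coe]
    generalize B.splitL f = z
    induction z with
    | zero => simp
    | add x₁ x₂ h₁ h₂ => simp only [map_add, tmul_add, smul_add, h₁, h₂]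
    | tmul c v =>
      have : B.projL (op c • a • e) = counit (R := ℂ) a • B.projL (op c • e) := by
        apply Subtype.ext
        rw [← smul_comm a (op c) e]
        exact B.projL₀_lsmul a _
      simp [this, smul_tmul']
  rw [← LinearMap.comp_apply, this, LinearMap.smul_apply]

/-- Linear maps on `E ⊗_A E` agree if they agree on the elements `a (v ⊗ w)` with `v`, `w`
left-invariant. -/
lemma tensorA_ext_lA_incl {N : Type*} [AddCommGroup N] [Module ℂ N]
    {φ ψ : TensorA A E →ₗ[ℂ] N}
    (h : ∀ a (y : B.invL ⊗[ℂ] B.invL), φ (lA E a (B.incl y)) = ψ (lA E a (B.incl y))) :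
    φ = ψ := by
  have h1 : ∀ (e : E) (w : B.invL), φ (tmulA A e w) = ψ (tmulA A e w) := by
    intro e w
    rw [← B.lm_projL₀ e]
    generalize B.coL e = x
    induction x with
    | zero => simp [tmulA]
    | add x₁ x₂ h₁ h₂ =>
      simp only [← tmulHom_apply] at h₁ h₂ ⊢
      simp only [map_add, LinearMap.add_apply, h₁, h₂]
    | tmul a e => exact h a (B.projL e ⊗ₜ w)
  refine tensorA_ext fun e f => ?_
  rw [← B.lm_projL₀ f]
  generalize B.coL f = x
  induction x with
  | zero => simp [tmulA]
  | add x₁ x₂ h₁ h₂ =>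
    simp only [← tmulHom_apply] at h₁ h₂ ⊢
    simp only [map_add, h₁, h₂]
  | tmul a f =>
    simp only [LinearMap.lTensor_tmul, lift.tmul, lm_apply, ← tmulA_bal]
    exact h1 _ (B.projL f)

/-- The composite `incl ∘ retr` sends `a y`, with `y` in `₀E ⊗ ₀E`, to `ε(a) y`. The braiding is
left linear and preserves `₀E ⊗ ₀E`, so both orders give `ε(a) σ(y)`. This lets a solution of the
torsion equation be projected to `₀E ⊗ ₀E`. -/
lemma incl_retr_braiding_comm (x : TensorA A E) :
    B.incl (B.retr (B.braiding x)) = B.braiding (B.incl (B.retr x)) := by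
  have : B.incl ∘ₗ B.retr ∘ₗ B.braiding = B.braiding ∘ₗ B.incl ∘ₗ B.retr := by
    refine B.tensorA_ext_lA_incl fun a y => ?_
    simp only [LinearMap.comp_apply, braiding_lA, retr_lA, map_smul, retr_incl,
      incl_retr_braiding]
  exact LinearMap.congr_fun this x

/-- The diagonal right coaction on `₀E ⊗ ₀E`. -/
def coVV : B.invL ⊗[ℂ] B.invL →ₗ[ℂ] (B.invL ⊗[ℂ] B.invL) ⊗[ℂ] A :=
  diagCo B.coV B.coV

lemma coRT_incl (y : B.invL ⊗[ℂ] B.invL) : B.coRT (B.incl y) = B.incl.rTensor A (B.coVV y) := by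
  have : B.coRT ∘ₗ B.incl = B.incl.rTensor A ∘ₗ B.coVV := by
    refine TensorProduct.ext' fun v w => ?_
    simp only [LinearMap.comp_apply, incl_tmul, coRT, liftA_tmulA, map_tmul, coR_coe, coVV, diagCo]
    generalize B.coV v = x
    generalize B.coV w = y
    induction x with
    | zero => simp
    | add x₁ x₂ h₁ h₂ => simp only [map_add, add_tmul, h₁, h₂]
    | tmul v a =>
      induction y with
      | zero => simp
      | add x₁ x₂ h₁ h₂ => simp only [map_add, tmul_add, h₁, h₂]
      | tmul w b => simp [mkA_tmul]
  exact LinearMap.congr_fun this y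

lemma coRT_rA (a : A) (x : TensorA A E) :
    B.coRT (rA E a x) = map₂ (rAHom A E) (LinearMap.mul ℂ A).flip (comul a) (B.coRT x) := by
  have : B.coRT ∘ₗ rA E a =
      map₂ (rAHom A E) (LinearMap.mul ℂ A).flip (comul a) ∘ₗ B.coRT := by
    refine tensorA_ext fun e f => ?_
    simp only [LinearMap.comp_apply, rA_tmulA, coRT, liftA_tmulA, map_tmul, B.coR_rsmul]
    generalize B.coR e = x
    generalize B.coR f = y
    generalize (comul a : A ⊗[ℂ] A) = t
    induction x with
    | zero => simp
    | add x₁ x₂ h₁ h₂ => simp only [map_add, add_tmul, h₁, h₂]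
    | tmul e b =>
      induction y with
      | zero => simp
      | add x₁ x₂ h₁ h₂ => simp only [map_add, tmul_add, h₁, h₂]
      | tmul f c =>
        induction t with
        | zero => simp
        | add x₁ x₂ h₁ h₂ => simp only [map_add, LinearMap.add_apply, tmul_add, h₁, h₂]
        | tmul x y => simp [mkA_tmul, mul_assoc]
  exact LinearMap.congr_fun this x

lemma coLT_rA_incl (a : A) (y : B.invL ⊗[ℂ] B.invL) :
    B.coLT (rA E a (B.incl y)) = ((rAHom A E).flip (B.incl y)).lTensor A (comul a) := by
  induction y with
  | zero => simp
  | add x₁ x₂ h₁ h₂ =>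
    simp only [map_add, h₁, h₂, LinearMap.lTensor_add, LinearMap.add_apply]
  | tmul v w =>
    simp only [incl_tmul, rA_tmulA, coLT, liftA_tmulA, LinearMap.comp_apply, map_tmul,
      B.mem_invL.1 v.2, B.coL_rsmul, B.mem_invL.1 w.2]
    generalize (comul a : A ⊗[ℂ] A) = t
    induction t with
    | zero => simp
    | add x₁ x₂ h₁ h₂ => simp only [map_add, LinearMap.add_apply, tmul_add, h₁, h₂]
    | tmul x y => simp [mkA_tmul]

end BicovariantBimodule

/-! ### The torsion equation on left-invariant one-forms -/

namespace BicovariantCalculus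

variable (C : BicovariantCalculus A E)

lemma d_one : C.d 1 = 0 := by
  have h := C.leibniz 1 1
  simpa using h

lemma d_algebraMap_mul (c : ℂ) (a : A) : C.d (algebraMap ℂ A c * a) = c • C.d a := by
  rw [← Algebra.smul_def, map_smul]

/-- The map `x ↦ ∑ da ⊗_A db` for `x = ∑ a ⊗ b`. -/
def dd : A ⊗[ℂ] A →ₗ[ℂ] TensorA A E := mkA A E ∘ₗ map C.d C.d

@[simp] lemma dd_tmul (a b : A) : C.dd (a ⊗ₜ b) = tmulA A (C.d a) (C.d b) := rfl

lemma extD_adb (x : A ⊗[ℂ] A) : C.extD (C.adb x) = C.wedge (C.dd x) := by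
  rw [extD, descend_adb]; rfl

/-- The map `E → E ⊗_A E`, `e ↦ projR(e₍₀₎) ⊗_A d(e₍₁₎)`. -/
def obstr : E →ₗ[ℂ] TensorA A E := mkA A E ∘ₗ map C.toBimodule.projR C.d ∘ₗ C.toBimodule.coR

/-- The general formula for `(σ - 1)(∑ da ⊗ db)` has the further term `d(e₍₋₁₎) ⊗ projL₀(e₍₀₎)` for
`e = ∑ a db`. For left-invariant `e` this contains `d 1 = 0`. What remains depends on `e` alone and
is the inhomogeneous term of the torsion equation. -/
lemma sigma_dd_sub (x : A ⊗[ℂ] A) (hx : C.adb x ∈ C.V) :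
    C.sigma (C.dd x) - C.dd x = C.obstr (C.adb x) := by
  have key : ∀ x, C.sigma (C.dd x) - C.dd x = C.obstr (C.adb x) -
        mkA A E (map C.d C.toBimodule.projL₀ (C.toBimodule.coL (C.adb x))) := by
    intro x
    induction x with
    | zero => simp
    | tmul a b => exact C.sigma_d_d a b
    | add x₁ x₂ h₁ h₂ =>
      simp only [map_add]
      rw [add_sub_add_comm, h₁, h₂]
      abel
  rw [key, C.toBimodule.mem_invL.1 hx, map_tmul, d_one, zero_tmul, map_zero, sub_zero]

/-- The map `₀E → ₀E ⊗ ₀E`, `v ↦ v₍₀₎ ⊗ projL(d(v₍₁₎))`. -/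
def obstr0 : C.V →ₗ[ℂ] C.V ⊗[ℂ] C.V :=
  (C.toBimodule.projL ∘ₗ C.d).lTensor C.V ∘ₗ C.toBimodule.coV

/-- The antipode moves across `⊗_A`: `v₍₀₎ S(v₍₁₎) ⊗_A d(v₍₂₎) = v₍₀₎ ⊗_A S(v₍₁₎) d(v₍₂₎)`, and
`S(a₁) d(a₂)` is `projL₀ (d a)`. So the obstruction lies in `₀E ⊗ ₀E`. -/
lemma incl_obstr0 (v : C.V) : C.incl (C.obstr0 v) = C.obstr v := by
  have key : ∀ z : E ⊗[ℂ] A, mkA A E (map (lift (rm A E ∘ₗ antipode ℂ).flip) C.d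
      ((TensorProduct.assoc ℂ E A A).symm ((comul (R := ℂ) (A := A)).lTensor E z))) =
      mkA A E ((C.toBimodule.projL₀ ∘ₗ C.d).lTensor E z) := by
    intro z
    induction z with
    | zero => simp
    | add x y hx hy => simp only [map_add, hx, hy]
    | tmul e c =>
      simp only [LinearMap.lTensor_tmul, LinearMap.comp_apply, BicovariantBimodule.projL₀, coL_d,
        mkA_tmul]
      generalize (comul c : A ⊗[ℂ] A) = t
      induction t with
      | zero => simp [tmulA]
      | add x y hx hy =>
        simp only [← tmulHom_apply] at hx hy ⊢
        simp only [map_add, tmul_add, hx, hy]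
      | tmul x y => simp [mkA_tmul, tmulA_bal]
  have h : C.obstr v = mkA A E ((C.toBimodule.projL₀ ∘ₗ C.d).lTensor E
      (C.toBimodule.coR (v : E))) := by
    rw [← key, ← C.toBimodule.coR_coassoc, LinearEquiv.symm_apply_apply,
      ← LinearMap.comp_apply (map _ _), LinearMap.map_comp_rTensor]
    rfl
  rw [h, C.toBimodule.coR_coe, obstr0, LinearMap.comp_apply]
  generalize C.toBimodule.coV v = z
  induction z with
  | zero => simp
  | add x y hx hy => simp only [map_add, hx, hy]
  | tmul v a => simp [mkA_tmul]

/-- The first factor `projR(e₍₀₎)` is right-invariant, so only `d(e₍₁₎)` is coacted on, and `d` is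
equivariant. -/
lemma coRT_obstr (e : E) :
    C.toBimodule.coRT (C.obstr e) = C.obstr.rTensor A (C.toBimodule.coR e) := by
  have key : ∀ z : E ⊗[ℂ] A, C.toBimodule.coRT (mkA A E (map C.toBimodule.projR C.d z)) =
      (mkA A E ∘ₗ map C.toBimodule.projR C.d).rTensor A
        ((TensorProduct.assoc ℂ E A A).symm ((comul (R := ℂ) (A := A)).lTensor E z)) := by
    intro z
    induction z with
    | zero => simp
    | add x y hx hy => simp only [map_add, hx, hy]
    | tmul e c =>
      simp only [LinearMap.lTensor_tmul, map_tmul, mkA_tmul, BicovariantBimodule.coRT,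
        liftA_tmulA, LinearMap.comp_apply, coR_d,
        C.toBimodule.mem_invR.1 (C.toBimodule.projR_mem e)]
      generalize (comul c : A ⊗[ℂ] A) = t
      induction t with
      | zero => simp
      | add x y hx hy => simp only [map_add, tmul_add, hx, hy]
      | tmul x y => simp
  rw [obstr, LinearMap.comp_apply, LinearMap.comp_apply, key, ← C.toBimodule.coR_coassoc,
    LinearEquiv.symm_apply_apply, ← LinearMap.comp_assoc, ← LinearMap.comp_apply,
    ← LinearMap.rTensor_comp]

/-- The torsion of a linear map `₀E → ₀E ⊗ ₀E` vanishes iff `₀σ(y) - y` is prescribed. -/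
lemma wedge_incl_add_extD_eq_zero_iff (y : C.V ⊗[ℂ] C.V) (v : C.V) :
    C.wedge (C.incl y) + C.extD v = 0 ↔ C.sigma0 y - y = -C.obstr0 v := by
  -- Writing `v = ∑ a db` gives `dv = ∧(∑ da ⊗ db)`. The torsion vanishes iff `σ` fixes `y + ∑ da ⊗
  -- db`.
  obtain ⟨x, hx⟩ := C.adb_surjective (v : E)
  rw [← hx, extD_adb, ← map_add, wedge_eq_zero_iff, ← C.incl_injective.eq_iff, map_neg,
    incl_obstr0, ← hx, ← C.sigma_dd_sub x (hx ▸ v.2), map_sub, incl_sigma0, map_add]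
  constructor
  · intro h
    rw [neg_sub, sub_eq_sub_iff_add_eq_add, h, add_comm]
  · intro h
    rw [neg_sub, sub_eq_sub_iff_add_eq_add] at h
    rw [h, add_comm]

/-- There is a torsionless linear map `₀E → ₀E ⊗ ₀E`. -/
lemma exists_torsionless : ∃ T : C.V →ₗ[ℂ] C.V ⊗[ℂ] C.V,
    ∀ v, C.sigma0 (T v) - T v = -C.obstr0 v := by
  obtain ⟨s, hs⟩ := C.adb.exists_rightInverse_of_surjective
    (LinearMap.range_eq_top.2 C.adb_surjective)
  have hs' : ∀ e, C.adb (s e) = e := LinearMap.congr_fun hs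
  -- The linear section `s` writes `v` as `∑ a db`, and `-∑ da ⊗ db` solves the equation in `E ⊗_A
  -- E`. It need not be left-invariant, so it is projected by `retr`; the equation survives because
  -- `incl ∘ retr` commutes with `σ`.
  refine ⟨-(C.toBimodule.retr ∘ₗ C.dd ∘ₗ s ∘ₗ C.V.subtype), fun v => ?_⟩
  have h := C.sigma_dd_sub (s v) (by rw [hs']; exact v.2)
  rw [hs', ← incl_obstr0] at h
  have h' := congrArg C.toBimodule.retr h
  rw [C.toBimodule.retr_incl, map_sub] at h'
  rw [← h', ← C.incl_injective.eq_iff]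
  simp only [LinearMap.neg_apply, LinearMap.comp_apply, Submodule.subtype_apply, map_neg, map_sub,
    incl_sigma0]
  rw [sigma, C.toBimodule.incl_retr_braiding_comm]
  abel

lemma incl_rTensor_injective : Function.Injective (C.incl.rTensor A) := by
  refine Function.LeftInverse.injective (g := C.toBimodule.retr.rTensor A) fun x => ?_
  rw [← LinearMap.comp_apply, ← LinearMap.rTensor_comp,
    show C.toBimodule.retr ∘ₗ C.incl = LinearMap.id from LinearMap.ext C.toBimodule.retr_incl]
  simp

lemma sigma0_intertwines :
    Intertwines C.toBimodule.coVV C.toBimodule.coVV C.sigma0 := by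
  intro y
  apply C.incl_rTensor_injective
  have h : C.incl ∘ₗ C.sigma0 = C.sigma ∘ₗ C.incl := LinearMap.ext C.incl_sigma0
  have h' := LinearMap.congr_fun (congrArg (LinearMap.rTensor A) h) (C.toBimodule.coVV y)
  rw [LinearMap.rTensor_comp, LinearMap.rTensor_comp, LinearMap.comp_apply,
    LinearMap.comp_apply] at h'
  rw [h', ← C.toBimodule.coRT_incl, ← C.toBimodule.coRT_incl, incl_sigma0]
  exact C.toBimodule.coRT_braiding _

lemma obstr0_intertwines : Intertwines C.toBimodule.coV C.toBimodule.coVV C.obstr0 := by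
  intro v
  apply C.incl_rTensor_injective
  have h : C.incl ∘ₗ C.obstr0 = C.obstr ∘ₗ C.V.subtype := LinearMap.ext C.incl_obstr0
  rw [← C.toBimodule.coRT_incl, incl_obstr0, coRT_obstr, C.toBimodule.coR_coe,
    ← LinearMap.comp_apply (C.incl.rTensor A), ← LinearMap.rTensor_comp, h,
    LinearMap.rTensor_comp]
  rfl

lemma mem_sym {y : C.V ⊗[ℂ] C.V} : y ∈ C.sym ↔ C.sigma0 y = y := by
  rw [sym_eq, Module.End.mem_eigenspace_iff, one_smul]

/-- The symmetric tensors form a subcomodule of `₀E ⊗ ₀E`. -/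
lemma isSubcomodule_sym : IsSubcomodule A C.toBimodule.coVV C.sym := by
  intro y hy
  rw [mem_sym] at hy
  have hsym : C.sym = LinearMap.ker (C.sigma0 - LinearMap.id) := by
    ext z
    rw [mem_sym, LinearMap.mem_ker, LinearMap.sub_apply,
      LinearMap.id_apply, sub_eq_zero]
  rw [hsym]
  -- By flatness the kernel of `(₀σ - 1) ⊗ id` is `sym ⊗ A`.
  refine (Module.Flat.rTensor_exact A (LinearMap.exact_subtype_ker_map _)
    (C.toBimodule.coVV y)).1 ?_
  rw [LinearMap.rTensor_sub]
  change C.sigma0.rTensor A _ - LinearMap.id.rTensor A _ = 0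
  rw [← C.sigma0_intertwines, hy]
  simp

/-! ### The metric equation, and equivariance of its solutions -/

namespace Metric

variable {C} (g : C.Metric)

/-- `(id ⊗ g) σ₁₂ : (₀E ⊗ ₀E) ⊗ ₀E → ₀E`. -/
def contractSigma : (C.V ⊗[ℂ] C.V) ⊗[ℂ] C.V →ₗ[ℂ] C.V := g.contract ∘ₗ C.sigma0.rTensor C.V

lemma contr_apply (hσ : C.IsDiagonalisable) (T : C.V →ₗ[ℂ] C.V ⊗[ℂ] C.V) (x : C.V ⊗[ℂ] C.V) :
    g.contr hσ T x = (2 : ℂ) • g.contractSigma (T.rTensor C.V (psym hσ x)) := rfl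

lemma psym_of_mem (hσ : C.IsDiagonalisable) {y : C.V ⊗[ℂ] C.V} (hy : y ∈ C.sym) :
    psym hσ y = y := by
  rw [psym, Submodule.projection_apply, Submodule.projectionOnto_apply_of_mem_left hσ.isCompl hy]

lemma psym_mem (hσ : C.IsDiagonalisable) (y : C.V ⊗[ℂ] C.V) : psym hσ y ∈ C.sym := by
  rw [psym, Submodule.projection_apply]
  exact Subtype.prop _

/-- The idempotent `₀P_sym` has range the symmetric tensors and is the identity there, so only their
images matter, and the factor `2` is invertible. -/
lemma contr_eq_zero_iff (hσ : C.IsDiagonalisable) (T : C.V →ₗ[ℂ] C.V ⊗[ℂ] C.V) :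
    g.contr hσ T = 0 ↔ ∀ y ∈ C.sym, g.contractSigma (T.rTensor C.V y) = 0 := by
  constructor
  · intro h y hy
    have := LinearMap.congr_fun h y
    rw [contr_apply, psym_of_mem hσ hy, LinearMap.zero_apply] at this
    exact (smul_eq_zero.1 this).resolve_left two_ne_zero
  · intro h
    refine LinearMap.ext fun x => ?_
    rw [contr_apply, h _ (psym_mem hσ x), smul_zero, LinearMap.zero_apply]

variable {g}

/-- Right invariance of `g` rewritten for the scalar form `g0`. Left invariance enters because it
makes `g` scalar on `₀E ⊗ ₀E`. -/
lemma IsRightInvariant.lid_g0 (hgL : g.IsLeftInvariant) (hgR : g.IsRightInvariant)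
    (y : C.V ⊗[ℂ] C.V) :
    TensorProduct.lid ℂ A (g.g0.rTensor A (C.toBimodule.coVV y)) = algebraMap ℂ A (g.g0 y) := by
  rw [← hgL.apply_incl, ← hgR, C.toBimodule.coRT_incl]
  exact congrArg _ (LinearMap.rTensor_comp_apply A (counit ∘ₗ g.toFun) C.incl _)

/-- For `v ⊗ w ⊗ z` the coaction leg is `v₍₁₎ w₍₁₎ z₍₁₎`. The adjacent legs of `w` and `z` are
absorbed by invariance of `g0`, leaving the coaction of `v`. -/
lemma contract_intertwines (hgL : g.IsLeftInvariant) (hgR : g.IsRightInvariant) :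
    Intertwines (diagCo C.toBimodule.coVV C.toBimodule.coV) C.toBimodule.coV g.contract := by
  intro t
  induction t with
  | zero => simp
  | add x y hx hy => simp only [map_add, hx, hy]
  | tmul y z =>
    induction y with
    | zero => simp
    | add x y hx hy => simp only [map_add, add_tmul, hx, hy]
    | tmul v w =>
      have h := hgR.lid_g0 hgL (w ⊗ₜ z)
      have hL : C.toBimodule.coV (g.contract ((v ⊗ₜ w) ⊗ₜ z)) =
          (LinearMap.mulRight ℂ (algebraMap ℂ A (g.g0 (w ⊗ₜ z)))).lTensor C.V
            (C.toBimodule.coV v) := by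
        rw [contract_tmul, map_smul]
        generalize C.toBimodule.coV v = x
        induction x with
        | zero => simp
        | add x y hx hy => simp only [map_add, smul_add, hx, hy]
        | tmul v a => simp [Algebra.algebraMap_eq_smul_one]
      rw [hL, ← h]
      simp only [diagCo, BicovariantBimodule.coVV, LinearMap.comp_apply, map_tmul]
      generalize C.toBimodule.coV v = x
      generalize C.toBimodule.coV w = x'
      generalize C.toBimodule.coV z = x''
      induction x with
      | zero => simp
      | add x y hx hy => simp only [map_add, add_tmul, hx, hy]
      | tmul v a =>
        simp only [LinearMap.lTensor_tmul, LinearMap.mulRight_apply]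
        induction x' with
        | zero => simp
        | add x y hx hy => simp only [map_add, add_tmul, tmul_add, mul_add, hx, hy]
        | tmul w b =>
          induction x'' with
          | zero => simp
          | add x y hx hy => simp only [map_add, tmul_add, mul_add, hx, hy]
          | tmul z c => simp [mul_assoc, smul_tmul']

lemma contractSigma_intertwines (hgL : g.IsLeftInvariant) (hgR : g.IsRightInvariant) :
    Intertwines (diagCo C.toBimodule.coVV C.toBimodule.coV) C.toBimodule.coV g.contractSigma :=
  (contract_intertwines hgL hgR).comp (C.sigma0_intertwines.rTensor _)

/-- A solution of the homogeneous torsion equation takes values in the symmetric tensors, so it lies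
in the domain of `Φ_g`, and the homogeneous metric equation puts it in the kernel. -/
lemma eq_zero_of_sym (hσ : C.IsDiagonalisable) (hΦ : Function.Injective (g.Phi hσ))
    {L : C.V →ₗ[ℂ] C.V ⊗[ℂ] C.V} (h₁ : ∀ v, C.sigma0 (L v) = L v)
    (h₂ : ∀ y ∈ C.sym, g.contractSigma (L.rTensor C.V y) = 0) : L = 0 := by
  have hL : ∀ v, L v ∈ C.sym := fun v => C.mem_sym.2 (h₁ v)
  have h0 : g.Phi hσ (L.codRestrict C.sym hL) = 0 := by
    change g.contr hσ L ∘ₗ C.sym.subtype = 0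
    rw [(g.contr_eq_zero_iff hσ L).2 h₂, LinearMap.zero_comp]
  have h0' := (map_eq_zero_iff _ hΦ).1 h0
  ext1 v
  exact congrArg Subtype.val (LinearMap.congr_fun h0' v)

/-- A solution of the torsion and metric equations on `₀E` intertwines the right coactions. -/
lemma intertwines_of_solution (hσ : C.IsDiagonalisable) (hgL : g.IsLeftInvariant)
    (hgR : g.IsRightInvariant) (hΦ : Function.Injective (g.Phi hσ))
    {T : C.V →ₗ[ℂ] C.V ⊗[ℂ] C.V} (h₁ : ∀ v, C.sigma0 (T v) - T v = -C.obstr0 v)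
    (h₂ : ∀ y ∈ C.sym, g.contractSigma (T.rTensor C.V y) = 0) :
    Intertwines C.toBimodule.coV C.toBimodule.coVV T := by
  exact intertwines_of_unique C.toBimodule.isRightComodule_coV C.sigma0_intertwines
    C.obstr0_intertwines (contractSigma_intertwines hgL hgR) C.isSubcomodule_sym
    (fun L => eq_zero_of_sym hσ hΦ) h₁ h₂

end Metric

/-! ### Connections as extensions of linear maps on `₀E` -/

lemma ext_rsmul_invL (hA : IsCosemisimple A) {N : Type*} [AddCommGroup N] [Module ℂ N]
    {φ ψ : E →ₗ[ℂ] N} (h : ∀ (v : C.V) (a : A), φ (op a • (v : E)) = ψ (op a • (v : E))) :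
    φ = ψ := by
  have : φ ∘ₗ C.toBimodule.mulR = ψ ∘ₗ C.toBimodule.mulR := TensorProduct.ext' h
  ext e
  obtain ⟨x, rfl⟩ := (C.toBimodule.mulR_bijective hA).2 e
  exact LinearMap.congr_fun this x

/-- The connection with `∇(v a) = T(v) a + v ⊗_A da` for `v` left-invariant. -/
def conn (hA : IsCosemisimple A) (T : C.V →ₗ[ℂ] C.V ⊗[ℂ] C.V) : E →ₗ[ℂ] TensorA A E :=
  lift ((rAHom A E).flip ∘ₗ C.incl ∘ₗ T + (tmulHom A E ∘ₗ C.V.subtype).compl₂ C.d) ∘ₗ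
    (LinearEquiv.ofBijective _ (C.toBimodule.mulR_bijective hA)).symm.toLinearMap

section Conn

variable {C} (hA : IsCosemisimple A) (T : C.V →ₗ[ℂ] C.V ⊗[ℂ] C.V)

lemma conn_rsmul (v : C.V) (a : A) :
    C.conn hA T (op a • (v : E)) = rA E a (C.incl (T v)) + tmulA A (v : E) (C.d a) := by
  have : (LinearEquiv.ofBijective _ (C.toBimodule.mulR_bijective hA)).symm (op a • (v : E)) =
      v ⊗ₜ a := by
    rw [LinearEquiv.symm_apply_eq]
    rfl
  rw [conn, LinearMap.comp_apply, LinearEquiv.coe_coe, this]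
  rfl

lemma conn_coe (v : C.V) : C.conn hA T (v : E) = C.incl (T v) := by
  have h := conn_rsmul hA T v 1
  have h1 : rA E (1 : A) = LinearMap.id := tensorA_ext fun e f => by simp
  rw [op_one, one_smul, d_one, h1] at h
  simpa [tmulA] using h

lemma restrict_conn : C.restrict (C.conn hA T) = T := by
  refine LinearMap.ext fun v => ?_
  rw [restrict, LinearMap.comp_apply, LinearMap.comp_apply, Submodule.subtype_apply, conn_coe,
    C.toBimodule.retr_incl]

lemma isConnection_conn : C.IsConnection (C.conn hA T) := by
  intro ρ a
  have : C.conn hA T ∘ₗ rm A E a =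
      rA E a ∘ₗ C.conn hA T + (tmulHom A E).flip (C.d a) := by
    refine C.ext_rsmul_invL hA fun v b => ?_
    simp only [LinearMap.comp_apply, rm_apply, LinearMap.add_apply, LinearMap.flip_apply,
      tmulHom_apply]
    rw [← mul_smul, ← op_mul, conn_rsmul, conn_rsmul, rA_mul, C.leibniz, map_add, rA_tmulA,
      tmulA_bal]
    simp only [← tmulHom_apply, map_add]
    abel
  exact LinearMap.congr_fun this ρ

lemma coLT_tmulA_d (v : C.V) (a : A) : C.toBimodule.coLT (tmulA A (v : E) (C.d a)) =
    (tmulHom A E (v : E) ∘ₗ C.d).lTensor A (comul a) := by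
  simp only [BicovariantBimodule.coLT, liftA_tmulA, LinearMap.comp_apply, map_tmul,
    C.toBimodule.mem_invL.1 v.2, coL_d]
  generalize (comul a : A ⊗[ℂ] A) = t
  induction t with
  | zero => simp
  | add x y hx hy => simp only [map_add, tmul_add, hx, hy]
  | tmul x y => simp [mkA_tmul]

/-- No condition on `T` is needed: `v` and `T(v)` are left-invariant, so on `v a` the left coaction
acts only through `Δ(a)` in both terms of the Leibniz formula. -/
lemma isLeftCovariant_conn : C.IsLeftCovariant (C.conn hA T) := by
  intro e
  have : C.toBimodule.coLT ∘ₗ C.conn hA T = (C.conn hA T).lTensor A ∘ₗ C.toBimodule.coL := by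
    refine C.ext_rsmul_invL hA fun v a => ?_
    simp only [LinearMap.comp_apply]
    rw [conn_rsmul, map_add, C.toBimodule.coLT_rA_incl, coLT_tmulA_d, C.toBimodule.coL_rsmul,
      C.toBimodule.mem_invL.1 v.2]
    generalize (comul a : A ⊗[ℂ] A) = t
    induction t with
    | zero => simp
    | add x y hx hy =>
      simp only [map_add, LinearMap.add_apply, ← hx, ← hy]
      abel
    | tmul x y => simp [conn_rsmul, tmul_add]
  exact LinearMap.congr_fun this e

lemma coRT_tmulA_d (v : C.V) (a : A) : C.toBimodule.coRT (tmulA A (v : E) (C.d a)) =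
    map₂ ((tmulHom A E ∘ₗ C.V.subtype).compl₂ C.d).flip (LinearMap.mul ℂ A).flip (comul a)
      (C.toBimodule.coV v) := by
  simp only [BicovariantBimodule.coRT, liftA_tmulA, LinearMap.comp_apply, map_tmul, coR_d,
    C.toBimodule.coR_coe]
  generalize (comul a : A ⊗[ℂ] A) = t
  generalize C.toBimodule.coV v = z
  induction t with
  | zero => simp
  | add x y hx hy => simp only [map_add, LinearMap.add_apply, tmul_add, hx, hy]
  | tmul x y =>
    induction z with
    | zero => simp
    | add x y hx hy => simp only [map_add, add_tmul, hx, hy]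
    | tmul v b => simp [mkA_tmul]

lemma isRightCovariant_conn (hT : Intertwines C.toBimodule.coV C.toBimodule.coVV T) :
    C.IsRightCovariant (C.conn hA T) := by
  intro e
  have : C.toBimodule.coRT ∘ₗ C.conn hA T = (C.conn hA T).rTensor A ∘ₗ C.toBimodule.coR := by
    refine C.ext_rsmul_invL hA fun v a => ?_
    simp only [LinearMap.comp_apply]
    rw [conn_rsmul, map_add, C.toBimodule.coRT_rA, C.toBimodule.coRT_incl, hT v, coRT_tmulA_d,
      C.toBimodule.coR_rsmul, C.toBimodule.coR_coe]
    generalize (comul a : A ⊗[ℂ] A) = t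
    generalize C.toBimodule.coV v = z
    induction t with
    | zero => simp
    | add x y hx hy =>
      simp only [map_add, LinearMap.add_apply, ← hx, ← hy]
      abel
    | tmul x y =>
      induction z with
      | zero => simp
      | add x y hx hy =>
        simp only [map_add, ← hx, ← hy]
        abel
      | tmul v b => simp [conn_rsmul, add_tmul]
  exact LinearMap.congr_fun this e

end Conn

/-- The graded Leibniz rule `d(ρ a) = (dρ) a - ρ ∧ da`, with `dρ` represented by `∑ da ⊗ db`. -/
lemma extD_rsmul (a : A) (x : A ⊗[ℂ] A) : C.extD (op a • C.adb x) =
    C.wedge (rA E a (C.dd x) - tmulA A (C.adb x) (C.d a)) := by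
  induction x with
  | zero => simp [tmulA]
  | add x y hx hy =>
    simp only [← tmulHom_apply] at hx hy ⊢
    simp only [map_add, smul_add, LinearMap.add_apply, hx, hy]
    rw [← map_add]
    congr 1
    abel
  | tmul b c =>
    rw [adb_tmul, rsmul_adb, map_sub, extD_smul_d, extD_smul_d, ← map_sub, C.leibniz, C.leibniz,
      dd_tmul, rA_tmulA]
    congr 1
    have h := tmulA_bal (C.d b) c (C.d a)
    simp only [← tmulHom_apply, map_add, LinearMap.add_apply] at h ⊢
    rw [h]
    abel

lemma wedge_rA_eq_zero {x : TensorA A E} (hx : C.wedge x = 0) (a : A) :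
    C.wedge (rA E a x) = 0 := by
  rw [wedge_eq_zero_iff] at hx ⊢
  rw [sigma, C.toBimodule.braiding_rA]
  exact congrArg _ hx

variable {C}

/-- The torsion of a connection is right `A`-linear: the term `ρ ⊗_A da` of the connection cancels
`-ρ ∧ da` from the exterior derivative. -/
lemma torsion_eq_zero_of_invL (hA : IsCosemisimple A) {D : E →ₗ[ℂ] TensorA A E}
    (hD : C.IsConnection D) (h : ∀ v : C.V, C.torsion D v = 0) : C.torsion D = 0 := by
  refine C.ext_rsmul_invL hA fun v a => ?_
  obtain ⟨x, hx⟩ := C.adb_surjective (v : E)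
  have hv := h v
  rw [← hx] at hv ⊢
  rw [torsion, LinearMap.add_apply, LinearMap.comp_apply, extD_adb, ← map_add] at hv
  rw [torsion, LinearMap.add_apply, LinearMap.comp_apply, hD, extD_rsmul, ← map_add,
    add_add_sub_cancel, ← map_add, C.wedge_rA_eq_zero hv, LinearMap.zero_apply]

/-! ### Existence and uniqueness of the Levi-Civita connection -/

namespace Metric

variable {g : C.Metric} (hσ : C.IsDiagonalisable)

/-- On `x` in `₀E ⊗ ₀E` the metric is scalar, so `d(g(x) a) = g(x) da` cancels the derivative term
of `Π_g`. What remains is `Π⁰_g(∇)(x) a = 0`, which is detected at `a = 1`. -/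
lemma isCompatible_iff (hgL : g.IsLeftInvariant) (D : E →ₗ[ℂ] TensorA A E) :
    g.IsCompatible hσ D ↔ g.contr hσ (C.restrict D) = 0 := by
  have key : ∀ (x : C.V ⊗[ℂ] C.V) (a : A),
      C.d (g.toFun (rA E a (C.incl x))) = g.toFun (C.incl x) • C.d a := by
    intro x a
    rw [g.map_rA, hgL.apply_incl, d_algebraMap_mul, algebraMap_smul]
  constructor
  · intro h
    refine LinearMap.ext fun x => Subtype.ext ?_
    have := h x 1
    rw [key, add_eq_right, op_one, one_smul] at this
    exact this
  · intro h x a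
    rw [key, Pi0, h]
    simp

/-- The difference of the two restrictions to `₀E` solves the homogeneous equations and vanishes.
The Leibniz rule carries the equality to all of `E = ₀E · A`. -/
lemma eq_of_isLeviCivita (hA : IsCosemisimple A) (hgL : g.IsLeftInvariant)
    (hΦ : Function.Injective (g.Phi hσ)) {D D' : E →ₗ[ℂ] TensorA A E}
    (hD : g.IsLeviCivita hσ D) (hD' : g.IsLeviCivita hσ D') : D = D' := by
  have hsol : ∀ {D : E →ₗ[ℂ] TensorA A E}, g.IsLeviCivita hσ D →
      (∀ v, C.sigma0 (C.restrict D v) - C.restrict D v = -C.obstr0 v) ∧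
        ∀ y ∈ C.sym, g.contractSigma ((C.restrict D).rTensor C.V y) = 0 := by
    intro D hD
    refine ⟨fun v => ?_, (g.contr_eq_zero_iff hσ _).1
      ((isCompatible_iff hσ hgL D).1 hD.isCompatible)⟩
    rw [← wedge_incl_add_extD_eq_zero_iff, incl_restrict hD.isLeftCovariant]
    exact LinearMap.congr_fun hD.torsion_eq_zero v
  obtain ⟨h₁, h₂⟩ := hsol hD
  obtain ⟨h₁', h₂'⟩ := hsol hD'
  have h0 : C.restrict D - C.restrict D' = 0 := by
    refine eq_zero_of_sym hσ hΦ (fun v => ?_) fun y hy => ?_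
    · change C.sigma0 (C.restrict D v - C.restrict D' v) = C.restrict D v - C.restrict D' v
      rw [map_sub, ← sub_eq_zero, sub_sub_sub_comm, h₁, h₁', sub_self]
    · rw [LinearMap.rTensor_sub]
      change g.contractSigma ((C.restrict D).rTensor C.V y - (C.restrict D').rTensor C.V y) = 0
      rw [map_sub, h₂ y hy, h₂' y hy, sub_zero]
  refine C.ext_rsmul_invL hA fun v a => ?_
  have hv : C.restrict D v - C.restrict D' v = 0 := LinearMap.congr_fun h0 v
  rw [hD.isConnection, hD'.isConnection, ← incl_restrict hD.isLeftCovariant,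
    ← incl_restrict hD'.isLeftCovariant, sub_eq_zero.1 hv]

/-- The torsion and metric equations on `₀E` have a solution. -/
lemma exists_solution (hΦ : Function.Surjective (g.Phi hσ)) :
    ∃ T : C.V →ₗ[ℂ] C.V ⊗[ℂ] C.V, (∀ v, C.sigma0 (T v) - T v = -C.obstr0 v) ∧
      ∀ y ∈ C.sym, g.contractSigma (T.rTensor C.V y) = 0 := by
  obtain ⟨T₀, hT₀⟩ := C.exists_torsionless
  obtain ⟨L, hL⟩ := hΦ (g.contr hσ T₀ ∘ₗ C.sym.subtype)
  -- The correction `L` has the same contraction as `T₀` on symmetric tensors. Its values are fixed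
  -- by `₀σ`, so subtracting it leaves the torsion equation intact.
  refine ⟨T₀ - C.sym.subtype ∘ₗ L, fun v => ?_, fun y hy => ?_⟩
  · have hs : C.sigma0 (L v : C.V ⊗[ℂ] C.V) = L v := C.mem_sym.1 (L v).2
    change C.sigma0 (T₀ v - L v) - (T₀ v - L v) = _
    rw [map_sub, hs, sub_sub_sub_cancel_right, hT₀]
  · have h := LinearMap.congr_fun hL ⟨y, hy⟩
    change g.contr hσ (C.sym.subtype ∘ₗ L) y = g.contr hσ T₀ y at h
    rw [contr_apply, contr_apply, psym_of_mem hσ hy] at h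
    have h' := smul_right_injective C.V (two_ne_zero (α := ℂ)) h
    rw [LinearMap.rTensor_sub]
    change g.contractSigma (T₀.rTensor C.V y - (C.sym.subtype ∘ₗ L).rTensor C.V y) = 0
    rw [map_sub, h', sub_self]

lemma isLeviCivita_conn (hA : IsCosemisimple A) (hgL : g.IsLeftInvariant)
    {T : C.V →ₗ[ℂ] C.V ⊗[ℂ] C.V} (h₁ : ∀ v, C.sigma0 (T v) - T v = -C.obstr0 v)
    (h₂ : ∀ y ∈ C.sym, g.contractSigma (T.rTensor C.V y) = 0) :
    g.IsLeviCivita hσ (C.conn hA T) where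
  isConnection := isConnection_conn hA T
  isLeftCovariant := isLeftCovariant_conn hA T
  torsion_eq_zero := torsion_eq_zero_of_invL hA (isConnection_conn hA T) fun v => by
    rw [torsion, LinearMap.add_apply, LinearMap.comp_apply, conn_coe]
    exact (C.wedge_incl_add_extD_eq_zero_iff _ v).2 (h₁ v)
  isCompatible := by
    rw [isCompatible_iff hσ hgL, restrict_conn]
    exact (g.contr_eq_zero_iff hσ T).2 h₂

end Metric

end BicovariantCalculus

end Bicov

end

theorem mainTheorem6 {A : Type*} [Ring A] [HopfAlgebra ℂ A] (hA : Bicov.IsCosemisimple A)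
    {E : Type*} [AddCommGroup E] [Module ℂ E] [Module A E] [Module Aᵐᵒᵖ E]
    [SMulCommClass A Aᵐᵒᵖ E] [IsScalarTower ℂ A E] [IsScalarTower ℂ Aᵐᵒᵖ E]
    (C : Bicov.BicovariantCalculus A E) (hfin : FiniteDimensional ℂ C.V)
    (hσ : C.IsDiagonalisable) (g : C.Metric)
    (hgL : g.IsLeftInvariant) (hgR : g.IsRightInvariant)
    (hΦ : Function.Bijective (g.Phi hσ)) :
    ∃ D : E →ₗ[ℂ] Bicov.TensorA A E,
      g.IsLeviCivita hσ D ∧ (∀ D', g.IsLeviCivita hσ D' → D' = D) ∧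
        C.IsLeftCovariant D ∧ C.IsRightCovariant D := by
  obtain ⟨T, h₁, h₂⟩ := Bicov.BicovariantCalculus.Metric.exists_solution hσ hΦ.2
  have hD := Bicov.BicovariantCalculus.Metric.isLeviCivita_conn hσ hA hgL h₁ h₂
  exact ⟨C.conn hA T, hD,
    fun D' hD' => Bicov.BicovariantCalculus.Metric.eq_of_isLeviCivita hσ hA hgL hΦ.1 hD' hD,
    hD.isLeftCovariant, Bicov.BicovariantCalculus.isRightCovariant_conn hA T
      (Bicov.BicovariantCalculus.Metric.intertwines_of_solution hσ hgL hgR hΦ.1 h₁ h₂)⟩
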